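/- **Conventions.** Write $\lg n=\max\{1,\log_2 n\}$. The model is the word RAM with $w$-bit words: a program is a fixed finite program, independent of $w$ and of the input, with the usual unit-cost arithmetic, bitwise, shift and comparison instructions on words; the real coordinates of points occupy one cell each and can only be copied and compared. The stored data structure is read-only for queries, and $w$ is large enough to address it, i.e. $2^w\ge Cn$ for the constant $C$ below. A point $q\in\mathbb R^2$ dominates $p$ if $p.x\le q.x$ and $p.y\le q.y$. Let $P\subset\mathbb R^2$ be a set of $n\ge 1$ points in general position (no two share an $x$-coordinate or a $y$-coordinate). A binary range tree $T$ over $P$ is a binary tree, every internal node of which has two children, whose leaves store the points of $P$, from left to right by increasing $y$-coordinate; it is stored with child pointers, the point at each leaf, and at each internal node the largest $y$-coordinate of its left subtree, its nodes being numbered arbitrarily $0,\dots,2n-2$. For a node $v$, $P(v)$ is the (not stored) list of the points at the leaf descendants of $v$ (at $v$ itself if $v$ is a leaf), sorted by increasing $x$-coordinate. **Lemma.** For every $\beta$ there is a constant $A=A(\beta)$ such that for every $\varepsilon>0$ there are a constant $C=C(\beta,\varepsilon)$ and three word RAM programs (locate, sizes, report) with the following property. For every $P$ as above with $|P|=n$,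 every binary range tree $T$ over $P$ of height at most $\beta\lg n$, and every $w$ with $2^w\ge Cn$, the stored tree $T$ can be augmented with at most $Cn$ additional words so that for every query point $q\in\mathbb R^2$, with $Q$ the region dominated by $q$, there are a set $S$ of at most $A\lg n$ nodes of $T$ and, for each $v\in S$, a nonempty prefix $L(v)$ of $P(v)$, such that the sets of points in $L(v)$, $v\in S$, are pairwise disjoint and their union is $P\cap Q$, and moreover: 1. given $q$, the program *locate* outputs $S$ in at most $A\lg n$ steps; 2. continuing from there, the program *sizes* computes all sizes $|L(v)|$, $v\in S$, in at most $A\lg n$ further steps in total; 3. given any $v\in S$ and any index $i$ of a point of $L(v)$, the program *report* outputs the $i$-th point of $L(v)$ in at most $C(\lg n)^{\varepsilon}$ steps. -/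

import Mathlib

/-! ### A word RAM

Words are `w`-bit vectors. The input points have real coordinates; a coordinate occupies one
cell, and coordinates can only be copied and compared. Programs are finite and mention neither
`w` nor the input size. -/

/-- Binary operations on machine words. -/
inductive WordOp
  | add | sub | mul | div | mod | and | or | xor | shl | shr | lt | eq

/-- The value of a word operation; arithmetic is modulo `2 ^ w`, words are unsigned, and
comparisons return `1` or `0`. -/
def WordOp.eval {w : ℕ} (o : WordOp) (a b : BitVec w) : BitVec w :=
  match o with
  | .add => a + b
  | .sub => a - b
  | .mul => a * b
  | .div => a / b
  | .mod => a % b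
  | .and => a &&& b
  | .or => a ||| b
  | .xor => a ^^^ b
  | .shl => a <<< b.toNat
  | .shr => a >>> b.toNat
  | .lt => if a.toNat < b.toNat then 1 else 0
  | .eq => if a = b then 1 else 0

/-- The stored data structure, which queries can only read: finitely many arrays of words and
finitely many arrays of coordinates. -/
structure DataMemory (w : ℕ) where
  words : List (List (BitVec w))
  coords : List (List ℝ)

/-- The working state of a query: word registers, coordinate registers and writable arrays of
words (indexed by words). A program names registers and arrays explicitly, so it uses only a
constant number of each. -/
structure RamState (w : ℕ) where
  reg : ℕ → BitVec w
  creg : ℕ → ℝ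
  work : ℕ → BitVec w → BitVec w

/-- Programs of the word RAM.
* `const r c`: set register `r` to the constant `c`;
* `op o r a b`: set register `r` to `o` of registers `a` and `b`;
* `cle r x y`: set register `r` to `1` or `0` according to whether coordinate register `x` is at
  most coordinate register `y`;
* `ccopy x y`: copy coordinate register `y` to `x`;
* `load r a i` / `cload x a i`: read the entry of stored word / coordinate array `a` whose index
  is in register `i`;
* `read r a i` / `write a i r`: read / write the entry of writable array `a` whose index is in
  register `i`;
* `seq`, `ite` (branch on register `r` being nonzero), `loop` (repeat while register `r` is
  nonzero). -/
inductive RamProg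
  | skip
  | const (r c : ℕ)
  | op (o : WordOp) (r a b : ℕ)
  | cle (r x y : ℕ)
  | ccopy (x y : ℕ)
  | load (r a i : ℕ)
  | cload (x a i : ℕ)
  | read (r a i : ℕ)
  | write (a i r : ℕ)
  | seq (c d : RamProg)
  | ite (r : ℕ) (c d : RamProg)
  | loop (r : ℕ) (c : RamProg)

namespace RamState

variable {w : ℕ}

/-- Assign a word register. -/
def setReg (s : RamState w) (r : ℕ) (v : BitVec w) : RamState w :=
  { s with reg := Function.update s.reg r v }

/-- Assign a coordinate register. -/
noncomputable def setCreg (s : RamState w) (x : ℕ) (v : ℝ) : RamState w :=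
  { s with creg := Function.update s.creg x v }

/-- Assign an entry of a writable array. -/
def setWork (s : RamState w) (a : ℕ) (i v : BitVec w) : RamState w :=
  { s with work := Function.update s.work a (Function.update (s.work a) i v) }

end RamState

/-- `RamProg.Exec D c s s' t`: on stored data `D`, program `c` started in state `s` halts in state
`s'` after exactly `t` steps. Every elementary instruction and every test costs one step. -/
inductive RamProg.Exec {w : ℕ} (D : DataMemory w) :
    RamProg → RamState w → RamState w → ℕ → Prop
  | skip (s : RamState w) : Exec D .skip s s 1
  | const (s : RamState w) (r c : ℕ) :
      Exec D (.const r c) s (s.setReg r (BitVec.ofNat w c)) 1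
  | op (s : RamState w) (o : WordOp) (r a b : ℕ) :
      Exec D (.op o r a b) s (s.setReg r (o.eval (s.reg a) (s.reg b))) 1
  | cle_true (s : RamState w) (r x y : ℕ) (h : s.creg x ≤ s.creg y) :
      Exec D (.cle r x y) s (s.setReg r 1) 1
  | cle_false (s : RamState w) (r x y : ℕ) (h : ¬ s.creg x ≤ s.creg y) :
      Exec D (.cle r x y) s (s.setReg r 0) 1
  | ccopy (s : RamState w) (x y : ℕ) :
      Exec D (.ccopy x y) s (s.setCreg x (s.creg y)) 1
  | load (s : RamState w) (r a i : ℕ) :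
      Exec D (.load r a i) s
        (s.setReg r ((D.words.getD a []).getD (s.reg i).toNat 0)) 1
  | cload (s : RamState w) (x a i : ℕ) :
      Exec D (.cload x a i) s
        (s.setCreg x ((D.coords.getD a []).getD (s.reg i).toNat 0)) 1
  | read (s : RamState w) (r a i : ℕ) :
      Exec D (.read r a i) s (s.setReg r (s.work a (s.reg i))) 1
  | write (s : RamState w) (a i r : ℕ) :
      Exec D (.write a i r) s (s.setWork a (s.reg i) (s.reg r)) 1
  | seq {c d : RamProg} {s s' s'' : RamState w} {t t' : ℕ}
      (h : Exec D c s s' t) (h' : Exec D d s' s'' t') :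
      Exec D (.seq c d) s s'' (t + t')
  | ite_true {r : ℕ} {c d : RamProg} {s s' : RamState w} {t : ℕ}
      (hr : s.reg r ≠ 0) (h : Exec D c s s' t) : Exec D (.ite r c d) s s' (t + 1)
  | ite_false {r : ℕ} {c d : RamProg} {s s' : RamState w} {t : ℕ}
      (hr : s.reg r = 0) (h : Exec D d s s' t) : Exec D (.ite r c d) s s' (t + 1)
  | loop_stop {r : ℕ} {c : RamProg} {s : RamState w}
      (hr : s.reg r = 0) : Exec D (.loop r c) s s 1
  | loop_step {r : ℕ} {c : RamProg} {s s' s'' : RamState w} {t t' : ℕ}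
      (hr : s.reg r ≠ 0) (h : Exec D c s s' t) (h' : Exec D (.loop r c) s' s'' t') :
      Exec D (.loop r c) s s'' (t + t' + 1)

/-! ### Binary range trees -/

/-- Binary trees whose leaves store points of the plane. -/
inductive RangeTree
  | leaf (p : ℝ × ℝ)
  | node (l r : RangeTree)

namespace RangeTree

/-- The points stored at the leaves, from left to right. -/
def leaves : RangeTree → List (ℝ × ℝ)
  | leaf p => [p]
  | node l r => l.leaves ++ r.leaves

/-- The height (number of edges on a longest path from the root to a leaf). -/
def height : RangeTree → ℕ
  | leaf _ => 0
  | node l r => max l.height r.height + 1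

/-- The number of nodes. -/
def numNodes : RangeTree → ℕ
  | leaf _ => 1
  | node l r => l.numNodes + r.numNodes + 1

/-- The largest `y`-coordinate stored in the tree. -/
noncomputable def maxY : RangeTree → ℝ
  | leaf p => p.2
  | node l r => max l.maxY r.maxY

/-- `T` is a binary range tree over `P`, built on the `y`-coordinates: each leaf stores a point of
`P`, and the leaves from left to right list `P` by increasing `y`-coordinate. -/
def IsOver (T : RangeTree) (P : Finset (ℝ × ℝ)) : Prop :=
  T.leaves.Pairwise (fun p p' => p.2 < p'.2) ∧ ∀ p, p ∈ T.leaves ↔ p ∈ P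

/-- The nodes of a tree: the root, and the nodes of the left and of the right subtree. -/
inductive Node : RangeTree → Type
  | root (T : RangeTree) : Node T
  | inLeft {l r : RangeTree} (v : Node l) : Node (node l r)
  | inRight {l r : RangeTree} (v : Node r) : Node (node l r)

namespace Node

/-- The subtree rooted at a node. -/
def subtree : {T : RangeTree} → Node T → RangeTree
  | T, .root _ => T
  | _, .inLeft v => v.subtree
  | _, .inRight v => v.subtree

/-- The left child of a node; a leaf has none. -/
def leftChild : {T : RangeTree} → Node T → Option (Node T)
  | .leaf _, .root _ => none
  | .node l _, .root _ => some (.inLeft (.root l))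
  | _, .inLeft v => v.leftChild.map .inLeft
  | _, .inRight v => v.leftChild.map .inRight

/-- The right child of a node; a leaf has none. -/
def rightChild : {T : RangeTree} → Node T → Option (Node T)
  | .leaf _, .root _ => none
  | .node _ r, .root _ => some (.inRight (.root r))
  | _, .inLeft v => v.rightChild.map .inLeft
  | _, .inRight v => v.rightChild.map .inRight

/-- The list `P(v)`: the points stored at the leaf descendants of `v` (at `v` itself if `v` is a
leaf), sorted by `x`-coordinate. -/
noncomputable def pointList {T : RangeTree} (v : Node T) : List (ℝ × ℝ) :=
  v.subtree.leaves.insertionSort (fun p p' => p.1 ≤ p'.1)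

/-- The pair of coordinate fields of the record of a node: the stored point at a leaf; at an
internal node the second field is the splitting value, the largest `y`-coordinate in the left
subtree, and the first is unused. -/
noncomputable def coordFields {T : RangeTree} (v : Node T) : ℝ × ℝ :=
  match v.subtree with
  | .leaf p => p
  | .node l _ => (0, l.maxY)

end Node

/-- The word in which a node (`0` for no node) is stored, when `e` numbers the nodes. -/
def nodeWord {T : RangeTree} (w : ℕ) (e : T.Node ≃ Fin T.numNodes) : Option T.Node → BitVec w
  | none => 0
  | some v => BitVec.ofNat w (e v)

/-- The memory holding the tree `T`, with nodes numbered by `e`, together with additional word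
arrays `X`. Word arrays `0`, `1`, `2` hold for each node whether it is internal, its left child
and its right child; word array `3` holds the root; `X` follows. Coordinate arrays `0` and `1`
hold the coordinate fields of the nodes. -/
noncomputable def augmented (T : RangeTree) (w : ℕ) (e : T.Node ≃ Fin T.numNodes)
    (X : List (List (BitVec w))) : DataMemory w where
  words :=
    [List.ofFn fun k => if (e.symm k).leftChild.isSome then 1 else 0,
     List.ofFn fun k => nodeWord w e (e.symm k).leftChild,
     List.ofFn fun k => nodeWord w e (e.symm k).rightChild,
     [nodeWord w e (some (.root T))]] ++ X
  coords :=
    [List.ofFn fun k => (e.symm k).coordFields.1,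
     List.ofFn fun k => (e.symm k).coordFields.2]

end RangeTree

/-! ### Dominance queries -/

/-- General position: no two points share an `x`-coordinate or a `y`-coordinate. -/
def GeneralPosition (P : Finset (ℝ × ℝ)) : Prop :=
  Set.InjOn Prod.fst (P : Set (ℝ × ℝ)) ∧ Set.InjOn Prod.snd (P : Set (ℝ × ℝ))

/-- The point `q` dominates the point `p`. -/
def Dominates (q p : ℝ × ℝ) : Prop := p.1 ≤ q.1 ∧ p.2 ≤ q.2

/-- The binary logarithm, rounded up to `1` for `n < 2`. -/
noncomputable def lg (n : ℕ) : ℝ := max 1 (Real.logb 2 n)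

/-- `S` lists, without repetition, a set of nodes, and the lists `L v`, `v ∈ S`, are nonempty
prefixes of the lists `P(v)` that partition the points of `P` dominated by `q`. -/
def IsPrefixPartition {T : RangeTree} (P : Finset (ℝ × ℝ)) (q : ℝ × ℝ)
    (S : List T.Node) (L : T.Node → List (ℝ × ℝ)) : Prop :=
  S.Nodup ∧
  (∀ v ∈ S, L v ≠ [] ∧ L v <+: v.pointList) ∧
  (∀ v ∈ S, ∀ v' ∈ S, v ≠ v' → (L v).Disjoint (L v')) ∧
  (∀ p, (p ∈ P ∧ Dominates q p) ↔ ∃ v ∈ S, p ∈ L v)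

/-- The state contains the nodes `S`: their number in register `0` and their names in writable
array `0`. -/
def RamState.HoldsNodes {w : ℕ} {T : RangeTree} (s : RamState w) (e : T.Node ≃ Fin T.numNodes)
    (S : List T.Node) : Prop :=
  s.reg 0 = BitVec.ofNat w S.length ∧
  ∀ (j : ℕ) (hj : j < S.length), s.work 0 (BitVec.ofNat w j) = BitVec.ofNat w (e S[j])

/-- The state contains, in writable array `1`, the sizes of the prefixes `L v` for `v` in `S`. -/
def RamState.HoldsSizes {w : ℕ} {T : RangeTree} (s : RamState w)
    (S : List T.Node) (L : T.Node → List (ℝ × ℝ)) : Prop :=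
  ∀ (j : ℕ) (hj : j < S.length), s.work 1 (BitVec.ofNat w j) = BitVec.ofNat w (L S[j]).length

/-! Number the leaves by increasing y. Cutting `T` at each depth gives a sequence of interval
partitions of the leaf indices in which every block splits into at most two
(`RangeTree.intervalHierarchy`). Sorting each block by x gives one permutation per level,
`blockPos`: the point of rank `i` in P(v) sits at position `v.start + i` of the level of `v`. One
bit per position records whether its point passes to the right child, and differences of bit ranks
turn a rank at `v` into ranks at its children (`Node.bitRank_add_count`). Sampled ranks, bits packed
by about half of log n, and a table of digit counts give any bit rank in constant time and O(n)
words.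

Locating. A binary search replaces the real number q.x by an integer rank. A walk from the root then
follows q.y and carries this rank along. A left subtree lying entirely below q.y goes into S, and
its rank is the length of its prefix (`StoredTree.descend_spec`). The sizes are thus a by-product of
locating, so the program for them is `skip`; nothing here depends on ε, hence neither does A.

Reporting. The position of the point is followed down to the lowest level, where it is the leaf
index. Let H be the height, k ≥ 1/ε, and B least with H < B^(k+1). With levels counted from the
bottom, single steps reach a multiple of B, and then jumps of length B^i reach a multiple of
B^(i+1), for i = 1, ..., k; the last multiple is 0. Each phase takes fewer than B moves, and B =
O((lg n)^ε) (`base_le_rpow`).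

Space for the jumps. The heart is `IntervalHierarchy.card_image_div_le`: a jump of length δ sends a
window of s consecutive positions into at most 4·2^δ + 1 windows. Blocks inside the window are
permuted within it; each of the at most two overhanging blocks splits into at most 2^δ pieces, on
which the jump is monotone and does not increase distances. A target is therefore stored as an index
into a short list belonging to its window, plus a remainder modulo s. With s = 2^((k+5)δ) both take
O(δ) bits, and only every δ-th level has such a table, so packing gives O(n) words for each δ
(`levels_mul_words_le`, `levels_mul_windows_le`).

The programs are verified by time-bounded triples `RamProg.Runs` over states of natural numbers. The
structure `StoredTree` separates them from the memory layout, and `RangeTree.exists_storedTree`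
builds the memory. -/

/-! ### Structured programs over the word RAM -/

/-- The entry `j` of the stored word array `a`, as a natural number. -/
def DataMemory.rd {w : ℕ} (D : DataMemory w) (a j : ℕ) : ℕ :=
  ((D.words.getD a []).getD j 0).toNat

/-- Word expressions over registers and stored word arrays. -/
inductive WExpr
  | reg (r : ℕ)
  | lit (c : ℕ)
  | bin (o : WordOp) (a b : WExpr)
  | ld (a : ℕ) (i : WExpr)

namespace WExpr

instance : Add WExpr := ⟨.bin .add⟩
instance : Sub WExpr := ⟨.bin .sub⟩
instance : Mul WExpr := ⟨.bin .mul⟩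
instance : Div WExpr := ⟨.bin .div⟩
instance : Mod WExpr := ⟨.bin .mod⟩

/-- Code evaluating an expression into register `k`, with the registers above `k` as scratch. -/
def compile : WExpr → ℕ → RamProg
  | reg r, k => .op .or k r r
  | lit c, k => .const k c
  | bin o a b, k => .seq (a.compile k) (.seq (b.compile (k + 1)) (.op o k k (k + 1)))
  | ld a i, k => .seq (i.compile k) (.load k a k)

/-- The number of steps of the compiled code. -/
def cost : WExpr → ℕ
  | reg _ => 1
  | lit _ => 1
  | bin _ a b => a.cost + (b.cost + 1)
  | ld _ i => i.cost + 1

/-- `Ev D ρ e n`: the expression `e` has value `n`, without overflow, when the registers below `20`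
hold the numbers `ρ`. -/
inductive Ev {w : ℕ} (D : DataMemory w) (ρ : ℕ → ℕ) : WExpr → ℕ → Prop
  | reg {r n : ℕ} (h : r < 20) (hn : ρ r = n) : Ev D ρ (reg r) n
  | lit {c : ℕ} (h : c < 2 ^ w) : Ev D ρ (lit c) c
  | add {a b : WExpr} {x y : ℕ} (ha : Ev D ρ a x) (hb : Ev D ρ b y) (h : x + y < 2 ^ w) :
      Ev D ρ (a + b) (x + y)
  | sub {a b : WExpr} {x y : ℕ} (ha : Ev D ρ a x) (hb : Ev D ρ b y) (h : y ≤ x) :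
      Ev D ρ (a - b) (x - y)
  | mul {a b : WExpr} {x y : ℕ} (ha : Ev D ρ a x) (hb : Ev D ρ b y) (h : x * y < 2 ^ w) :
      Ev D ρ (a * b) (x * y)
  | div {a b : WExpr} {x y : ℕ} (ha : Ev D ρ a x) (hb : Ev D ρ b y) : Ev D ρ (a / b) (x / y)
  | mod {a b : WExpr} {x y : ℕ} (ha : Ev D ρ a x) (hb : Ev D ρ b y) : Ev D ρ (a % b) (x % y)
  | lt {a b : WExpr} {x y : ℕ} (hw : 0 < w) (ha : Ev D ρ a x) (hb : Ev D ρ b y) :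
      Ev D ρ (bin .lt a b) (if x < y then 1 else 0)
  | ld {i : WExpr} {a x y : ℕ} (hi : Ev D ρ i x) (h : D.rd a x = y) : Ev D ρ (ld a i) y

/-- `Comp s k m s'`: the state `s'` differs from `s` only in registers from `k` on, and register
`k` holds `m`. -/
def Comp {w : ℕ} (s : RamState w) (k m : ℕ) (s' : RamState w) : Prop :=
  (s'.reg k).toNat = m ∧ (∀ r < k, s'.reg r = s.reg r) ∧ s'.creg = s.creg ∧ s'.work = s.work

/-- The right operand is evaluated from register `k + 1` on, so the left value waiting in register
`k` survives. This is the part of the correctness of compilation common to all operations. -/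
theorem exec_bin {w : ℕ} {D : DataMemory w} {a b : WExpr} {x y m k : ℕ} {s : RamState w}
    (o : WordOp)
    (ha : ∃ s', RamProg.Exec D (a.compile k) s s' a.cost ∧ Comp s k x s')
    (hb : ∀ s', Comp s k x s' →
      ∃ s'', RamProg.Exec D (b.compile (k + 1)) s' s'' b.cost ∧ Comp s' (k + 1) y s'')
    (hm : ∀ u v : BitVec w, u.toNat = x → v.toNat = y → (o.eval u v).toNat = m) :
    ∃ s', RamProg.Exec D ((bin o a b).compile k) s s' (bin o a b).cost ∧ Comp s k m s' := by
  obtain ⟨s1, e1, c1⟩ := ha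
  obtain ⟨s2, e2, c2⟩ := hb s1 c1
  refine ⟨_, .seq e1 (.seq e2 (.op s2 o k k (k + 1))), ?_, ?_, ?_, ?_⟩
  · simp only [RamState.setReg, Function.update_self]
    exact hm _ _ (by rw [c2.2.1 k (by omega), c1.1]) c2.1
  · intro r hr
    simp only [RamState.setReg]
    rw [Function.update_of_ne (by omega), c2.2.1 r (by omega), c1.2.1 r hr]
  · simp only [RamState.setReg]; rw [c2.2.2.1, c1.2.2.1]
  · simp only [RamState.setReg]; rw [c2.2.2.2, c1.2.2.2]

theorem Ev.exec {w : ℕ} {D : DataMemory w} {ρ : ℕ → ℕ} {e : WExpr} {n : ℕ} (h : Ev D ρ e n) :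
    ∀ (s : RamState w) (k : ℕ), 20 ≤ k → (∀ r < 20, (s.reg r).toNat = ρ r) →
      ∃ s', RamProg.Exec D (e.compile k) s s' e.cost ∧ Comp s k n s' := by
  -- Scratch starts at register 20 or later, so the environment `ρ` is still valid after the left
  -- operand has been evaluated.
  have lift : ∀ (s s' : RamState w) (k x : ℕ), 20 ≤ k → (∀ r < 20, (s.reg r).toNat = ρ r) →
      Comp s k x s' → ∀ r < 20, (s'.reg r).toNat = ρ r := by
    intro s s' k x hk hs c r hr
    rw [c.2.1 r (by omega), hs r hr]
  induction h with
  | @reg r n h hn =>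
    intro s k hk hs
    -- There is no move instruction; `or` of a register with itself makes a copy.
    refine ⟨_, .op s .or k r r, ?_, ?_, rfl, rfl⟩
    · simp [RamState.setReg, WordOp.eval, hs r h, hn]
    · intro r' hr; simp only [RamState.setReg]; rw [Function.update_of_ne (by omega)]
  | @lit c h =>
    intro s k hk hs
    refine ⟨_, .const s k c, ?_, ?_, rfl, rfl⟩
    · simp [RamState.setReg, Nat.mod_eq_of_lt h]
    · intro r' hr; simp only [RamState.setReg]; rw [Function.update_of_ne (by omega)]
  | @ld i a x y hi hv ih =>
    intro s k hk hs
    obtain ⟨s1, e1, c1⟩ := ih s k hk hs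
    refine ⟨_, .seq e1 (.load s1 k a k), ?_, ?_, c1.2.2.1, c1.2.2.2⟩
    · simp only [RamState.setReg, Function.update_self]
      rw [c1.1]; exact hv
    · intro r' hr; simp only [RamState.setReg]
      rw [Function.update_of_ne (by omega), c1.2.1 r' hr]
  | @add a b x y ha hb hl iha ihb =>
    intro s k hk hs
    refine exec_bin _ (iha s k hk hs)
      (fun s' c => ihb s' (k + 1) (by omega) (lift s s' k x hk hs c)) ?_
    rintro u v rfl rfl
    simp [WordOp.eval, BitVec.toNat_add, Nat.mod_eq_of_lt hl]
  | @sub a b x y ha hb hl iha ihb =>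
    intro s k hk hs
    refine exec_bin _ (iha s k hk hs)
      (fun s' c => ihb s' (k + 1) (by omega) (lift s s' k x hk hs c)) ?_
    rintro u v rfl rfl
    exact BitVec.toNat_sub_of_le (by simpa [BitVec.le_def] using hl)
  | @mul a b x y ha hb hl iha ihb =>
    intro s k hk hs
    refine exec_bin _ (iha s k hk hs)
      (fun s' c => ihb s' (k + 1) (by omega) (lift s s' k x hk hs c)) ?_
    rintro u v rfl rfl
    simp [WordOp.eval, BitVec.toNat_mul, Nat.mod_eq_of_lt hl]
  | @div a b x y ha hb iha ihb =>
    intro s k hk hs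
    refine exec_bin _ (iha s k hk hs)
      (fun s' c => ihb s' (k + 1) (by omega) (lift s s' k x hk hs c)) ?_
    rintro u v rfl rfl
    simp [WordOp.eval]
  | @mod a b x y ha hb iha ihb =>
    intro s k hk hs
    refine exec_bin _ (iha s k hk hs)
      (fun s' c => ihb s' (k + 1) (by omega) (lift s s' k x hk hs c)) ?_
    rintro u v rfl rfl
    simp [WordOp.eval]
  | @lt a b x y hw ha hb iha ihb =>
    intro s k hk hs
    refine exec_bin _ (iha s k hk hs)
      (fun s' c => ihb s' (k + 1) (by omega) (lift s s' k x hk hs c)) ?_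
    rintro u v rfl rfl
    have : 1 < 2 ^ w := Nat.one_lt_two_pow (by omega)
    simp only [WordOp.eval]
    split_ifs <;> simp [Nat.mod_eq_of_lt this]

end WExpr

/-- A state read as natural numbers. -/
structure NatState where
  reg : ℕ → ℕ
  creg : ℕ → ℝ
  work : ℕ → ℕ → ℕ

namespace NatState

def setReg (σ : NatState) (r v : ℕ) : NatState := { σ with reg := Function.update σ.reg r v }

noncomputable def setCreg (σ : NatState) (x : ℕ) (v : ℝ) : NatState :=
  { σ with creg := Function.update σ.creg x v }

def setWork (σ : NatState) (a i v : ℕ) : NatState :=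
  { σ with work := Function.update σ.work a (Function.update (σ.work a) i v) }

@[simp] theorem setReg_reg (σ : NatState) (r v : ℕ) :
    (σ.setReg r v).reg = Function.update σ.reg r v := rfl
@[simp] theorem setReg_creg (σ : NatState) (r v : ℕ) : (σ.setReg r v).creg = σ.creg := rfl
@[simp] theorem setReg_work (σ : NatState) (r v : ℕ) : (σ.setReg r v).work = σ.work := rfl
@[simp] theorem setCreg_reg (σ : NatState) (x : ℕ) (v : ℝ) : (σ.setCreg x v).reg = σ.reg := rfl
@[simp] theorem setCreg_creg (σ : NatState) (x : ℕ) (v : ℝ) :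
    (σ.setCreg x v).creg = Function.update σ.creg x v := rfl
@[simp] theorem setCreg_work (σ : NatState) (x : ℕ) (v : ℝ) : (σ.setCreg x v).work = σ.work := rfl
@[simp] theorem setWork_reg (σ : NatState) (a i v : ℕ) : (σ.setWork a i v).reg = σ.reg := rfl
@[simp] theorem setWork_creg (σ : NatState) (a i v : ℕ) : (σ.setWork a i v).creg = σ.creg := rfl
@[simp] theorem setWork_work (σ : NatState) (a i v : ℕ) :
    (σ.setWork a i v).work = Function.update σ.work a (Function.update (σ.work a) i v) := rfl

/-- The machine state `s` is described by `σ` (registers from `20` on are scratch). -/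
def Rep {w : ℕ} (s : RamState w) (σ : NatState) : Prop :=
  (∀ r < 20, (s.reg r).toNat = σ.reg r) ∧ s.creg = σ.creg ∧
    ∀ a i, i < 2 ^ w → (s.work a (BitVec.ofNat w i)).toNat = σ.work a i

/-- The description of a machine state. -/
def ofState {w : ℕ} (s : RamState w) : NatState where
  reg r := (s.reg r).toNat
  creg := s.creg
  work a i := (s.work a (BitVec.ofNat w i)).toNat

theorem rep_ofState {w : ℕ} (s : RamState w) : Rep s (ofState s) :=
  ⟨fun _ _ => rfl, rfl, fun _ _ _ => rfl⟩

end NatState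

namespace RamProg

open NatState

variable {w : ℕ} {D : DataMemory w}

/-- Started in a state described by `σ`, the program halts within `T` steps in a state described by
some `σ'` with `Q σ'`. -/
def Runs (D : DataMemory w) (c : RamProg) (σ : NatState) (T : ℕ) (Q : NatState → Prop) : Prop :=
  ∀ s : RamState w, Rep s σ → ∃ (s' : RamState w) (t : ℕ),
    Exec D c s s' t ∧ t ≤ T ∧ ∃ σ', Rep s' σ' ∧ Q σ'

theorem Runs.mono {c : RamProg} {σ : NatState} {T T' : ℕ} {Q Q' : NatState → Prop}
    (h : Runs D c σ T Q) (hT : T ≤ T') (hQ : ∀ σ, Q σ → Q' σ) : Runs D c σ T' Q' := by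
  intro s hs
  obtain ⟨s', t, e, ht, σ', r, q⟩ := h s hs
  exact ⟨s', t, e, ht.trans hT, σ', r, hQ _ q⟩

theorem Runs.skip {σ : NatState} {Q : NatState → Prop} (h : Q σ) : Runs D .skip σ 1 Q :=
  fun s hs => ⟨s, 1, .skip s, le_rfl, σ, hs, h⟩

/-- The postcondition of the first program is itself a triple for the second, so specifications
chain without naming the intermediate state, and the time bounds add up. -/
theorem Runs.seq {c d : RamProg} {σ : NatState} {T T' : ℕ} {Q : NatState → Prop}
    (h : Runs D c σ T (fun σ' => Runs D d σ' T' Q)) : Runs D (.seq c d) σ (T + T') Q := by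
  intro s hs
  obtain ⟨s', t, e, ht, σ', r, q⟩ := h s hs
  obtain ⟨s'', t', e', ht', q'⟩ := q s' r
  exact ⟨s'', _, .seq e e', by omega, q'⟩

/-- Assign the value of an expression to a register. -/
def asg (r : ℕ) (e : WExpr) : RamProg := .seq (e.compile 20) (.op .or r 20 20)

theorem Runs.asg {r n : ℕ} {e : WExpr} {σ : NatState} {Q : NatState → Prop}
    (he : e.Ev D σ.reg n) (h : Q (σ.setReg r n)) : Runs D (asg r e) σ (e.cost + 1) Q := by
  intro s hs
  obtain ⟨s1, e1, c1⟩ := he.exec s 20 le_rfl hs.1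
  refine ⟨_, _, .seq e1 (.op s1 .or r 20 20), le_rfl, _, ⟨?_, ?_, ?_⟩, h⟩
  · intro r' hr'
    by_cases hrr : r' = r
    · subst hrr; simp [RamState.setReg, WordOp.eval, c1.1]
    · simp [RamState.setReg, Function.update_of_ne hrr, c1.2.1 r' hr', hs.1 r' hr']
  · simp [RamState.setReg, c1.2.2.1, hs.2.1]
  · intro a i hi
    simp [RamState.setReg, c1.2.2.2, hs.2.2 a i hi]

/-- Read an entry of a stored coordinate array. -/
def cget (x a : ℕ) (e : WExpr) : RamProg := .seq (e.compile 20) (.cload x a 20)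

theorem Runs.cget {x a n : ℕ} {e : WExpr} {σ : NatState} {Q : NatState → Prop}
    (he : e.Ev D σ.reg n) (h : Q (σ.setCreg x ((D.coords.getD a []).getD n 0))) :
    Runs D (cget x a e) σ (e.cost + 1) Q := by
  intro s hs
  obtain ⟨s1, e1, c1⟩ := he.exec s 20 le_rfl hs.1
  refine ⟨_, _, .seq e1 (.cload s1 x a 20), le_rfl, _, ⟨?_, ?_, ?_⟩, h⟩
  · intro r' hr'
    simp [RamState.setCreg, c1.2.1 r' hr', hs.1 r' hr']
  · simp [RamState.setCreg, c1.2.2.1, hs.2.1, c1.1]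
  · intro a i hi
    simp [RamState.setCreg, c1.2.2.2, hs.2.2 a i hi]

/-- Write the value of `f` to the entry `e` of a writable array. -/
def put (a : ℕ) (e f : WExpr) : RamProg :=
  .seq (e.compile 20) (.seq (f.compile 21) (.write a 20 21))

theorem Runs.put {a i v : ℕ} {e f : WExpr} {σ : NatState} {Q : NatState → Prop}
    (he : e.Ev D σ.reg i) (hf : f.Ev D σ.reg v) (h : Q (σ.setWork a i v)) :
    Runs D (put a e f) σ (e.cost + (f.cost + 1)) Q := by
  intro s hs
  obtain ⟨s1, e1, c1⟩ := he.exec s 20 le_rfl hs.1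
  obtain ⟨s2, e2, c2⟩ := hf.exec s1 21 (by omega)
    (fun r hr => by rw [c1.2.1 r hr, hs.1 r hr])
  have hi20 : s2.reg 20 = BitVec.ofNat w i := by
    rw [c2.2.1 20 (by omega), ← c1.1, BitVec.ofNat_toNat, BitVec.setWidth_eq]
  refine ⟨_, _, .seq e1 (.seq e2 (.write s2 a 20 21)), le_rfl, _, ⟨?_, ?_, ?_⟩, h⟩
  · intro r' hr'
    simp [RamState.setWork, c2.2.1 r' (by omega), c1.2.1 r' hr', hs.1 r' hr']
  · simp [RamState.setWork, c2.2.2.1, c1.2.2.1, hs.2.1]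
  · intro a' j hj
    have hiw : i < 2 ^ w := by rw [← c1.1]; exact (s1.reg 20).isLt
    simp only [RamState.setWork, hi20, NatState.setWork]
    by_cases haa : a' = a
    · subst haa
      simp only [Function.update_self]
      by_cases hij : j = i
      · subst hij; simp [c2.1]
      -- Both indices are below 2^w, so different indices address different cells.
      · have : BitVec.ofNat w j ≠ BitVec.ofNat w i := by
          intro hc
          have := congrArg BitVec.toNat hc
          rw [BitVec.toNat_ofNat, BitVec.toNat_ofNat, Nat.mod_eq_of_lt hj,
            Nat.mod_eq_of_lt hiw] at this
          exact hij this
        rw [Function.update_of_ne this, Function.update_of_ne hij, c2.2.2.2, c1.2.2.2,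
          hs.2.2 a' j hj]
    · rw [Function.update_of_ne haa, Function.update_of_ne haa, c2.2.2.2, c1.2.2.2,
        hs.2.2 a' j hj]

open Classical in
theorem Runs.cle {r x y : ℕ} {σ : NatState} {Q : NatState → Prop} (hw : 0 < w)
    (h : Q (σ.setReg r (if σ.creg x ≤ σ.creg y then 1 else 0))) : Runs D (.cle r x y) σ 1 Q := by
  intro s hs
  have h1 : 1 < 2 ^ w := Nat.one_lt_two_pow (by omega)
  have key : ∀ v : BitVec w, v.toNat = (if σ.creg x ≤ σ.creg y then 1 else 0) →
      Rep (s.setReg r v) (σ.setReg r (if σ.creg x ≤ σ.creg y then 1 else 0)) := by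
    intro v hv
    refine ⟨?_, by simp [RamState.setReg, hs.2.1], ?_⟩
    · intro r' hr'
      by_cases hrr : r' = r
      · subst hrr; simp [RamState.setReg, hv]
      · simp [RamState.setReg, Function.update_of_ne hrr, hs.1 r' hr']
    · intro a i hi
      simp [RamState.setReg, hs.2.2 a i hi]
  by_cases hc : s.creg x ≤ s.creg y
  · refine ⟨_, 1, .cle_true s r x y hc, le_rfl, _, key 1 ?_, h⟩
    rw [← hs.2.1, if_pos hc]; simp [Nat.mod_eq_of_lt h1]
  · refine ⟨_, 1, .cle_false s r x y hc, le_rfl, _, key 0 ?_, h⟩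
    rw [← hs.2.1, if_neg hc]; simp

theorem Runs.ite {r : ℕ} {c d : RamProg} {σ : NatState} {T : ℕ} {Q : NatState → Prop}
    (hr : r < 20) (hc : σ.reg r ≠ 0 → Runs D c σ T Q) (hd : σ.reg r = 0 → Runs D d σ T Q) :
    Runs D (.ite r c d) σ (T + 1) Q := by
  intro s hs
  by_cases h : σ.reg r = 0
  · obtain ⟨s', t, e, ht, q⟩ := hd h s hs
    refine ⟨s', _, .ite_false ?_ e, by omega, q⟩
    rw [← hs.1 r hr] at h
    exact BitVec.eq_of_toNat_eq (by simpa using h)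
  · obtain ⟨s', t, e, ht, q⟩ := hc h s hs
    refine ⟨s', _, .ite_true ?_ e, by omega, q⟩
    rw [← hs.1 r hr] at h
    intro h0; rw [h0] at h; simp at h

theorem Runs.loop_done {r : ℕ} {c : RamProg} {σ : NatState} {Q : NatState → Prop}
    (hr : r < 20) (h0 : σ.reg r = 0) (h : Q σ) : Runs D (.loop r c) σ 1 Q := by
  intro s hs
  refine ⟨s, 1, RamProg.Exec.loop_stop ?_, le_rfl, σ, hs, h⟩
  rw [← hs.1 r hr] at h0
  exact BitVec.eq_of_toNat_eq (by simpa using h0)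

theorem Runs.loop_step {r : ℕ} {c : RamProg} {σ : NatState} {T T' : ℕ} {Q : NatState → Prop}
    (hr : r < 20) (h0 : σ.reg r ≠ 0) (h : Runs D c σ T (fun σ' => Runs D (.loop r c) σ' T' Q)) :
    Runs D (.loop r c) σ (T + T' + 1) Q := by
  intro s hs
  obtain ⟨s', t, e, ht, σ', r', q⟩ := h s hs
  obtain ⟨s'', t', e', ht', q'⟩ := q s' r'
  refine ⟨s'', _, .loop_step ?_ e e', by omega, q'⟩
  rw [← hs.1 r hr] at h0
  intro h1; rw [h1] at h0; simp at h0

/-- The loop rule: `I m` is an invariant whose rank `m` decreases. -/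
theorem Runs.loop {r : ℕ} {c : RamProg} {T : ℕ} (I : ℕ → NatState → Prop) (hr : r < 20)
    (hbody : ∀ m σ, I m σ → σ.reg r ≠ 0 → Runs D c σ T (fun σ' => ∃ m' < m, I m' σ')) :
    ∀ m σ, I m σ →
      Runs D (.loop r c) σ (m * (T + 1) + 1) (fun σ' => (∃ m', I m' σ') ∧ σ'.reg r = 0) := by
  intro m
  induction m using Nat.strong_induction_on with
  | _ m ih =>
    intro σ hI
    by_cases h0 : σ.reg r = 0
    · exact (Runs.loop_done (Q := fun σ' => (∃ m', I m' σ') ∧ σ'.reg r = 0) hr h0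
        ⟨⟨m, hI⟩, h0⟩).mono (by omega) (fun _ h => h)
    · rcases Nat.eq_zero_or_pos m with rfl | hm
      -- Rank 0 with a nonzero flag cannot occur: the body would produce a rank below 0.
      · intro s hs
        obtain ⟨s', t, e, ht, σ', r', m', hm', _⟩ := hbody 0 σ hI h0 s hs
        omega
      · have := Runs.loop_step (T' := (m - 1) * (T + 1) + 1) hr h0
          ((hbody m σ hI h0).mono le_rfl (fun σ' ⟨m', hm', hI'⟩ =>
            (ih m' hm' σ' hI').mono (by
              have : m' * (T + 1) ≤ (m - 1) * (T + 1) := Nat.mul_le_mul_right _ (by omega)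
              omega) (fun _ h => h)))
        refine this.mono ?_ (fun _ h => h)
        obtain ⟨m, rfl⟩ : ∃ k, m = k + 1 := ⟨m - 1, by omega⟩
        simp only [Nat.add_sub_cancel]
        ring_nf; omega

end RamProg

/-! ### Hierarchies of interval partitions -/

/-- `st d r` is the left end of the block of `r` in the `d`-th of a sequence of interval partitions
of `ℕ`, each block of which splits into at most two blocks of the next partition. -/
structure IntervalHierarchy (st : ℕ → ℕ → ℕ) : Prop where
  mono : ∀ d r r', r ≤ r' → st d r ≤ st d r'
  le : ∀ d r, st d r ≤ r
  idem : ∀ d r, st d (st d r) = st d r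
  refine : ∀ d r, st d (st (d + 1) r) = st d r
  split : ∀ d a, ∃ m, ∀ r, st d r = a → st (d + 1) r = a ∨ st (d + 1) r = m

/-- The elements of `[0, n)` in the block at `a` of the `d`-th partition whose key is below `t`. -/
def blockBelow (n : ℕ) (st : ℕ → ℕ → ℕ) (xr : ℕ → ℕ) (d a t : ℕ) : Finset ℕ :=
  (Finset.range n).filter (fun r => st d r = a ∧ xr r < t)

/-- The position of `r` when each block of the `d`-th partition is sorted by the keys `xr`. -/
def blockPos (n : ℕ) (st : ℕ → ℕ → ℕ) (xr : ℕ → ℕ) (d r : ℕ) : ℕ :=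
  st d r + (blockBelow n st xr d (st d r) (xr r)).card

/-- Whether the element at position `p` of the `d`-th order leaves the first block when its block is
split. -/
def splitBit (n : ℕ) (st : ℕ → ℕ → ℕ) (xr : ℕ → ℕ) (d p : ℕ) : Prop :=
  ∃ r < n, blockPos n st xr d r = p ∧ st (d + 1) r ≠ st d r

open Classical in
/-- The number of positions before `p` whose bit is set. -/
noncomputable def bitRank (n : ℕ) (st : ℕ → ℕ → ℕ) (xr : ℕ → ℕ) (d p : ℕ) : ℕ :=
  ((Finset.range p).filter (splitBit n st xr d)).card

theorem mem_blockBelow {n : ℕ} {st : ℕ → ℕ → ℕ} {xr : ℕ → ℕ} {d a t r : ℕ} :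
    r ∈ blockBelow n st xr d a t ↔ r < n ∧ st d r = a ∧ xr r < t := by
  simp [blockBelow]

/-- The element `r` itself is counted only on the right. Hence ranks within a block increase
strictly with the key. -/
theorem blockBelow_card_lt {n : ℕ} {st : ℕ → ℕ → ℕ} {xr : ℕ → ℕ} {d a t r : ℕ} (hr : r < n)
    (ha : st d r = a) (ht : xr r < t) :
    (blockBelow n st xr d a (xr r)).card < (blockBelow n st xr d a t).card := by
  refine Finset.card_lt_card (Finset.ssubset_iff_of_subset ?_ |>.2 ⟨r, ?_, ?_⟩)
  · intro x; simp only [mem_blockBelow]; rintro ⟨h1, h2, h3⟩; exact ⟨h1, h2, by omega⟩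
  · simp [mem_blockBelow, hr, ha, ht]
  · simp [mem_blockBelow]

theorem bitRank_succ_of {n : ℕ} {st : ℕ → ℕ → ℕ} {xr : ℕ → ℕ} {d p : ℕ}
    (h : splitBit n st xr d p) : bitRank n st xr d (p + 1) = bitRank n st xr d p + 1 := by
  classical
  unfold bitRank
  rw [Finset.range_add_one, Finset.filter_insert, if_pos h, Finset.card_insert_of_notMem (by simp)]

theorem bitRank_succ_of_not {n : ℕ} {st : ℕ → ℕ → ℕ} {xr : ℕ → ℕ} {d p : ℕ}
    (h : ¬ splitBit n st xr d p) : bitRank n st xr d (p + 1) = bitRank n st xr d p := by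
  classical
  unfold bitRank
  rw [Finset.range_add_one, Finset.filter_insert, if_neg h]

theorem bitRank_le {n : ℕ} {st : ℕ → ℕ → ℕ} {xr : ℕ → ℕ} (d p : ℕ) :
    bitRank n st xr d p ≤ p := by
  classical
  exact (Finset.card_filter_le _ _).trans (by simp)

/-- Everything lies in `{min, min + 1}`. It is applied to the quotients by `s` of positions at most
`s` apart. -/
theorem Finset.card_le_two_of_close (V : Finset ℕ) (hV : ∀ x ∈ V, ∀ y ∈ V, y ≤ x + 1) :
    V.card ≤ 2 := by
  rcases V.eq_empty_or_nonempty with rfl | hne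
  · simp
  · have : V ⊆ {V.min' hne, V.min' hne + 1} := by
      intro y hy
      have h1 := V.min'_le y hy
      have h2 := hV _ (V.min'_mem hne) y hy
      simp only [Finset.mem_insert, Finset.mem_singleton]; omega
    exact (Finset.card_le_card this).trans Finset.card_le_two

namespace IntervalHierarchy

open Finset

variable {st : ℕ → ℕ → ℕ} {n : ℕ} {xr : ℕ → ℕ}

theorem between (h : IntervalHierarchy st) {d a x y z : ℕ} (hx : st d x = a) (hz : st d z = a)
    (hxy : x ≤ y) (hyz : y ≤ z) : st d y = a :=
  le_antisymm (hz ▸ h.mono d y z hyz) (hx ▸ h.mono d x y hxy)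

theorem refine_add (h : IntervalHierarchy st) (d k r : ℕ) : st d (st (d + k) r) = st d r := by
  induction k generalizing r with
  | zero => exact h.idem d r
  | succ k ih =>
    rw [← ih (st (d + (k + 1)) r), ← Nat.add_assoc, h.refine, ih]

/-- A block is an interval beginning at `st d r`. If the offset `c` left it, the whole block would
fit into `c` positions. -/
theorem add_lt_of_lt_card (h : IntervalHierarchy st) {d r c : ℕ}
    (hc : c < ((range n).filter (fun r' => st d r' = st d r)).card) :
    st d r + c < n ∧ st d (st d r + c) = st d r := by
  by_contra hcon
  have hsub : (range n).filter (fun r' => st d r' = st d r) ⊆ Ico (st d r) (st d r + c) := by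
    intro x hx
    simp only [mem_filter, mem_range] at hx
    have h1 : st d r ≤ x := hx.2 ▸ h.le d x
    simp only [mem_Ico]
    refine ⟨h1, ?_⟩
    by_contra hlt
    exact hcon ⟨by omega, h.between (h.idem d r) hx.2 (by omega) (by omega)⟩
  have := card_le_card hsub
  simp at this
  omega

/-- The elements with smaller key omit `r`, so they are fewer than the block. Sorting thus permutes
every block within its own interval. -/
theorem blockPos_mem (h : IntervalHierarchy st) {d r : ℕ} (hr : r < n) :
    blockPos n st xr d r < n ∧ st d (blockPos n st xr d r) = st d r := by
  refine h.add_lt_of_lt_card (card_lt_card ((ssubset_iff_of_subset ?_).2 ⟨r, ?_, ?_⟩))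
  · intro x; simp only [mem_blockBelow, mem_filter, mem_range]; tauto
  · simp [hr]
  · simp [mem_blockBelow]

/-- The position determines the block, since it lies in it, and the offset inside the block
determines the key. -/
theorem blockPos_injOn (h : IntervalHierarchy st) (hxr : Set.InjOn xr (range n)) (d : ℕ) :
    Set.InjOn (blockPos n st xr d) (range n) := by
  intro r hr r' hr' e
  have hr : r < n := by simpa using hr
  have hr' : r' < n := by simpa using hr'
  have hst : st d r = st d r' := by
    rw [← (h.blockPos_mem (xr := xr) hr).2, e, (h.blockPos_mem hr').2]
  have hc : (blockBelow n st xr d (st d r') (xr r)).card =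
      (blockBelow n st xr d (st d r') (xr r')).card := by
    unfold blockPos at e; rw [hst] at e; omega
  rcases lt_trichotomy (xr r) (xr r') with hlt | heq | hlt
  · have := blockBelow_card_lt (n := n) (st := st) (d := d) hr hst hlt; omega
  · exact hxr (by simpa using hr) (by simpa using hr') heq
  · have := blockBelow_card_lt (n := n) (st := st) (d := d) hr' rfl hlt; omega

/-- One inclusion is monotonicity of ranks; injectivity makes the two sides equally large. A
threshold on keys becomes an initial segment of the block, which is what allows counting by bit
ranks. -/
theorem image_blockPos (h : IntervalHierarchy st) (hxr : Set.InjOn xr (range n)) (d a t : ℕ) :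
    (blockBelow n st xr d a t).image (blockPos n st xr d) =
      Ico a (a + (blockBelow n st xr d a t).card) := by
  refine eq_of_subset_of_card_le ?_ ?_
  · intro p hp
    obtain ⟨r, hr, rfl⟩ := mem_image.1 hp
    obtain ⟨h1, h2, h3⟩ := mem_blockBelow.1 hr
    have := blockBelow_card_lt (n := n) (st := st) (d := d) h1 h2 h3
    simp only [mem_Ico, blockPos, h2]
    omega
  · rw [card_image_of_injOn]
    · simp
    · exact (h.blockPos_injOn hxr d).mono (fun x hx => by
        simpa using (mem_blockBelow.1 hx).1)

theorem splitBit_blockPos (h : IntervalHierarchy st) (hxr : Set.InjOn xr (range n)) {d r : ℕ}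
    (hr : r < n) : splitBit n st xr d (blockPos n st xr d r) ↔ st (d + 1) r ≠ st d r := by
  constructor
  · rintro ⟨r', hr', e, hne⟩
    rwa [h.blockPos_injOn hxr d (by simpa using hr') (by simpa using hr) e] at hne
  · exact fun hne => ⟨r, hr, rfl, hne⟩

/-- The set bits among the first positions of a block count the elements leaving its first half. -/
theorem bitRank_add (h : IntervalHierarchy st) (hxr : Set.InjOn xr (range n)) (d a t : ℕ) :
    bitRank n st xr d (a + (blockBelow n st xr d a t).card) =
      bitRank n st xr d a + ((blockBelow n st xr d a t).filter (fun r => st (d + 1) r ≠ a)).card := by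
  classical
  have e1 : range (a + (blockBelow n st xr d a t).card) =
      range a ∪ Ico a (a + (blockBelow n st xr d a t).card) := by
    ext x; simp only [mem_range, mem_union, mem_Ico]; omega
  unfold bitRank
  rw [e1, filter_union, card_union_of_disjoint]
  · congr 1
    rw [← h.image_blockPos hxr, filter_image, card_image_of_injOn]
    · congr 1
      refine filter_congr (fun r hr => ?_)
      obtain ⟨h1, h2, h3⟩ := mem_blockBelow.1 hr
      rw [h.splitBit_blockPos hxr h1, h2]
    · exact (h.blockPos_injOn hxr d).mono (fun x hx => by
        simpa using (mem_blockBelow.1 (mem_filter.1 hx).1).1)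
  · refine disjoint_filter_filter (disjoint_left.2 fun x hx hx' => ?_)
    simp only [mem_range, mem_Ico] at hx hx'
    omega

/-- By `split`, each further level at most doubles the number of blocks met. -/
theorem card_image_le_two_pow (h : IntervalHierarchy st) (d a k : ℕ) (s : Finset ℕ)
    (hs : ∀ r ∈ s, st d r = a) : (s.image (st (d + k))).card ≤ 2 ^ k := by
  classical
  induction k with
  | zero =>
    refine (card_le_card (t := {a}) ?_).trans (by simp)
    intro x hx
    obtain ⟨r, hr, rfl⟩ := mem_image.1 hx
    simp [hs r hr]
  | succ k ih =>
    choose m hm using h.split (d + k)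
    have hsub : s.image (st (d + (k + 1))) ⊆ (s.image (st (d + k))).biUnion (fun u => {u, m u}) := by
      intro x hx
      obtain ⟨r, hr, rfl⟩ := mem_image.1 hx
      simp only [mem_biUnion, mem_image, mem_insert, mem_singleton]
      exact ⟨_, ⟨r, hr, rfl⟩, hm _ r rfl⟩
    calc _ ≤ _ := card_le_card hsub
      _ ≤ (s.image (st (d + k))).card * 2 := card_biUnion_le_card_mul _ _ _ (fun u _ => card_le_two)
      _ ≤ 2 ^ k * 2 := Nat.mul_le_mul_right _ ih
      _ = 2 ^ (k + 1) := (pow_succ 2 k).symm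

/-- Elements of one block of a finer partition are at most as far apart in the finer order. -/
theorem blockPos_add_le (h : IntervalHierarchy st) {d k r r' : ℕ}
    (hst : st (d + k) r = st (d + k) r') (hx : xr r ≤ xr r') :
    blockPos n st xr (d + k) r' + blockPos n st xr d r ≤
      blockPos n st xr (d + k) r + blockPos n st xr d r' := by
  have hd : st d r = st d r' := by rw [← h.refine_add d k r, hst, h.refine_add]
  -- The distance of the two positions counts the keys between them in their block; a block of the
  -- finer partition contains fewer such elements than the coarser block around it.
  have key : ∀ d' a, (blockBelow n st xr d' a (xr r')).card = (blockBelow n st xr d' a (xr r)).card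
      + ((range n).filter (fun x => st d' x = a ∧ xr r ≤ xr x ∧ xr x < xr r')).card := by
    intro d' a
    rw [← card_union_of_disjoint]
    · congr 1
      ext x; simp only [blockBelow, mem_filter, mem_range, mem_union]; omega
    · refine disjoint_left.2 fun x hx hx' => ?_
      simp only [blockBelow, mem_filter, mem_range] at hx hx'
      omega
  unfold blockPos
  rw [hd, hst, key, key]
  have : ((range n).filter (fun x => st (d + k) x = st (d + k) r' ∧ xr r ≤ xr x ∧ xr x < xr r')).card
      ≤ ((range n).filter (fun x => st d x = st d r' ∧ xr r ≤ xr x ∧ xr x < xr r')).card := by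
    refine card_le_card (fun x => ?_)
    simp only [mem_filter, mem_range]
    rintro ⟨h1, h2, h3⟩
    exact ⟨h1, by rw [← h.refine_add d k x, h2, h.refine_add], h3⟩
  omega

/-- Moving from one order to a finer one, a window of `s` positions is sent to few windows. -/
theorem card_image_div_le (h : IntervalHierarchy st) (d k s j : ℕ) (hs : 0 < s) :
    (((range n).filter (fun r => blockPos n st xr d r / s = j)).image
      (fun r => blockPos n st xr (d + k) r / s)).card ≤ 4 * 2 ^ k + 1 := by
  classical
  set R := (range n).filter (fun r => blockPos n st xr d r / s = j) with hR
  have hwin : ∀ r ∈ R, r < n ∧ j * s ≤ blockPos n st xr d r ∧ blockPos n st xr d r ≤ j * s + s - 1 := by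
    intro r hr
    obtain ⟨h1, h2⟩ := mem_filter.1 hr
    have h3 := Nat.div_mul_le_self (blockPos n st xr d r) s
    have h4 := Nat.lt_div_mul_add hs (a := blockPos n st xr d r)
    rw [h2] at h3 h4
    exact ⟨by simpa using h1, h3, by omega⟩
  -- One coarse block meets at most 2^k finer blocks. In each of these the positions spread over at
  -- most `s`, because distances do not grow, so they produce at most two quotients.
  have part : ∀ a, ((R.filter (fun r => st d r = a)).image
      (fun r => blockPos n st xr (d + k) r / s)).card ≤ 2 * 2 ^ k := by
    intro a
    set Ra := R.filter (fun r => st d r = a) with hRa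
    have hsub : Ra.image (fun r => blockPos n st xr (d + k) r / s) ⊆
        (Ra.image (st (d + k))).biUnion (fun u => (Ra.filter (fun r => st (d + k) r = u)).image
          (fun r => blockPos n st xr (d + k) r / s)) := by
      intro x hx
      obtain ⟨r, hr, rfl⟩ := mem_image.1 hx
      refine mem_biUnion.2 ⟨_, mem_image_of_mem _ hr, mem_image.2 ⟨r, ?_, rfl⟩⟩
      simp [hr]
    calc _ ≤ _ := card_le_card hsub
      _ ≤ (Ra.image (st (d + k))).card * 2 := by
        refine card_biUnion_le_card_mul _ _ _ (fun u _ => card_le_two_of_close _ ?_)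
        intro x hx y hy
        obtain ⟨r, hr, rfl⟩ := mem_image.1 hx
        obtain ⟨r', hr', rfl⟩ := mem_image.1 hy
        obtain ⟨hr1, hr2⟩ := mem_filter.1 hr
        obtain ⟨hr1', hr2'⟩ := mem_filter.1 hr'
        have w := hwin r (mem_filter.1 hr1).1
        have w' := hwin r' (mem_filter.1 hr1').1
        have hle : blockPos n st xr (d + k) r' ≤ blockPos n st xr (d + k) r + s := by
          rcases le_total (xr r) (xr r') with hx | hx
          · have := h.blockPos_add_le (n := n) (d := d) (hr2.trans hr2'.symm) hx
            omega
          -- With the keys in the other order, `r'` does not come after `r` at all.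
          · have e := hr2.trans hr2'.symm
            have : (blockBelow n st xr (d + k) (st (d + k) r') (xr r')).card ≤
                (blockBelow n st xr (d + k) (st (d + k) r') (xr r)).card :=
              card_le_card (fun z => by simp only [mem_blockBelow]; omega)
            unfold blockPos
            rw [e]; omega
        calc blockPos n st xr (d + k) r' / s ≤ (blockPos n st xr (d + k) r + s) / s :=
              Nat.div_le_div_right hle
          _ = _ := Nat.add_div_right _ hs
      _ ≤ 2 ^ k * 2 := Nat.mul_le_mul_right _
          (h.card_image_le_two_pow d a k _ (fun r hr => (mem_filter.1 hr).2))
      _ = 2 * 2 ^ k := Nat.mul_comm _ _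
  -- Only the blocks of the first and of the last position of the window can reach outside it.
  have hsub : R.image (fun r => blockPos n st xr (d + k) r / s) ⊆
      ((R.filter (fun r => st d r = st d (j * s))).image (fun r => blockPos n st xr (d + k) r / s) ∪
       (R.filter (fun r => st d r = st d (j * s + s - 1))).image
          (fun r => blockPos n st xr (d + k) r / s)) ∪ {j} := by
    intro x hx
    obtain ⟨r, hr, rfl⟩ := mem_image.1 hx
    simp only [mem_union, mem_singleton]
    by_cases c1 : st d r = st d (j * s)
    · exact .inl (.inl (mem_image.2 ⟨r, by simp [hr, c1], rfl⟩))
    by_cases c2 : st d r = st d (j * s + s - 1)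
    · exact .inl (.inr (mem_image.2 ⟨r, by simp [hr, c2], rfl⟩))
    -- Any other block met lies inside the window, and its elements stay in it at the finer level,
    -- so the quotient is `j` again.
    right
    obtain ⟨w0, w1, w2⟩ := hwin r hr
    have hp := (h.blockPos_mem (xr := xr) (d := d) w0).2
    have hp' : st d (blockPos n st xr (d + k) r) = st d r := by
      rw [← h.refine_add d k, (h.blockPos_mem w0).2, h.refine_add]
    have l1 : j * s ≤ blockPos n st xr (d + k) r := by
      by_contra hc
      exact c1 (h.between hp' hp (by omega) w1).symm
    have l2 : blockPos n st xr (d + k) r < j * s + s := by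
      by_contra hc
      exact c2 (h.between hp hp' w2 (by omega)).symm
    exact Nat.div_eq_of_lt_le l1 (by rw [Nat.succ_mul]; exact l2)
  calc _ ≤ _ := card_le_card hsub
    _ ≤ _ := card_union_le _ _
    _ ≤ (2 * 2 ^ k + 2 * 2 ^ k) + 1 :=
      Nat.add_le_add ((card_union_le _ _).trans (Nat.add_le_add (part _) (part _))) (by simp)
    _ = _ := by ring

end IntervalHierarchy

/-! ### The interval hierarchy of a range tree -/

theorem List.countP_range_eq_card (n : ℕ) (p : ℕ → Prop) [DecidablePred p] :
    (List.range n).countP (fun i => decide (p i)) = ((Finset.range n).filter p).card := by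
  rw [← Nat.count_eq_card_filter_range]; rfl

/-- Once `p` fails at an entry it fails at all later ones, so nothing after the first failure is
kept. -/
theorem List.Pairwise.filter_prefix {α : Type*} {R : α → α → Prop} (p : α → Bool)
    (hp : ∀ a b, R a b → p b → p a) {l : List α} (h : l.Pairwise R) : l.filter p <+: l := by
  induction h with
  | nil => simp
  | @cons a l ha _ ih =>
    by_cases hpa : p a
    · rw [List.filter_cons_of_pos hpa]; exact (List.prefix_cons_inj a).2 ih
    · rw [List.filter_cons_of_neg hpa, List.filter_eq_nil_iff.2 (fun b hb hpb => hpa (hp a b (ha b hb) hpb))]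
      exact List.nil_prefix

theorem List.countP_lt_getElem_of_pairwise {α : Type*} (f : α → ℝ) {l : List α}
    (h : l.Pairwise (fun a b => f a < f b)) (i : ℕ) (hi : i < l.length) :
    l.countP (fun a => decide (f a < f l[i])) = i := by
  have h1 : (l.take i).countP (fun a => decide (f a < f l[i])) = i := by
    have : (l.take i).countP (fun a => decide (f a < f l[i])) = (l.take i).length := by
      rw [List.countP_eq_length]
      intro a ha
      obtain ⟨j, hj, rfl⟩ := List.mem_take_iff_getElem.1 ha
      simpa using List.pairwise_iff_getElem.1 h j i (by omega) hi (by omega)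
    rw [this, List.length_take]; omega
  have h2 : (l.drop i).countP (fun a => decide (f a < f l[i])) = 0 := by
    rw [List.countP_eq_zero]
    intro a ha
    obtain ⟨j, hj, rfl⟩ := List.mem_drop_iff_getElem.1 ha
    rcases Nat.eq_zero_or_pos j with rfl | hj0
    · simp
    · have := List.pairwise_iff_getElem.1 h i (i + j) hi (by omega) (by omega)
      simp [this.le]
  have h3 := List.countP_append (p := fun a => decide (f a < f l[i])) (l₁ := l.take i)
    (l₂ := l.drop i)
  rw [List.take_append_drop] at h3
  omega

namespace RangeTree

/-- The left end of the block of leaf `i` when the tree is cut at depth `d`. -/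
def blockStart : RangeTree → ℕ → ℕ → ℕ
  | leaf _, _, _ => 0
  | node _ _, 0, _ => 0
  | node l r, d + 1, i =>
    if i < l.leaves.length then l.blockStart d i
    else l.leaves.length + r.blockStart d (i - l.leaves.length)

@[simp] theorem blockStart_zero (T : RangeTree) (i : ℕ) : T.blockStart 0 i = 0 := by
  cases T <;> rfl

theorem leaves_length_pos (T : RangeTree) : 0 < T.leaves.length := by
  induction T with
  | leaf p => simp [leaves]
  | node l r hl hr => simp [leaves]; omega

theorem numNodes_add_one (T : RangeTree) : T.numNodes + 1 = 2 * T.leaves.length := by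
  induction T with
  | leaf p => simp [leaves, numNodes]
  | node l r hl hr => simp [leaves, numNodes]; omega

/-- Below the root, the hierarchies of the two subtrees stand side by side, the right one shifted by
the number of left leaves. Indices beyond the last leaf fall into the rightmost block, so the axioms
hold on all of ℕ; the block of a leaf never splits. -/
theorem intervalHierarchy (T : RangeTree) : IntervalHierarchy T.blockStart := by
  induction T with
  | leaf p => constructor <;> simp [blockStart]
              exact fun _ => ⟨0, fun h => .inl h⟩
  | node l r hl hr =>
    have hz : ∀ i, (node l r).blockStart 0 i = 0 := blockStart_zero _
    have hs : ∀ d i, (node l r).blockStart (d + 1) i = if i < l.leaves.length then l.blockStart d i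
        else l.leaves.length + r.blockStart d (i - l.leaves.length) := fun d i => rfl
    have hll := hl.le
    have hrl := hr.le
    constructor
    · rintro (_ | d) i j hij
      · simp
      · simp only [hs]
        split_ifs with h1 h2 h2
        · exact hl.mono d i j hij
        · have := hll d i; omega
        · omega
        · have := hr.mono d (i - l.leaves.length) (j - l.leaves.length) (by omega); omega
    · rintro (_ | d) i
      · simp
      · simp only [hs]
        split_ifs with h1
        · exact hll d i
        · have := hrl d (i - l.leaves.length); omega
    · rintro (_ | d) i
      · simp
      · by_cases h1 : i < l.leaves.length
        · have := hll d i
          simp only [hs, h1, if_true]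
          rw [if_pos (by omega), hl.idem]
        · simp only [hs, h1, if_false]
          rw [if_neg (by omega), Nat.add_sub_cancel_left, hr.idem]
    · rintro (_ | d) i
      · simp
      · by_cases h1 : i < l.leaves.length
        · have := hll (d + 1) i
          simp only [hs, h1, if_true]
          rw [if_pos (by omega), hl.refine]
        · simp only [hs, h1, if_false]
          rw [if_neg (by omega), Nat.add_sub_cancel_left, hr.refine]
    · rintro (_ | d) a
      · refine ⟨l.leaves.length, fun i hi => ?_⟩
        simp only [hz] at hi
        simp only [hs, blockStart_zero]
        split_ifs <;> simp [hi]
      · by_cases ha : a < l.leaves.length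
        · obtain ⟨m, hm⟩ := hl.split d a
          refine ⟨m, fun i hi => ?_⟩
          simp only [hs] at hi ⊢
          split_ifs at hi ⊢ with h1
          · exact hm i hi
          · omega
        · obtain ⟨m, hm⟩ := hr.split d (a - l.leaves.length)
          refine ⟨l.leaves.length + m, fun i hi => ?_⟩
          simp only [hs] at hi ⊢
          split_ifs at hi ⊢ with h1
          · have := hll d i; omega
          · have := hm (i - l.leaves.length) (by omega); omega

/-- Cutting at the height or lower isolates every leaf. A position at the last level is therefore
the leaf index itself, which is where reporting ends. -/
theorem blockStart_of_height_le (T : RangeTree) :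
    ∀ d, T.height ≤ d → ∀ i < T.leaves.length, T.blockStart d i = i := by
  induction T with
  | leaf p => intro d _ i hi; simp [leaves] at hi; simp [blockStart, hi]
  | node l r hl hr =>
    rintro (_ | d) hd i hi
    · simp [height] at hd
    · simp only [height] at hd
      simp only [leaves, List.length_append] at hi
      simp only [blockStart]
      split_ifs with h1
      · exact hl d (by omega) i h1
      · rw [hr d (by omega) _ (by omega)]; omega

/-- The `i`-th leaf. -/
noncomputable def leafAt (T : RangeTree) (i : ℕ) : ℝ × ℝ := T.leaves.getD i (0, 0)

/-- The rank of the `i`-th leaf in the order of `x`-coordinates. -/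
noncomputable def xRank (T : RangeTree) (i : ℕ) : ℕ :=
  ((Finset.range T.leaves.length).filter (fun j => (T.leafAt j).1 < (T.leafAt i).1)).card

/-- The number of points with `x`-coordinate at most `x`. -/
noncomputable def xCount (T : RangeTree) (x : ℝ) : ℕ :=
  ((Finset.range T.leaves.length).filter (fun j => (T.leafAt j).1 ≤ x)).card

theorem xCount_le (T : RangeTree) (x : ℝ) : T.xCount x ≤ T.leaves.length :=
  (Finset.card_filter_le _ _).trans (by simp)

/-- From here on the real number `x` of the query is replaced by the integer threshold `xCount x` on
ranks. Strictness comes from leaf `i`, which only `xCount` counts. -/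
theorem xRank_lt_xCount (T : RangeTree) {i : ℕ} (hi : i < T.leaves.length) (x : ℝ) :
    T.xRank i < T.xCount x ↔ (T.leafAt i).1 ≤ x := by
  constructor
  · intro hlt
    by_contra hc
    refine absurd (Finset.card_le_card ?_) (not_le.2 hlt)
    intro j
    simp only [Finset.mem_filter]
    exact fun h => ⟨h.1, h.2.trans_lt (not_le.1 hc)⟩
  · intro hle
    refine Finset.card_lt_card ((Finset.ssubset_iff_of_subset ?_).2 ⟨i, ?_, ?_⟩)
    · intro j; simp only [Finset.mem_filter]; exact fun h => ⟨h.1, h.2.le.trans hle⟩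
    · simp [hi, hle]
    · simp

theorem xRank_lt_xRank (T : RangeTree) {i j : ℕ} (hi : i < T.leaves.length) :
    T.xRank i < T.xRank j ↔ (T.leafAt i).1 < (T.leafAt j).1 := by
  constructor
  · intro hlt
    by_contra hc
    refine absurd (Finset.card_le_card ?_) (not_le.2 hlt)
    intro k
    simp only [Finset.mem_filter]
    exact fun h => ⟨h.1, h.2.trans_le (not_lt.1 hc)⟩
  · intro hle
    refine Finset.card_lt_card ((Finset.ssubset_iff_of_subset ?_).2 ⟨i, ?_, ?_⟩)
    · intro k; simp only [Finset.mem_filter]; exact fun h => ⟨h.1, h.2.trans hle⟩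
    · simp [hi, hle]
    · simp

theorem xRank_lt (T : RangeTree) {i : ℕ} (hi : i < T.leaves.length) :
    T.xRank i < T.leaves.length := by
  have : T.xRank i < T.xCount (T.leafAt i).1 := (T.xRank_lt_xCount hi _).2 le_rfl
  exact this.trans_le (T.xCount_le _)

/-- The points of the tree have distinct `x`-coordinates. -/
def XInj (T : RangeTree) : Prop :=
  Set.InjOn (fun i => (T.leafAt i).1) (Finset.range T.leaves.length)

theorem XInj.xRank_injOn {T : RangeTree} (h : T.XInj) :
    Set.InjOn T.xRank (Finset.range T.leaves.length) := by
  intro i hi j hj e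
  have hi' : i < T.leaves.length := by simpa using hi
  have hj' : j < T.leaves.length := by simpa using hj
  refine h hi hj (le_antisymm ?_ ?_)
  · by_contra hc; have := (T.xRank_lt_xRank hj').2 (not_le.1 hc); omega
  · by_contra hc; have := (T.xRank_lt_xRank hi').2 (not_le.1 hc); omega

/-- Every rank below the number of points is attained. -/
theorem XInj.exists_xRank {T : RangeTree} (h : T.XInj) {j : ℕ} (hj : j < T.leaves.length) :
    ∃ i < T.leaves.length, T.xRank i = j := by
  have := Finset.surj_on_of_inj_on_of_card_le (s := Finset.range T.leaves.length)
    (t := Finset.range T.leaves.length) (fun i _ => T.xRank i)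
    (fun i hi => by simpa using T.xRank_lt (by simpa using hi))
    (fun i k hi hk e => h.xRank_injOn (by simpa using hi) (by simpa using hk) e) le_rfl
    j (by simpa using hj)
  obtain ⟨i, hi, e⟩ := this
  exact ⟨i, by simpa using hi, e.symm⟩

/-! ### Nodes as blocks of the hierarchy, and ranks at nodes -/

namespace Node

/-- The index of the first leaf below a node. -/
def start : {T : RangeTree} → Node T → ℕ
  | _, .root _ => 0
  | _, .inLeft v => v.start
  | .node l _, .inRight v => l.leaves.length + v.start

/-- The depth of a node. -/
def depth : {T : RangeTree} → Node T → ℕ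
  | _, .root _ => 0
  | _, .inLeft v => v.depth + 1
  | _, .inRight v => v.depth + 1

/-- The number of leaves below a node. -/
def size {T : RangeTree} (v : Node T) : ℕ := v.subtree.leaves.length

theorem size_pos {T : RangeTree} (v : Node T) : 0 < v.size := leaves_length_pos _

theorem depth_add_height {T : RangeTree} (v : Node T) : v.depth + v.subtree.height ≤ T.height := by
  induction v with
  | root T => simp [depth, subtree]
  | inLeft v ih => simp only [depth, subtree, height]; omega
  | inRight v ih => simp only [depth, subtree, height]; omega

theorem leaves_eq {T : RangeTree} (v : Node T) :
    ∃ l₁ l₂, T.leaves = l₁ ++ v.subtree.leaves ++ l₂ ∧ l₁.length = v.start := by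
  induction v with
  | root T => exact ⟨[], [], by simp [subtree], rfl⟩
  | @inLeft l r v ih =>
    obtain ⟨l₁, l₂, e, hl⟩ := ih
    exact ⟨l₁, l₂ ++ r.leaves, by simp [leaves, subtree, e], hl⟩
  | @inRight l r v ih =>
    obtain ⟨l₁, l₂, e, hl⟩ := ih
    exact ⟨l.leaves ++ l₁, l₂, by simp [leaves, subtree, e], by simp [start, hl]⟩

theorem start_add_size_le {T : RangeTree} (v : Node T) : v.start + v.size ≤ T.leaves.length := by
  obtain ⟨l₁, l₂, e, hl⟩ := v.leaves_eq
  rw [e]; simp [size, ← hl]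

theorem start_lt {T : RangeTree} (v : Node T) : v.start < T.leaves.length := by
  have := v.start_add_size_le; have := v.size_pos; omega

theorem subtree_leaves {T : RangeTree} (v : Node T) :
    v.subtree.leaves = (List.range v.size).map (fun j => T.leafAt (v.start + j)) := by
  obtain ⟨l₁, l₂, e, hl⟩ := v.leaves_eq
  refine List.ext_getElem (by simp [size]) fun i h1 h2 => ?_
  simp only [List.getElem_map, List.getElem_range, leafAt, e, ← hl]
  rw [List.append_assoc, List.getD_eq_getElem _ _ (by simp; omega), List.getElem_append_right (by omega)]
  simp [List.getElem_append_left, h1]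

theorem mem_subtree_leaves {T : RangeTree} (v : Node T) (p : ℝ × ℝ) :
    p ∈ v.subtree.leaves ↔ ∃ i, v.start ≤ i ∧ i < v.start + v.size ∧ T.leafAt i = p := by
  rw [subtree_leaves]
  simp only [List.mem_map, List.mem_range]
  constructor
  · rintro ⟨j, hj, rfl⟩; exact ⟨_, by omega, by omega, rfl⟩
  · rintro ⟨i, h1, h2, rfl⟩; exact ⟨i - v.start, by omega, by congr 1; omega⟩

/-- This identifies the leaves below `v` with a block at the level of `v`. The bound on `i` excludes
the superfluous indices in the rightmost block. -/
theorem blockStart_eq_iff {T : RangeTree} (v : Node T) {i : ℕ} (hi : i < T.leaves.length) :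
    T.blockStart v.depth i = v.start ↔ v.start ≤ i ∧ i < v.start + v.size := by
  induction v generalizing i with
  | root T => simp [depth, start, size, subtree, hi]
  | @inLeft l r v ih =>
    have h1 := v.start_add_size_le
    have h2 : (inLeft (r := r) v).size = v.size := rfl
    have h3 := v.size_pos
    simp only [depth, start, blockStart, h2]
    split_ifs with hl
    · exact ih hl
    · omega
  | @inRight l r v ih =>
    have h2 : (inRight (l := l) v).size = v.size := rfl
    simp only [leaves, List.length_append] at hi
    simp only [depth, start, blockStart, h2]
    split_ifs with hl
    · have := l.intervalHierarchy.le v.depth i; omega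
    · have := ih (i := i - l.leaves.length) (by omega)
      omega

theorem children_leaf {T : RangeTree} (v : Node T) {p : ℝ × ℝ} (hv : v.subtree = leaf p) :
    v.leftChild = none ∧ v.rightChild = none := by
  induction v with
  | root T => simp only [subtree] at hv; subst hv; exact ⟨rfl, rfl⟩
  | inLeft v ih => simp [leftChild, rightChild, ih hv]
  | inRight v ih => simp [leftChild, rightChild, ih hv]

theorem children_node {T : RangeTree} (v : Node T) {l r : RangeTree} (hv : v.subtree = node l r) :
    ∃ vl vr : Node T, v.leftChild = some vl ∧ v.rightChild = some vr ∧
      vl.subtree = l ∧ vr.subtree = r ∧ vl.depth = v.depth + 1 ∧ vr.depth = v.depth + 1 ∧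
      vl.start = v.start ∧ vr.start = v.start + vl.size ∧ v.size = vl.size + vr.size := by
  induction v with
  | root T =>
    simp only [subtree] at hv; subst hv
    exact ⟨.inLeft (.root l), .inRight (.root r), rfl, rfl, rfl, rfl, rfl, rfl, rfl,
      by simp [start, size, subtree], by simp [size, subtree, leaves]⟩
  | inLeft v ih =>
    obtain ⟨vl, vr, h1, h2, h3, h4, h5, h6, h7, h8, h9⟩ := ih hv
    exact ⟨.inLeft vl, .inLeft vr, by simp [leftChild, h1], by simp [rightChild, h2], h3, h4,
      by simp [depth, h5], by simp [depth, h6], h7, h8, h9⟩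
  | @inRight l' r' v ih =>
    obtain ⟨vl, vr, h1, h2, h3, h4, h5, h6, h7, h8, h9⟩ := ih hv
    refine ⟨.inRight vl, .inRight vr, by simp [leftChild, h1], by simp [rightChild, h2], h3, h4,
      by simp [depth, h5], by simp [depth, h6], by simp [start, h7], ?_, h9⟩
    have : (inRight (l := l') vl).size = vl.size := rfl
    simp only [start, this]; omega

theorem exists_leaf {T : RangeTree} (i : ℕ) (hi : i < T.leaves.length) :
    ∃ u : Node T, u.start = i ∧ u.subtree = leaf (T.leafAt i) := by
  induction T generalizing i with
  | leaf p =>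
    simp [leaves] at hi
    exact ⟨.root _, by simp [start, hi], by simp [subtree, leafAt, leaves, hi]⟩
  | node l r hl hr =>
    simp only [leaves, List.length_append] at hi
    by_cases h1 : i < l.leaves.length
    · obtain ⟨u, e, s⟩ := hl i h1
      refine ⟨.inLeft u, e, ?_⟩
      simp only [subtree, s, leafAt, leaves, List.getD_append _ _ _ _ h1]
    · obtain ⟨u, e, s⟩ := hr (i - l.leaves.length) (by omega)
      refine ⟨.inRight u, by simp only [start]; omega, ?_⟩
      simp only [subtree, s, leafAt, leaves, List.getD_append_right _ _ _ _ (not_lt.1 h1)]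

/-- The number of points below `v` whose `x`-rank is below `t`. -/
noncomputable def count {T : RangeTree} (v : Node T) (t : ℕ) : ℕ :=
  (blockBelow T.leaves.length T.blockStart T.xRank v.depth v.start t).card

theorem mem_blockBelow_node {T : RangeTree} (v : Node T) {i t : ℕ} :
    i ∈ blockBelow T.leaves.length T.blockStart T.xRank v.depth v.start t ↔
      v.start ≤ i ∧ i < v.start + v.size ∧ T.xRank i < t := by
  have := v.start_add_size_le
  rw [mem_blockBelow]
  constructor
  · rintro ⟨h1, h2, h3⟩
    have := (v.blockStart_eq_iff h1).1 h2
    exact ⟨this.1, this.2, h3⟩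
  · rintro ⟨h1, h2, h3⟩
    exact ⟨by omega, (v.blockStart_eq_iff (by omega)).2 ⟨h1, h2⟩, h3⟩

theorem count_le_size {T : RangeTree} (v : Node T) (t : ℕ) : v.count t ≤ v.size := by
  refine (Finset.card_le_card (t := Finset.Ico v.start (v.start + v.size)) ?_).trans (by simp)
  intro i hi
  have := v.mem_blockBelow_node.1 hi
  simp; omega

/-- The ranks form a bijection onto an initial segment of ℕ. This gives the value with which the
descent starts. -/
theorem count_root {T : RangeTree} {t : ℕ} (ht : t ≤ T.leaves.length) (h : T.XInj) :
    (root T).count t = t := by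
  have : (blockBelow T.leaves.length T.blockStart T.xRank (root T).depth (root T).start t).image
      T.xRank = Finset.range t := by
    ext j
    simp only [Finset.mem_image, Finset.mem_range]
    constructor
    · rintro ⟨i, hi, rfl⟩; exact (mem_blockBelow.1 hi).2.2
    · intro hj
      obtain ⟨i, hi, e⟩ := h.exists_xRank (j := j) (by omega)
      exact ⟨i, mem_blockBelow.2 ⟨hi, by simp [depth, start], by omega⟩, e⟩
  rw [count, ← Finset.card_image_of_injOn (f := T.xRank), this, Finset.card_range]
  exact h.xRank_injOn.mono (fun i hi => by simpa using (mem_blockBelow.1 hi).1)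

/-- The left child keeps the left end of the block of `v`, so the elements whose block start changes
are those of the right child. -/
theorem count_children {T : RangeTree} (v vl vr : Node T) (t : ℕ)
    (h1 : vl.depth = v.depth + 1) (h3 : vl.start = v.start)
    (h4 : vr.start = v.start + vl.size) (h5 : v.size = vl.size + vr.size) :
    v.count t = vl.count t + vr.count t ∧
    ((blockBelow T.leaves.length T.blockStart T.xRank v.depth v.start t).filter
      (fun r => T.blockStart (v.depth + 1) r ≠ v.start)).card = vr.count t := by
  have hsp := vl.size_pos
  constructor
  · unfold count
    rw [← Finset.card_union_of_disjoint]
    · congr 1; ext i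
      simp only [Finset.mem_union, mem_blockBelow_node]; omega
    · refine Finset.disjoint_left.2 fun i hi hi' => ?_
      simp only [mem_blockBelow_node] at hi hi'; omega
  · unfold count
    congr 1; ext i
    have hv := v.start_add_size_le
    simp only [Finset.mem_filter, mem_blockBelow_node]
    constructor
    · rintro ⟨⟨a1, a2, a3⟩, a4⟩
      have := vl.blockStart_eq_iff (i := i) (by omega)
      rw [h1, h3] at this
      have := this.not.1 a4
      omega
    · rintro ⟨a1, a2, a3⟩
      refine ⟨⟨by omega, by omega, a3⟩, fun hc => ?_⟩
      have := vl.blockStart_eq_iff (i := i) (by omega)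
      rw [h1, h3] at this
      have := this.1 hc
      omega

/-- The rank of a query in the right child, read off from the split bits. -/
theorem bitRank_add_count {T : RangeTree} (hT : T.XInj) (v vl vr : Node T) (t : ℕ)
    (h1 : vl.depth = v.depth + 1) (h3 : vl.start = v.start)
    (h4 : vr.start = v.start + vl.size) (h5 : v.size = vl.size + vr.size) :
    bitRank T.leaves.length T.blockStart T.xRank v.depth (v.start + v.count t) =
      bitRank T.leaves.length T.blockStart T.xRank v.depth v.start + vr.count t := by
  rw [← (count_children v vl vr t h1 h3 h4 h5).2]
  exact T.intervalHierarchy.bitRank_add hT.xRank_injOn _ _ _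

/-- A bridge from lists of points to sets of leaf indices. The predicate is general because it
serves both the closed condition defining prefixes and the strict one giving the index of a point.
-/
theorem countP_subtree {T : RangeTree} (v : Node T) (t : ℕ) (p : ℝ × ℝ → Prop) [DecidablePred p]
    (hp : ∀ i < T.leaves.length, T.xRank i < t ↔ p (T.leafAt i)) :
    v.subtree.leaves.countP (fun a => decide (p a)) = v.count t := by
  have hv := v.start_add_size_le
  rw [subtree_leaves, List.countP_map]
  have : ((fun a => decide (p a)) ∘ fun j => T.leafAt (v.start + j)) =
    fun j => decide (p (T.leafAt (v.start + j))) := rfl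
  rw [this, List.countP_range_eq_card, count]
  refine Finset.card_bij (fun j _ => v.start + j) ?_ ?_ ?_
  · intro j hj
    simp only [Finset.mem_filter, Finset.mem_range] at hj
    rw [mem_blockBelow_node, hp _ (by omega)]
    exact ⟨by omega, by omega, hj.2⟩
  · intro a _ b _ e; omega
  · intro i hi
    obtain ⟨a1, a2, a3⟩ := v.mem_blockBelow_node.1 hi
    refine ⟨i - v.start, ?_, by omega⟩
    simp only [Finset.mem_filter, Finset.mem_range]
    rw [hp _ (by omega)] at a3
    exact ⟨by omega, by rwa [Nat.add_sub_cancel' a1]⟩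

theorem pointList_perm {T : RangeTree} (v : Node T) : v.pointList.Perm v.subtree.leaves :=
  List.perm_insertionSort _ _

theorem pointList_pairwise_le {T : RangeTree} (v : Node T) :
    v.pointList.Pairwise (fun a b => a.1 ≤ b.1) := by
  have : Std.Total (fun a b : ℝ × ℝ => a.1 ≤ b.1) := ⟨fun a b => le_total a.1 b.1⟩
  have : IsTrans (ℝ × ℝ) (fun a b : ℝ × ℝ => a.1 ≤ b.1) := ⟨fun _ _ _ => le_trans⟩
  exact List.pairwise_insertionSort _ _

theorem pointList_pairwise {T : RangeTree} (hT : T.XInj) (v : Node T) :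
    v.pointList.Pairwise (fun a b => a.1 < b.1) := by
  have hne : v.subtree.leaves.Pairwise (fun a b => a.1 ≠ b.1) := by
    have hv := v.start_add_size_le
    rw [subtree_leaves, List.pairwise_map]
    refine (List.nodup_range (n := v.size)).imp_of_mem ?_
    intro a b ha hb hab e
    simp only [List.mem_range] at ha hb
    have := hT (x₁ := v.start + a) (x₂ := v.start + b) (by simp; omega) (by simp; omega) e
    omega
  have hne' : v.pointList.Pairwise (fun a b => a.1 ≠ b.1) :=
    (v.pointList_perm.pairwise_iff (fun h => h.symm)).2 hne
  exact (v.pointList_pairwise_le.and hne').imp (fun h => lt_of_le_of_ne h.1 h.2)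

/-- The points of `P(v)` with `x`-coordinate at most `x`. -/
noncomputable def prefixList {T : RangeTree} (x : ℝ) (v : Node T) : List (ℝ × ℝ) :=
  v.pointList.filter (fun p => decide (p.1 ≤ x))

theorem prefixList_prefix {T : RangeTree} (x : ℝ) (v : Node T) :
    v.prefixList x <+: v.pointList :=
  v.pointList_pairwise_le.filter_prefix _ (fun a b hab hb => by
    simp only [decide_eq_true_eq] at hb ⊢; exact hab.trans hb)

theorem mem_prefixList {T : RangeTree} (x : ℝ) (v : Node T) (p : ℝ × ℝ) :
    p ∈ v.prefixList x ↔ p ∈ v.subtree.leaves ∧ p.1 ≤ x := by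
  simp [prefixList, v.pointList_perm.mem_iff]

theorem prefixList_length {T : RangeTree} (x : ℝ) (v : Node T) :
    (v.prefixList x).length = v.count (T.xCount x) := by
  rw [prefixList, ← List.countP_eq_length_filter, v.pointList_perm.countP_eq,
    v.countP_subtree (T.xCount x) (fun p => p.1 ≤ x) (fun i hi => T.xRank_lt_xCount hi x)]

/-- The `i`-th point of `P(v)` is the leaf whose key has rank `i` among the leaves below `v`. -/
theorem pointList_getElem {T : RangeTree} (hT : T.XInj) (v : Node T) (i : ℕ)
    (hi : i < v.pointList.length) :
    ∃ r, v.start ≤ r ∧ r < v.start + v.size ∧ T.leafAt r = v.pointList[i] ∧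
      v.count (T.xRank r) = i := by
  have hv := v.start_add_size_le
  obtain ⟨r, h1, h2, h3⟩ := (v.mem_subtree_leaves _).1 (v.pointList_perm.mem_iff.1
    (List.getElem_mem hi))
  refine ⟨r, h1, h2, h3, ?_⟩
  rw [← v.countP_subtree (T.xRank r) (fun p => p.1 < (T.leafAt r).1)
    (fun j hj => T.xRank_lt_xRank hj), ← v.pointList_perm.countP_eq, h3]
  exact List.countP_lt_getElem_of_pairwise Prod.fst (v.pointList_pairwise hT) i hi

end Node

theorem maxY_le_iff (T : RangeTree) (y : ℝ) : T.maxY ≤ y ↔ ∀ p ∈ T.leaves, p.2 ≤ y := by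
  induction T with
  | leaf p => simp [maxY, leaves]
  | node l r hl hr => simp only [maxY, max_le_iff, hl, hr, leaves, List.mem_append]; aesop

theorem exists_maxY (T : RangeTree) : ∃ p ∈ T.leaves, p.2 = T.maxY := by
  induction T with
  | leaf p => simp [maxY, leaves]
  | node l r hl hr =>
    obtain ⟨a, ha, ea⟩ := hl
    obtain ⟨b, hb, eb⟩ := hr
    rcases max_choice l.maxY r.maxY with h | h
    · exact ⟨a, by simp [leaves, ha], by simp [maxY, h, ea]⟩
    · exact ⟨b, by simp [leaves, hb], by simp [maxY, h, eb]⟩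

end RangeTree

/-! ### Packed tables -/

/-- The first `K` values of `g` as the digits of a number in base `M`. -/
def packDigits (M : ℕ) (g : ℕ → ℕ) : ℕ → ℕ
  | 0 => 0
  | K + 1 => packDigits M g K + g K * M ^ K

theorem packDigits_lt {M : ℕ} {g : ℕ → ℕ} (hg : ∀ j, g j < M) (K : ℕ) :
    packDigits M g K < M ^ K := by
  induction K with
  | zero => simp [packDigits]
  | succ K ih =>
    have h1 : (g K + 1) * M ^ K ≤ M * M ^ K := Nat.mul_le_mul_right _ (hg K)
    rw [packDigits, pow_succ, Nat.mul_comm (M ^ K)]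
    rw [Nat.succ_mul] at h1
    omega

theorem packDigits_digit {M : ℕ} {g : ℕ → ℕ} (hg : ∀ j, g j < M) {j : ℕ} :
    ∀ {K : ℕ}, j < K → packDigits M g K / M ^ j % M = g j := by
  have hM : 0 < M := (Nat.zero_le _).trans_lt (hg 0)
  intro K
  induction K with
  | zero => intro h; omega
  | succ K ih =>
    intro h
    rcases Nat.lt_succ_iff_lt_or_eq.1 h with hj | rfl
    · obtain ⟨d, rfl⟩ := Nat.exists_eq_add_of_lt hj
      -- A higher digit contributes a multiple of `M ^ (j + 1)`, which disappears after division by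
      -- `M ^ j` and reduction modulo `M`.
      have : g (j + d + 1) * M ^ (j + d + 1) = M ^ j * (M * (g (j + d + 1) * M ^ d)) := by ring
      rw [packDigits, this, Nat.add_mul_div_left _ _ (pow_pos hM j), Nat.add_mul_mod_self_left,
        ih hj]
    · rw [packDigits, Nat.add_mul_div_right _ _ (pow_pos hM j),
        Nat.div_eq_of_lt (packDigits_lt hg j), Nat.zero_add, Nat.mod_eq_of_lt (hg j)]

/-- The word `m` of the packed form of `g`, with `K` values to a word. -/
def packedWord (M K : ℕ) (g : ℕ → ℕ) (m : ℕ) : ℕ := packDigits M (fun j => g (m * K + j)) K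

theorem packedWord_get {M K : ℕ} (hK : 0 < K) {g : ℕ → ℕ} (hg : ∀ j, g j < M) (p : ℕ) :
    packedWord M K g (p / K) / M ^ (p % K) % M = g p := by
  rw [packedWord, packDigits_digit (fun j => hg _) (Nat.mod_lt p hK)]
  congr 1
  rw [Nat.mul_comm]; exact Nat.div_add_mod p K

/-- Whether the bit `p` is set, as a number. -/
noncomputable def splitBitNat (n : ℕ) (st : ℕ → ℕ → ℕ) (xr : ℕ → ℕ) (d p : ℕ) : ℕ :=
  open Classical in if splitBit n st xr d p then 1 else 0

theorem splitBitNat_lt (n : ℕ) (st : ℕ → ℕ → ℕ) (xr : ℕ → ℕ) (d p : ℕ) :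
    splitBitNat n st xr d p < 2 := by
  unfold splitBitNat; split_ifs <;> omega

/-- The number of nonzero binary digits of `z` among the first `o`. -/
def digitCount (z o : ℕ) : ℕ := ((Finset.range o).filter (fun j => z / 2 ^ j % 2 = 1)).card

theorem digitCount_le (z o : ℕ) : digitCount z o ≤ o :=
  (Finset.card_filter_le _ _).trans (by simp)

/-- Induction on `o`: both sides grow by the bit at `m * b + o`, which `ho` keeps inside word `m`.
-/
theorem bitRank_eq_add_digitCount (n : ℕ) (st : ℕ → ℕ → ℕ) (xr : ℕ → ℕ) (d b m : ℕ) {o : ℕ}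
    (ho : o ≤ b) : bitRank n st xr d (m * b + o) = bitRank n st xr d (m * b) +
      digitCount (packedWord 2 b (splitBitNat n st xr d) m) o := by
  induction o with
  | zero => simp [digitCount]
  | succ o ih =>
    have hd : packedWord 2 b (splitBitNat n st xr d) m / 2 ^ o % 2 =
        splitBitNat n st xr d (m * b + o) :=
      packDigits_digit (fun j => splitBitNat_lt n st xr d (m * b + j)) (by omega)
    have hs : digitCount (packedWord 2 b (splitBitNat n st xr d) m) (o + 1) =
        digitCount (packedWord 2 b (splitBitNat n st xr d) m) o +
          splitBitNat n st xr d (m * b + o) := by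
      unfold digitCount
      rw [Finset.range_add_one, Finset.filter_insert, hd]
      have := splitBitNat_lt n st xr d (m * b + o)
      split_ifs with h1
      · rw [Finset.card_insert_of_notMem (by simp), h1]
      · omega
    rw [hs, ← Nat.add_assoc, ← Nat.add_assoc, ← ih (by omega)]
    unfold splitBitNat
    split_ifs with h1
    · exact bitRank_succ_of h1
    · exact bitRank_succ_of_not h1

/-- The formula evaluated by `rankE`: a sampled rank plus a digit count that depends only on one
word and an offset, hence can be tabulated. -/
theorem bitRank_eq_block (n : ℕ) (st : ℕ → ℕ → ℕ) (xr : ℕ → ℕ) (d : ℕ) {b : ℕ} (hb : 0 < b)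
    (p : ℕ) : bitRank n st xr d (p / b * b) +
      digitCount (packedWord 2 b (splitBitNat n st xr d) (p / b)) (p % b) =
        bitRank n st xr d p := by
  rw [← bitRank_eq_add_digitCount n st xr d b (p / b) (Nat.mod_lt p hb).le]
  congr 1
  rw [Nat.mul_comm]; exact Nat.div_add_mod p b

/-- A function on `[0, n)` that takes few values up to division by `s` on each window of `s`
positions is given by a table of these quotients, an index into the table, and a remainder. -/
theorem exists_window_table (n s c : ℕ) (hc : 0 < c) (f : ℕ → ℕ) (hf : ∀ p < n, f p < n)
    (hV : ∀ j, (((Finset.range n).filter (fun p => p / s = j)).image (fun p => f p / s)).card ≤ c) :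
    ∃ (tab : ℕ → ℕ → ℕ) (ix : ℕ → ℕ), (∀ j i, tab j i ≤ n) ∧ (∀ p, ix p < c) ∧
      ∀ p < n, tab (p / s) (ix p) = f p / s := by
  classical
  set V : ℕ → Finset ℕ :=
    fun j => ((Finset.range n).filter (fun p => p / s = j)).image (fun p => f p / s) with hVd
  -- Row `j` lists the distinct quotients attained on window `j`, and the index is the place of the
  -- wanted quotient in that list. The defaults 0 are never used for `p < n`; they keep the bounds
  -- valid for all arguments.
  refine ⟨fun j i => (V j).toList.getD i 0,
    fun p => if p < n then (V (p / s)).toList.idxOf (f p / s) else 0, ?_, ?_, ?_⟩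
  · intro j i
    by_cases hi : i < (V j).toList.length
    · simp only [List.getD_eq_getElem _ _ hi]
      have hm := (Finset.mem_toList (s := V j)).1 (List.getElem_mem hi)
      obtain ⟨p, hp, e⟩ := Finset.mem_image.1 hm
      rw [← e]
      have := hf p (by simpa using (Finset.mem_filter.1 hp).1)
      exact (Nat.div_le_self _ _).trans this.le
    · simp only [List.getD_eq_default _ _ (not_lt.1 hi), Nat.zero_le]
  · intro p
    dsimp only
    split_ifs with hp
    · have hm : f p / s ∈ (V (p / s)).toList :=
        Finset.mem_toList.2 (Finset.mem_image.2 ⟨p, by simp [hp], rfl⟩)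
      have := List.idxOf_lt_length_of_mem hm
      rw [Finset.length_toList] at this
      exact this.trans_le (hV _)
    · exact hc
  · intro p hp
    have hm : f p / s ∈ (V (p / s)).toList :=
      Finset.mem_toList.2 (Finset.mem_image.2 ⟨p, by simp [hp], rfl⟩)
    have := List.idxOf_lt_length_of_mem hm
    simp only [hp, if_true]
    rw [List.getD_eq_getElem _ _ this, List.getElem_idxOf]

/-- The passage from one block order to a finer one, as a table. -/
theorem IntervalHierarchy.exists_jump_table {st : ℕ → ℕ → ℕ} (h : IntervalHierarchy st) {n : ℕ}
    {xr : ℕ → ℕ} (hxr : Set.InjOn xr (Finset.range n)) (d k s c : ℕ) (hs : 0 < s) (hc : 0 < c)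
    (hsc : s = n ∨ 4 * 2 ^ k + 1 ≤ c) :
    ∃ (tab : ℕ → ℕ → ℕ) (ix lo : ℕ → ℕ), (∀ j i, tab j i ≤ n) ∧ (∀ p, ix p < c) ∧ (∀ p, lo p < s) ∧
      ∀ r < n, ∀ p, p = blockPos n st xr d r →
        tab (p / s) (ix p) * s + lo p = blockPos n st xr (d + k) r := by
  classical
  -- The jump as a function of positions: find the element at `p` and take its position in the finer
  -- order. Injectivity makes the choice irrelevant.
  set f : ℕ → ℕ := fun p => if hp : ∃ r < n, blockPos n st xr d r = p
    then blockPos n st xr (d + k) hp.choose else 0 with hfd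
  have hfp : ∀ r < n, f (blockPos n st xr d r) = blockPos n st xr (d + k) r := by
    intro r hr
    have hp : ∃ r' < n, blockPos n st xr d r' = blockPos n st xr d r := ⟨r, hr, rfl⟩
    simp only [hfd, dif_pos hp]
    congr 1
    exact h.blockPos_injOn hxr d (by simpa using hp.choose_spec.1) (by simpa using hr)
      hp.choose_spec.2
  have hfn : ∀ p < n, f p < n := by
    intro p hp
    simp only [hfd]
    split_ifs with hq
    · exact (h.blockPos_mem hq.choose_spec.1).1
    · omega
  -- The table is indexed by positions, whereas `card_image_div_le` speaks of elements; every
  -- position is occupied because an injection of a finite set into itself is onto.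
  have hsurj : ∀ p < n, ∃ r < n, blockPos n st xr d r = p := by
    intro p hp
    obtain ⟨r, hr, e⟩ := Finset.surj_on_of_inj_on_of_card_le (s := Finset.range n)
      (t := Finset.range n) (fun r _ => blockPos n st xr d r)
      (fun r hr => by simpa using (h.blockPos_mem (xr := xr) (d := d) (by simpa using hr)).1)
      (fun r r' hr hr' e => h.blockPos_injOn hxr d (by simpa using hr) (by simpa using hr') e)
      le_rfl p (by simpa using hp)
    exact ⟨r, by simpa using hr, e.symm⟩
  have hV : ∀ j, (((Finset.range n).filter (fun p => p / s = j)).image (fun p => f p / s)).card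
      ≤ c := by
    intro j
    rcases hsc with rfl | hsc
    -- With a single window of all `n` positions, every quotient is 0.
    · refine (Finset.card_le_card (t := {0}) ?_).trans (by rw [Finset.card_singleton]; exact hc)
      intro x hx
      obtain ⟨p, hp, rfl⟩ := Finset.mem_image.1 hx
      simp [Nat.div_eq_of_lt (hfn p (by simpa using (Finset.mem_filter.1 hp).1))]
    · refine ((Finset.card_le_card ?_).trans (h.card_image_div_le (n := n) (xr := xr) d k s j hs)).trans hsc
      intro x hx
      obtain ⟨p, hp, rfl⟩ := Finset.mem_image.1 hx
      obtain ⟨hp1, hp2⟩ := Finset.mem_filter.1 hp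
      obtain ⟨r, hr, rfl⟩ := hsurj p (by simpa using hp1)
      exact Finset.mem_image.2 ⟨r, by simp [hr, hp2], by rw [hfp r hr]⟩
  obtain ⟨tab, ix, h1, h2, h3⟩ := exists_window_table n s c hc f hfn hV
  refine ⟨tab, ix, fun p => f p % s, h1, h2, fun p => Nat.mod_lt _ hs, ?_⟩
  rintro r hr p rfl
  rw [h3 _ (h.blockPos_mem hr).1, hfp r hr, Nat.mul_comm]
  simp only [hfp r hr]
  exact Nat.div_add_mod _ _

/-! ### Straight-line programs -/

namespace RamProg

open NatState

variable {w : ℕ} {D : DataMemory w}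

/-- A bound on the number of steps of a program without loops. -/
def stepCost : RamProg → ℕ
  | .seq c d => c.stepCost + d.stepCost
  | .ite _ c d => max c.stepCost d.stepCost + 1
  | _ => 1

theorem stepCost_compile (e : WExpr) (k : ℕ) : (e.compile k).stepCost = e.cost := by
  induction e generalizing k with
  | reg r => rfl
  | lit c => rfl
  | bin o a b iha ihb => simp [WExpr.compile, stepCost, WExpr.cost, iha, ihb]
  | ld a i ih => simp [WExpr.compile, stepCost, WExpr.cost, ih]

/-- The loop-free program `c` reaches a state satisfying `Q`. -/
def Fast (D : DataMemory w) (c : RamProg) (σ : NatState) (Q : NatState → Prop) : Prop :=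
  Runs D c σ c.stepCost Q

theorem Fast.skip {σ : NatState} {Q : NatState → Prop} (h : Q σ) : Fast D .skip σ Q :=
  Runs.skip h

theorem Fast.mono {c : RamProg} {σ : NatState} {Q Q' : NatState → Prop}
    (h : Fast D c σ Q) (hQ : ∀ σ, Q σ → Q' σ) : Fast D c σ Q' :=
  Runs.mono h le_rfl hQ

theorem Fast.seq {c d : RamProg} {σ : NatState} {Q : NatState → Prop}
    (h : Fast D c σ (fun σ' => Fast D d σ' Q)) : Fast D (.seq c d) σ Q :=
  Runs.seq h

theorem Fast.asg {r n : ℕ} {e : WExpr} {σ : NatState} {Q : NatState → Prop}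
    (he : e.Ev D σ.reg n) (h : Q (σ.setReg r n)) : Fast D (asg r e) σ Q :=
  (Runs.asg he h).mono (by simp [RamProg.asg, stepCost, stepCost_compile]) (fun _ h => h)

theorem Fast.cget {x a n : ℕ} {e : WExpr} {σ : NatState} {Q : NatState → Prop}
    (he : e.Ev D σ.reg n) (h : Q (σ.setCreg x ((D.coords.getD a []).getD n 0))) :
    Fast D (cget x a e) σ Q :=
  (Runs.cget he h).mono (by simp [RamProg.cget, stepCost, stepCost_compile]) (fun _ h => h)

theorem Fast.put {a i v : ℕ} {e f : WExpr} {σ : NatState} {Q : NatState → Prop}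
    (he : e.Ev D σ.reg i) (hf : f.Ev D σ.reg v) (h : Q (σ.setWork a i v)) :
    Fast D (put a e f) σ Q :=
  (Runs.put he hf h).mono (by simp [RamProg.put, stepCost, stepCost_compile]) (fun _ h => h)

open Classical in
theorem Fast.cle {r x y : ℕ} {σ : NatState} {Q : NatState → Prop} (hw : 0 < w)
    (h : Q (σ.setReg r (if σ.creg x ≤ σ.creg y then 1 else 0))) : Fast D (.cle r x y) σ Q :=
  Runs.cle hw h

theorem Fast.ite {r : ℕ} {c d : RamProg} {σ : NatState} {Q : NatState → Prop}
    (hr : r < 20) (hc : σ.reg r ≠ 0 → Fast D c σ Q) (hd : σ.reg r = 0 → Fast D d σ Q) :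
    Fast D (.ite r c d) σ Q :=
  Runs.ite hr (fun h => Runs.mono (hc h) (le_max_left _ _) (fun _ h => h))
    (fun h => Runs.mono (hd h) (le_max_right _ _) (fun _ h => h))

end RamProg

/-! ### The query programs -/

open NatState RangeTree

/-- The parameter `j` stored in array `o`. -/
def parE (o j : ℕ) : WExpr := .ld o (.lit j)

/-- The rank of position `p` among the split bits of the level at height `h`. -/
def rankE (h p : WExpr) : WExpr :=
  .ld 9 (h * parE 4 1 + p / parE 4 2) +
    .ld 11 (.ld 10 (h * parE 4 1 + p / parE 4 2) * (parE 4 2 + .lit 1) + p % parE 4 2)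

/-- The entry `p` of row `j` of the packed array `a`, for the parameters and powers at `o`. -/
def unpackE (o a : ℕ) (j p : WExpr) : WExpr :=
  .ld a (j * parE o 3 + p / parE o 2) / .ld (o + 4) (p % parE o 2) % parE o 1

/-- The jump of position `p` in row `j` of the jump table at `o`. -/
def jumpE (o : ℕ) (j p : WExpr) : WExpr :=
  .ld (o + 3) ((j * parE o 4 + p / parE o 1) * parE o 5 + unpackE o (o + 1) j p) * parE o 1 +
    unpackE o (o + 2) j p

/-- The memory `D` holds the tree `T` and the tables used by the queries: `Δ i` for `i ≤ k + 1` are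
the jump lengths. -/
structure StoredTree {w : ℕ} (D : DataMemory w) (T : RangeTree) (e : T.Node ≃ Fin T.numNodes)
    (Δ : ℕ → ℕ) (k : ℕ) : Prop where
  bound : 2 * T.leaves.length + T.height + 10 ≤ 2 ^ w
  rd_leaf : ∀ (v : T.Node) p, v.subtree = leaf p → D.rd 0 (e v) = 0
  rd_node : ∀ (v : T.Node) l r, v.subtree = node l r → D.rd 0 (e v) = 1
  rd_left : ∀ v u : T.Node, v.leftChild = some u → D.rd 1 (e v) = e u
  rd_right : ∀ v u : T.Node, v.rightChild = some u → D.rd 2 (e v) = e u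
  rd_root : D.rd 3 0 = e (.root T)
  coord_leaf : ∀ (v : T.Node) p, v.subtree = leaf p →
    (D.coords.getD 0 []).getD (e v) 0 = p.1 ∧ (D.coords.getD 1 []).getD (e v) 0 = p.2
  coord_node : ∀ (v : T.Node) l r, v.subtree = node l r →
    (D.coords.getD 1 []).getD (e v) 0 = l.maxY
  rd_length : D.rd 4 0 = T.leaves.length
  rd_first : D.rd 4 3 = Δ 1
  rd_start : ∀ v : T.Node, D.rd 5 (e v) = v.start
  rd_height : ∀ v : T.Node, D.rd 6 (e v) = T.height - v.depth
  rd_xleaf : ∀ r < T.leaves.length, ∃ u : T.Node, u.subtree = leaf (T.leafAt r) ∧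
    D.rd 7 (T.xRank r) = e u
  rd_yleaf : ∀ r < T.leaves.length, ∃ u : T.Node, u.subtree = leaf (T.leafAt r) ∧ D.rd 8 r = e u
  rd_step : ∀ i < k, D.rd (12 + 5 * i) 0 = Δ (i + 1)
  rd_next : ∀ i < k, D.rd (12 + 5 * i) 6 = Δ (i + 2)
  rank_ev : ∀ (ρ : ℕ → ℕ) (h p : WExpr) (x y : ℕ), h.Ev D ρ x → p.Ev D ρ y → x ≤ T.height →
    y ≤ T.leaves.length →
    (rankE h p).Ev D ρ (bitRank T.leaves.length T.blockStart T.xRank (T.height - x) y)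
  jump_ev : ∀ i < k, ∀ (ρ : ℕ → ℕ) (j p : WExpr) (x r : ℕ), j.Ev D ρ (x + 1) →
    (x + 1) * Δ (i + 1) ≤ T.height → r < T.leaves.length →
    p.Ev D ρ (blockPos T.leaves.length T.blockStart T.xRank (T.height - (x + 1) * Δ (i + 1)) r) →
    (jumpE (12 + 5 * i) j p).Ev D ρ
      (blockPos T.leaves.length T.blockStart T.xRank (T.height - x * Δ (i + 1)) r)

/-- Binary search for the number of points with `x`-coordinate at most coordinate register `0`. -/
def searchBody : RamProg :=
  .seq (.asg 7 ((.reg 4 + .reg 5) / .lit 2)) (.seq (.cget 2 0 (.ld 7 (.reg 7))) (.seq (.cle 8 2 0)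
    (.seq (.ite 8 (.asg 4 (.reg 7 + .lit 1)) (.asg 5 (.reg 7)))
      (.asg 6 (.bin .lt (.reg 4) (.reg 5))))))

/-- Registers 4 and 5 bracket `xCount`, and register 6 is the loop flag. The result is left in
register 4. -/
def searchProg : RamProg :=
  .seq (.asg 4 (.lit 0)) (.seq (.asg 5 (parE 4 0)) (.seq (.asg 6 (.bin .lt (.reg 4) (.reg 5)))
    (.loop 6 searchBody)))

/-- Append the node in `f` with the size in register `r`. -/
def pushProg (f : WExpr) (r : ℕ) : RamProg :=
  .ite r (.seq (.put 0 (.reg 0) f) (.seq (.put 1 (.reg 0) (.reg r)) (.asg 0 (.reg 0 + .lit 1)))) .skip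

/-- One step of the descent from the node in register `2`, with the rank of the query in it in
register `3`. -/
def descendBody : RamProg :=
  .seq (.asg 7 (rankE (.ld 6 (.reg 2)) (.ld 5 (.reg 2) + .reg 3) -
      rankE (.ld 6 (.reg 2)) (.ld 5 (.reg 2))))
  (.seq (.cget 2 1 (.reg 2)) (.seq (.cle 8 2 1) (.seq (.asg 9 (.reg 3 - .reg 7))
  (.seq (.ite 8 (.seq (pushProg (.ld 1 (.reg 2)) 9)
      (.seq (.asg 3 (.reg 7)) (.asg 2 (.ld 2 (.reg 2)))))
      (.seq (.asg 3 (.reg 9)) (.asg 2 (.ld 1 (.reg 2)))))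
    (.asg 6 (.ld 0 (.reg 2)))))))

/-- The descent outputs only left siblings of its path, so the leaf at which it ends needs its own
test against q.y. -/
def lastLeafProg : RamProg :=
  .seq (.cget 2 1 (.reg 2)) (.seq (.cle 8 2 1) (.ite 8 (pushProg (.reg 2) 3) .skip))

/-- Register 0 counts the output nodes, register 2 holds the current node, register 3 the rank of
the query in it. Sizes are written along with the nodes. -/
def locateProg : RamProg :=
  .seq searchProg (.seq (.asg 0 (.lit 0)) (.seq (.asg 2 (.ld 3 (.lit 0)))
    (.seq (.asg 3 (.reg 4)) (.seq (.asg 6 (.ld 0 (.reg 2))) (.seq (.loop 6 descendBody)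
      lastLeafProg)))))

namespace StoredTree

open RamProg WExpr

variable {w : ℕ} {D : DataMemory w} {T : RangeTree} {e : T.Node ≃ Fin T.numNodes}
  {Δ : ℕ → ℕ} {k : ℕ}

theorem lt_pow (M : StoredTree D T e Δ k) {x : ℕ} (hx : x ≤ 2 * T.leaves.length + 9) :
    x < 2 ^ w := by
  have := M.bound; omega

theorem w_pos (M : StoredTree D T e Δ k) : 0 < w := by
  rcases Nat.eq_zero_or_pos w with rfl | h
  · have := M.bound; simp at this
  · exact h

theorem searchBody_spec (M : StoredTree D T e Δ k) (hT : T.XInj) (x y : ℝ) (m lo hi : ℕ)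
    (σ : NatState) (h4 : σ.reg 4 = lo) (h5 : σ.reg 5 = hi) (hx : σ.creg 0 = x) (hy : σ.creg 1 = y)
    (hlo : lo ≤ T.xCount x) (hhi : T.xCount x ≤ hi) (hn : hi ≤ T.leaves.length) (hlt : lo < hi)
    (hm : hi - lo < 2 ^ (m + 1)) :
    Fast D searchBody σ (fun σ' => ∃ lo' hi', σ'.reg 4 = lo' ∧ σ'.reg 5 = hi' ∧ σ'.creg 0 = x ∧
      σ'.creg 1 = y ∧ lo' ≤ T.xCount x ∧ T.xCount x ≤ hi' ∧ hi' ≤ T.leaves.length ∧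
      hi' - lo' < 2 ^ m ∧ σ'.reg 6 = if lo' < hi' then 1 else 0) := by
  have hw := M.w_pos
  have hp : 2 ^ (m + 1) = 2 * 2 ^ m := by ring
  -- The probed point has x-rank `(lo + hi) / 2`, so comparing its coordinate with `x` decides
  -- whether this midpoint is below `xCount x`.
  obtain ⟨r, hr, hxr⟩ := hT.exists_xRank (j := (lo + hi) / 2) (by omega)
  obtain ⟨u, hul, hrd⟩ := M.rd_xleaf r hr
  rw [hxr] at hrd
  have hcmp := T.xRank_lt_xCount hr x
  rw [hxr] at hcmp
  refine Fast.seq (Fast.asg (n := (lo + hi) / 2) (.div (.add (.reg (by norm_num) h4)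
    (.reg (by norm_num) h5) (M.lt_pow (by omega))) (.lit (M.lt_pow (by omega)))) ?_)
  refine Fast.seq (Fast.cget (n := e u) (.ld (.reg (by norm_num) (by simp)) hrd) ?_)
  refine Fast.seq (Fast.cle hw ?_)
  rw [(M.coord_leaf u _ hul).1]
  have hmid : (lo + hi) / 2 < hi := by omega
  simp only [setCreg_creg, setReg_creg, Function.update_self, ne_eq, OfNat.zero_ne_ofNat, not_false_eq_true, Function.update_of_ne, hx, ← hcmp]
  refine Fast.seq (Fast.ite (by norm_num) (fun hc => ?_) (fun hc => ?_))
  · have hc' : (lo + hi) / 2 < T.xCount x := by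
      by_contra hcon; simp [hcon] at hc
    refine Fast.asg (n := (lo + hi) / 2 + 1) (.add (.reg (by norm_num) (by simp))
      (.lit (M.lt_pow (by omega))) (M.lt_pow (by omega))) ?_
    refine Fast.asg (.lt hw (.reg (n := (lo + hi) / 2 + 1) (by norm_num) (by simp))
      (.reg (n := hi) (by norm_num) (by simp [h5]))) ?_
    refine ⟨(lo + hi) / 2 + 1, hi, ?_⟩
    simp [h5, hx, hy]
    omega
  · have hc' : ¬ (lo + hi) / 2 < T.xCount x := by
      intro hcon; simp [hcon] at hc
    refine Fast.asg (n := (lo + hi) / 2) (.reg (by norm_num) (by simp)) ?_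
    refine Fast.asg (.lt hw (.reg (n := lo) (by norm_num) (by simp [h4]))
      (.reg (n := (lo + hi) / 2) (by norm_num) (by simp))) ?_
    refine ⟨lo, (lo + hi) / 2, ?_⟩
    simp [h4, hx, hy]
    omega

theorem searchProg_spec (M : StoredTree D T e Δ k) (hT : T.XInj) (x y : ℝ) (m : ℕ)
    (hm : T.leaves.length < 2 ^ m) (σ : NatState) (hx : σ.creg 0 = x) (hy : σ.creg 1 = y) :
    Runs D searchProg σ (20 + m * (searchBody.stepCost + 1))
      (fun σ' => σ'.reg 4 = T.xCount x ∧ σ'.creg 0 = x ∧ σ'.creg 1 = y) := by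
  have hw := M.w_pos
  have hc := T.xCount_le x
  -- The loop rank is an exponent: `hi - lo < 2 ^ m`, and `m` drops by one at each halving. At `m =
  -- 0` the bracket is closed and the flag is 0.
  have key := Runs.loop (D := D) (r := 6) (c := searchBody) (T := searchBody.stepCost)
    (fun m σ => ∃ lo hi, σ.reg 4 = lo ∧ σ.reg 5 = hi ∧ σ.creg 0 = x ∧ σ.creg 1 = y ∧
      lo ≤ T.xCount x ∧ T.xCount x ≤ hi ∧ hi ≤ T.leaves.length ∧ hi - lo < 2 ^ m ∧
      σ.reg 6 = if lo < hi then 1 else 0) (by norm_num) ?_ m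
  · refine (Runs.seq (Fast.asg (n := 0) (.lit (M.lt_pow (by omega))) (Runs.seq (Fast.asg
      (n := T.leaves.length) (.ld (.lit (M.lt_pow (by omega))) M.rd_length) (Runs.seq (Fast.asg
      (.lt hw (.reg (n := 0) (by norm_num) (by simp))
      (.reg (n := T.leaves.length) (by norm_num) (by simp)))
      (Runs.mono (key _ ⟨0, T.leaves.length, ?_⟩) le_rfl ?_))))))).mono ?_ (fun _ h => h)
    · simp [hx, hy, hc]; omega
    · rintro σ' ⟨⟨m', lo, hi, h4, h5, h0, h1, a1, a2, a3, a4, a5⟩, h6⟩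
      refine ⟨?_, h0, h1⟩
      rw [h6] at a5
      split_ifs at a5 with hlt
      omega
    · simp [stepCost, RamProg.asg, stepCost_compile, cost]; omega
  · rintro m σ ⟨lo, hi, h4, h5, h0, h1, a1, a2, a3, a4, a5⟩ h6
    have hlt : lo < hi := by by_contra hc; rw [a5, if_neg hc] at h6; exact h6 rfl
    obtain ⟨m, rfl⟩ : ∃ m', m = m' + 1 := by
      rcases m with _ | m
      · simp at a4; omega
      · exact ⟨m, rfl⟩
    refine Runs.mono (M.searchBody_spec hT x y m lo hi σ h4 h5 h0 h1 a1 a2 a3 hlt a4) le_rfl ?_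
    exact fun σ' h => ⟨m, by omega, h⟩

end StoredTree

/-! ### Decomposition of a dominance range into prefixes at nodes -/

namespace RangeTree.Node

/-- The node `u`, unless no point below it has `x`-coordinate at most `x`. -/
noncomputable def nodeIf {T : RangeTree} (x : ℝ) (u : Node T) : List T.Node :=
  if u.count (T.xCount x) = 0 then [] else [u]

theorem count_ne_zero_of_mem {T : RangeTree} {x : ℝ} {u : Node T} {p : ℝ × ℝ}
    (hp : p ∈ u.prefixList x) : u.count (T.xCount x) ≠ 0 := by
  rw [← prefixList_length]
  exact (List.length_pos_of_mem hp).ne'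

theorem exists_mem_nodeIf {T : RangeTree} (x : ℝ) (u : Node T) (p : ℝ × ℝ) :
    (∃ u' ∈ u.nodeIf x, p ∈ u'.prefixList x) ↔ p ∈ u.prefixList x := by
  unfold nodeIf
  constructor
  · rintro ⟨u', hu', hp⟩
    split_ifs at hu'
    · simp at hu'
    · rwa [List.mem_singleton.1 hu'] at hp
  · intro hp
    rw [if_neg (count_ne_zero_of_mem hp)]
    exact ⟨u, by simp, hp⟩

theorem mem_nodeIf {T : RangeTree} {x : ℝ} {u u' : Node T} (h : u' ∈ u.nodeIf x) :
    u' = u ∧ u.count (T.xCount x) ≠ 0 := by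
  unfold nodeIf at h
  split_ifs at h with h0
  · simp at h
  · exact ⟨List.mem_singleton.1 h, h0⟩

theorem nodeIf_length_le {T : RangeTree} (x : ℝ) (u : Node T) : (u.nodeIf x).length ≤ 1 := by
  unfold nodeIf; split_ifs <;> simp

theorem pairwise_nodeIf {T : RangeTree} (x : ℝ) (u : Node T) (R : T.Node → T.Node → Prop) :
    (u.nodeIf x).Pairwise R := by
  unfold nodeIf; split_ifs <;> simp

/-- The nodes `S` decompose the points below `v` that are dominated by `q`. -/
structure IsCover {T : RangeTree} (q : ℝ × ℝ) (v : Node T) (S : List T.Node) : Prop where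
  ordered : S.Pairwise (fun u u' => u.start + u.size ≤ u'.start)
  within : ∀ u ∈ S, v.start ≤ u.start ∧ u.start + u.size ≤ v.start + v.size
  count_ne : ∀ u ∈ S, u.count (T.xCount q.1) ≠ 0
  mem_iff : ∀ p, (p ∈ v.subtree.leaves ∧ Dominates q p) ↔ ∃ u ∈ S, p ∈ u.prefixList q.1

/-- When all points below `v` satisfy the condition on y, only the one on x remains, and it cuts out
a prefix of P(v). -/
theorem IsCover.of_forall_le {T : RangeTree} {q : ℝ × ℝ} {v : Node T}
    (h : ∀ p ∈ v.subtree.leaves, p.2 ≤ q.2) : IsCover q v (v.nodeIf q.1) where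
  ordered := v.pairwise_nodeIf _ _
  within u hu := by rw [(mem_nodeIf hu).1]; exact ⟨le_rfl, le_rfl⟩
  count_ne u hu := by rw [(mem_nodeIf hu).1]; exact (mem_nodeIf hu).2
  mem_iff p := by
    rw [exists_mem_nodeIf, mem_prefixList, Dominates]
    exact ⟨fun h => ⟨h.1, h.2.1⟩, fun h' => ⟨h'.1, h'.2, h p h'.1⟩⟩

theorem IsCover.of_forall_lt {T : RangeTree} {q : ℝ × ℝ} {v : Node T}
    (h : ∀ p ∈ v.subtree.leaves, q.2 < p.2) : IsCover q v [] where
  ordered := .nil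
  within u hu := by simp at hu
  count_ne u hu := by simp at hu
  mem_iff p := by
    simp only [List.not_mem_nil, false_and, exists_false, iff_false, not_and]
    exact fun hp hd => absurd hd.2 (not_le.2 (h p hp))

theorem IsCover.append {T : RangeTree} {q : ℝ × ℝ} {v vl vr : Node T} {Sl Sr : List T.Node}
    {l r : RangeTree} (hv : v.subtree = node l r) (hl : vl.subtree = l) (hr : vr.subtree = r)
    (h3 : vl.start = v.start) (h4 : vr.start = v.start + vl.size) (h5 : v.size = vl.size + vr.size)
    (cl : IsCover q vl Sl) (cr : IsCover q vr Sr) : IsCover q v (Sl ++ Sr) where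
  ordered := by
    rw [List.pairwise_append]
    refine ⟨cl.ordered, cr.ordered, fun a ha b hb => ?_⟩
    have := cl.within a ha; have := cr.within b hb; omega
  within u hu := by
    rcases List.mem_append.1 hu with hu | hu
    · have := cl.within u hu; omega
    · have := cr.within u hu; omega
  count_ne u hu := by
    rcases List.mem_append.1 hu with hu | hu
    · exact cl.count_ne u hu
    · exact cr.count_ne u hu
  mem_iff p := by
    have a := cl.mem_iff p
    have b := cr.mem_iff p
    rw [hl] at a; rw [hr] at b
    simp only [hv, leaves, List.mem_append, or_and_right, exists_or, a, b]

theorem subtree_leaves_sublist {T : RangeTree} (v : Node T) :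
    v.subtree.leaves.Sublist T.leaves := by
  obtain ⟨l₁, l₂, e, _⟩ := v.leaves_eq
  rw [e, List.append_assoc]
  exact (List.sublist_append_left _ _).trans (List.sublist_append_right _ _)

/-- The nodes of a cover occupy disjoint leaf intervals in increasing order. As each point occurs at
one leaf only, this gives both the absence of repetitions and the disjointness of the prefixes. -/
theorem IsCover.isPrefixPartition {T : RangeTree} {P : Finset (ℝ × ℝ)} {q : ℝ × ℝ} {S : List T.Node}
    (hP : ∀ p, p ∈ T.leaves ↔ p ∈ P) (hnd : T.leaves.Nodup) (h : IsCover q (root T) S) :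
    IsPrefixPartition P q S (fun v => v.prefixList q.1) := by
  refine ⟨h.ordered.imp_of_mem ?_, fun v hv => ⟨?_, v.prefixList_prefix _⟩, ?_, ?_⟩
  · rintro a b _ _ hab rfl
    have := a.size_pos; omega
  · intro h0
    apply h.count_ne v hv
    rw [← prefixList_length]
    exact List.length_eq_zero_iff.2 h0
  · intro v hv v' hv' hne p hp hp'
    obtain ⟨i, i1, i2, i3⟩ := (v.mem_subtree_leaves p).1 ((mem_prefixList _ _ _).1 hp).1
    obtain ⟨j, j1, j2, j3⟩ := (v'.mem_subtree_leaves p).1 ((mem_prefixList _ _ _).1 hp').1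
    have hvs := v.start_add_size_le
    have hvs' := v'.start_add_size_le
    have hij : i = j := by
      have e := i3.trans j3.symm
      unfold leafAt at e
      rw [List.getD_eq_getElem _ _ (by omega), List.getD_eq_getElem _ _ (by omega)] at e
      exact (hnd.getElem_inj_iff).1 e
    have : ∀ a ∈ S, ∀ b ∈ S, a ≠ b → a.start + a.size ≤ b.start ∨ b.start + b.size ≤ a.start := by
      intro a ha b hb hab
      have hsymm : Std.Symm
          (fun a b : T.Node => a.start + a.size ≤ b.start ∨ b.start + b.size ≤ a.start) :=
        ⟨fun _ _ h => h.symm⟩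
      exact (h.ordered.imp (S := fun a b => a.start + a.size ≤ b.start ∨ b.start + b.size ≤ a.start)
        (fun h => .inl h)).forall ha hb hab
    rcases this v hv v' hv' hne with h | h <;> omega
  · intro p
    rw [← hP, ← h.mem_iff p]; rfl

end RangeTree.Node

/-! ### Correctness of locating -/

namespace StoredTree

open RamProg WExpr

variable {w : ℕ} {D : DataMemory w} {T : RangeTree} {e : T.Node ≃ Fin T.numNodes}
  {Δ : ℕ → ℕ} {k : ℕ}

/-- The output arrays hold the nodes `S` and the numbers of their points of `x`-rank below `c`. -/
def Holds (e : T.Node ≃ Fin T.numNodes) (c : ℕ) (σ : NatState) (S : List T.Node) : Prop :=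
  σ.reg 0 = S.length ∧
    ∀ (j : ℕ) (hj : j < S.length), σ.work 0 j = e S[j] ∧ σ.work 1 j = S[j].count c

/-- The branch on the size suppresses empty prefixes, matching `nodeIf`. The continuation `Q` may
rely on every register except 0 being unchanged. -/
theorem pushProg_spec (M : StoredTree D T e Δ k) {x : ℝ} {σ : NatState} {S : List T.Node}
    {u : T.Node} {f : WExpr} {r : ℕ} {Q : NatState → Prop} (hH : Holds e (T.xCount x) σ S)
    (hS : S.length + 1 < 2 ^ w) (hf : f.Ev D σ.reg (e u)) (hr : r < 20)
    (hru : σ.reg r = u.count (T.xCount x))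
    (hQ : ∀ σ' : NatState, (∀ i, i ≠ 0 → σ'.reg i = σ.reg i) → σ'.creg = σ.creg →
      Holds e (T.xCount x) σ' (S ++ u.nodeIf x) → Q σ') : Fast D (pushProg f r) σ Q := by
  have h1 := M.lt_pow (x := 1) (by omega)
  refine Fast.ite hr (fun h0 => ?_) (fun h0 => ?_)
  · refine Fast.seq (Fast.put (i := S.length) (.reg (by norm_num) hH.1) hf ?_)
    refine Fast.seq (Fast.put (i := S.length) (v := u.count (T.xCount x)) (.reg (by norm_num) hH.1)
      (.reg hr hru) ?_)
    refine Fast.asg (n := S.length + 1) (.add (.reg (by norm_num) hH.1) (.lit h1) hS) ?_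
    refine hQ _ (fun i hi => by simp [hi]) rfl ?_
    rw [hru] at h0
    rw [Node.nodeIf, if_neg h0]
    refine ⟨by simp, fun j hj => ?_⟩
    simp only [List.length_append, List.length_singleton] at hj
    by_cases hjS : j = S.length
    · subst hjS; simp
    · have hj' : j < S.length := by omega
      have := hH.2 j hj'
      simp [hjS, List.getElem_append_left hj', this]
  · refine Fast.skip (hQ σ (fun _ _ => rfl) rfl ?_)
    rw [hru] at h0
    rw [Node.nodeIf, if_pos h0, List.append_nil]
    exact hH

/-- The state of the descent at the node `v`, with the nodes `S` already found. -/
structure AtNode (D : DataMemory w) (e : T.Node ≃ Fin T.numNodes) (q : ℝ × ℝ) (v : T.Node)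
    (S : List T.Node) (σ : NatState) : Prop where
  holds : Holds e (T.xCount q.1) σ S
  node : σ.reg 2 = e v
  rank : σ.reg 3 = v.count (T.xCount q.1)
  flag : σ.reg 6 = D.rd 0 (e v)
  qx : σ.creg 0 = q.1
  qy : σ.creg 1 = q.2

theorem descendBody_spec (M : StoredTree D T e Δ k) (hT : T.XInj) {q : ℝ × ℝ} {v vl vr : T.Node}
    {l r : RangeTree} {S : List T.Node} {σ : NatState} (hv : v.subtree = .node l r)
    (hvl : v.leftChild = some vl) (hvr : v.rightChild = some vr) (h1 : vl.depth = v.depth + 1)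
    (h2 : vr.depth = v.depth + 1) (h3 : vl.start = v.start) (h4 : vr.start = v.start + vl.size)
    (h5 : v.size = vl.size + vr.size) (hσ : AtNode D e q v S σ) (hS : S.length + 1 < 2 ^ w) :
    Fast D descendBody σ (fun σ' => (l.maxY ≤ q.2 → AtNode D e q vr (S ++ vl.nodeIf q.1) σ') ∧
      (¬ l.maxY ≤ q.2 → AtNode D e q vl S σ')) := by
  have hw := M.w_pos
  obtain ⟨hH, hn, hrk, hfl, hx, hy⟩ := hσ
  have hd := v.depth_add_height
  -- Tables are indexed by the height above the lowest level; this converts back to depth.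
  have hdd : T.height - (T.height - v.depth) = v.depth := by omega
  have hss := v.start_add_size_le
  have hcs := v.count_le_size (T.xCount q.1)
  have hsum := (Node.count_children v vl vr (T.xCount q.1) h1 h3 h4 h5).1
  have hbit := Node.bitRank_add_count hT v vl vr (T.xCount q.1) h1 h3 h4 h5
  have rv : ∀ ρ : ℕ → ℕ, ρ 2 = e v → (WExpr.reg 2).Ev D ρ (e v) :=
    fun ρ h => .reg (by norm_num) h
  have rstart : ∀ ρ : ℕ → ℕ, ρ 2 = e v → (WExpr.ld 5 (.reg 2)).Ev D ρ v.start :=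
    fun ρ h => .ld (rv ρ h) (M.rd_start v)
  have rheight : ∀ ρ : ℕ → ℕ, ρ 2 = e v → (WExpr.ld 6 (.reg 2)).Ev D ρ (T.height - v.depth) :=
    fun ρ h => .ld (rv ρ h) (M.rd_height v)
  have e1 := M.rank_ev σ.reg _ _ _ (v.start + v.count (T.xCount q.1)) (rheight _ hn)
    (.add (rstart _ hn) (.reg (by norm_num) hrk) (M.lt_pow (by omega))) (by omega) (by omega)
  have e2 := M.rank_ev σ.reg _ _ _ v.start (rheight _ hn) (rstart _ hn) (by omega) (by omega)
  rw [hdd] at e1 e2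
  have e3 := WExpr.Ev.sub e1 e2 (by omega)
  -- The difference of the two bit ranks is the rank in the right child; the left rank is then found
  -- by subtraction.
  rw [hbit, Nat.add_sub_cancel_left] at e3
  refine Fast.seq (Fast.asg e3 ?_)
  refine Fast.seq (Fast.cget (n := e v) (rv _ (by simp [hn])) ?_)
  refine Fast.seq (Fast.cle hw ?_)
  rw [M.coord_node v l r hv]
  have e4 : v.count (T.xCount q.1) - vr.count (T.xCount q.1) = vl.count (T.xCount q.1) := by omega
  refine Fast.seq (Fast.asg (n := vl.count (T.xCount q.1)) (e4 ▸ .sub (.reg (by norm_num)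
    (by simp [hrk])) (.reg (by norm_num) (by simp)) (by omega)) ?_)
  refine Fast.seq (Fast.ite (by norm_num) (fun hc => ?_) (fun hc => ?_))
  · have hle : l.maxY ≤ q.2 := by
      by_contra hcon; simp [hy, hcon] at hc
    refine Fast.seq (pushProg_spec M (u := vl) (x := q.1) (S := S) ⟨by simp [hH.1], by simpa using hH.2⟩
      hS (.ld (rv _ (by simp [hn])) (M.rd_left v vl hvl)) (by norm_num) (by simp) ?_)
    intro σ' hreg hcreg hH'
    refine Fast.seq (Fast.asg (n := vr.count (T.xCount q.1)) (.reg (by norm_num)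
      (by simp [hreg])) ?_)
    refine Fast.asg (n := e vr) (.ld (rv _ (by simp [hreg, hn])) (M.rd_right v vr hvr)) ?_
    refine Fast.asg (n := D.rd 0 (e vr)) (.ld (.reg (by norm_num) (by simp)) rfl) ?_
    refine ⟨fun _ => ⟨⟨by simp [hH'.1], by simpa using hH'.2⟩, by simp, by simp, by simp,
      by simp [hcreg, hx], by simp [hcreg, hy]⟩, fun h => absurd hle h⟩
  · have hle : ¬ l.maxY ≤ q.2 := by
      intro hcon; simp [hy, hcon] at hc
    refine Fast.seq (Fast.asg (n := vl.count (T.xCount q.1)) (.reg (by norm_num) (by simp)) ?_)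
    refine Fast.asg (n := e vl) (.ld (rv _ (by simp [hn])) (M.rd_left v vl hvl)) ?_
    refine Fast.asg (n := D.rd 0 (e vl)) (.ld (.reg (by norm_num) (by simp)) rfl) ?_
    refine ⟨fun h => absurd h hle, fun _ => ⟨⟨by simp [hH.1], by simpa using hH.2⟩, by simp, by simp,
      by simp, by simp [hx], by simp [hy]⟩⟩

/-- Induction on the subtree, one loop iteration per level. The list `S` is chosen before the nodes
already found and the state, so the decomposition depends only on the query, as the theorem demands.
-/
theorem descend_spec (M : StoredTree D T e Δ k) (hT : T.XInj)
    (hord : T.leaves.Pairwise (fun p p' => p.2 < p'.2)) (q : ℝ × ℝ) (U : RangeTree) :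
    ∀ v : T.Node, v.subtree = U → ∃ S : List T.Node, v.IsCover q S ∧ S.length ≤ U.height + 1 ∧
      ∀ S₀ σ, AtNode D e q v S₀ σ → S₀.length + U.height + 1 < 2 ^ w →
        Runs D (.loop 6 descendBody) σ (U.height * (descendBody.stepCost + 1) + 1)
          (fun σ' => Fast D lastLeafProg σ' (fun σ'' => Holds e (T.xCount q.1) σ'' (S₀ ++ S))) := by
  have hw := M.w_pos
  induction U with
  | leaf p =>
    intro v hv
    have hlv : v.subtree.leaves = [p] := by rw [hv]; rfl
    refine ⟨if p.2 ≤ q.2 then v.nodeIf q.1 else [], ?_, ?_, ?_⟩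
    · split_ifs with hle
      · exact .of_forall_le (by simpa [hlv] using hle)
      · exact .of_forall_lt (by simpa [hlv] using hle)
    · split_ifs
      · simpa [height] using v.nodeIf_length_le q.1
      · simp
    · intro S₀ σ ⟨hH, hn, hrk, hfl, hx, hy⟩ hS
      refine (Runs.loop_done (by norm_num) (by rw [hfl, M.rd_leaf v p hv]) ?_).mono (by simp [height])
        (fun _ h => h)
      refine Fast.seq (Fast.cget (n := e v) (.reg (by norm_num) hn) (Fast.seq (Fast.cle hw ?_)))
      rw [(M.coord_leaf v p hv).2]
      refine Fast.ite (by norm_num) (fun hc => ?_) (fun hc => ?_)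
      · have hle : p.2 ≤ q.2 := by
          by_contra hcon; simp [hy, hcon] at hc
        rw [if_pos hle]
        exact pushProg_spec M (u := v) (x := q.1) (S := S₀) ⟨by simp [hH.1], by simpa using hH.2⟩
          (by simp only [height] at hS; omega) (.reg (by norm_num) (by simp [hn])) (by norm_num)
          (by simp [hrk]) (fun σ' _ _ h => h)
      · have hle : ¬ p.2 ≤ q.2 := by
          intro hcon; simp [hy, hcon] at hc
        rw [if_neg hle, List.append_nil]
        exact Fast.skip ⟨by simp [hH.1], by simpa using hH.2⟩
  | node l r ihl ihr =>
    intro v hv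
    obtain ⟨vl, vr, hvl, hvr, sl, sr, h1, h2, h3, h4, h5⟩ := v.children_node hv
    have step : ∀ S₀ σ, AtNode D e q v S₀ σ → S₀.length + (RangeTree.node l r).height + 1 < 2 ^ w →
        ∀ (T' : ℕ) (Q : NatState → Prop), (∀ σ',
          ((l.maxY ≤ q.2 → AtNode D e q vr (S₀ ++ vl.nodeIf q.1) σ') ∧
          (¬ l.maxY ≤ q.2 → AtNode D e q vl S₀ σ')) → Runs D (.loop 6 descendBody) σ' T' Q) →
        Runs D (.loop 6 descendBody) σ (descendBody.stepCost + T' + 1) Q := by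
      intro S₀ σ hσ hS T' Q hQ
      refine Runs.loop_step (by norm_num) (by rw [hσ.flag, M.rd_node v l r hv]; norm_num) ?_
      exact (M.descendBody_spec hT hv hvl hvr h1 h2 h3 h4 h5 hσ (by omega)).mono hQ
    by_cases hle : l.maxY ≤ q.2
    · obtain ⟨S, hc, hlen, hrun⟩ := ihr vr sr
      refine ⟨vl.nodeIf q.1 ++ S, ?_, ?_, ?_⟩
      · refine .append hv sl sr h3 h4 h5 (.of_forall_le ?_) hc
        rw [sl]; exact (l.maxY_le_iff q.2).1 hle
      · have := vl.nodeIf_length_le q.1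
        simp only [List.length_append, height]; omega
      · intro S₀ σ hσ hS
        refine (step S₀ σ hσ hS (r.height * (descendBody.stepCost + 1) + 1) _ fun σ' h' => ?_).mono
          ?_ (fun _ h => h)
        · rw [← List.append_assoc]
          refine hrun _ σ' (h'.1 hle) ?_
          have := vl.nodeIf_length_le q.1
          simp only [List.length_append, height] at hS ⊢; omega
        · have : (r.height + 1) * (descendBody.stepCost + 1) ≤
              (RangeTree.node l r).height * (descendBody.stepCost + 1) :=
            Nat.mul_le_mul_right _ (by simp [height])
          rw [Nat.succ_mul] at this
          omega
    · obtain ⟨S, hc, hlen, hrun⟩ := ihl vl sl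
      refine ⟨S, ?_, by simp only [height]; omega, ?_⟩
      · rw [← List.append_nil S]
        refine .append hv sl sr h3 h4 h5 hc (.of_forall_lt ?_)
        rw [sr]
        -- The highest point of the left subtree is above q.y, and all points of the right subtree
        -- are higher still, so the right subtree contributes nothing.
        obtain ⟨p, hp, hpe⟩ := l.exists_maxY
        have hsub := hord.sublist v.subtree_leaves_sublist
        rw [hv, leaves, List.pairwise_append] at hsub
        intro p' hp'
        have := hsub.2.2 p hp p' hp'
        rw [hpe] at this
        exact (not_le.1 hle).trans this
      · intro S₀ σ hσ hS
        refine (step S₀ σ hσ hS (l.height * (descendBody.stepCost + 1) + 1) _ fun σ' h' => ?_).mono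
          ?_ (fun _ h => h)
        · refine hrun _ σ' (h'.2 hle) ?_
          simp only [height] at hS ⊢; omega
        · have : (l.height + 1) * (descendBody.stepCost + 1) ≤
              (RangeTree.node l r).height * (descendBody.stepCost + 1) :=
            Nat.mul_le_mul_right _ (by simp [height])
          rw [Nat.succ_mul] at this
          omega

/-- The time bound for locating, in terms of the height and the number of bits of the size. -/
def locateTime (m H : ℕ) : ℕ :=
  m * (searchBody.stepCost + 1) + H * (descendBody.stepCost + 1) + lastLeafProg.stepCost + 40

theorem locateProg_spec (M : StoredTree D T e Δ k) (hT : T.XInj)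
    (hord : T.leaves.Pairwise (fun p p' => p.2 < p'.2)) (q : ℝ × ℝ) (m : ℕ)
    (hm : T.leaves.length < 2 ^ m) :
    ∃ S : List T.Node, (Node.root T).IsCover q S ∧ S.length ≤ T.height + 1 ∧
      ∀ σ : NatState, σ.creg 0 = q.1 → σ.creg 1 = q.2 →
        Runs D locateProg σ (locateTime m T.height) (fun σ' => Holds e (T.xCount q.1) σ' S) := by
  obtain ⟨S, hc, hlen, hrun⟩ := M.descend_spec hT hord q T (.root T) rfl
  refine ⟨S, hc, hlen, fun σ hx hy => ?_⟩
  have hz := M.lt_pow (x := 0) (by omega)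
  have hfin : ∀ σ' : NatState,
      (σ'.reg 4 = T.xCount q.1 ∧ σ'.creg 0 = q.1 ∧ σ'.creg 1 = q.2) → Runs D (.seq (.asg 0 (.lit 0))
      (.seq (.asg 2 (.ld 3 (.lit 0))) (.seq (.asg 3 (.reg 4)) (.seq (.asg 6 (.ld 0 (.reg 2)))
      (.seq (.loop 6 descendBody) lastLeafProg))))) σ'
      (2 + (3 + (2 + (3 + (T.height * (descendBody.stepCost + 1) + 1 + lastLeafProg.stepCost)))))
      (fun σ' => Holds e (T.xCount q.1) σ' S) := by
    rintro σ' ⟨h4, h0, h1⟩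
    refine Runs.seq (Runs.asg (e := .lit 0) (n := 0) (.lit hz) ?_)
    refine Runs.seq (Runs.asg (e := .ld 3 (.lit 0)) (n := e (.root T)) (.ld (.lit hz) M.rd_root) ?_)
    refine Runs.seq (Runs.asg (e := .reg 4) (n := T.xCount q.1) (.reg (by norm_num) (by simp [h4])) ?_)
    refine Runs.seq (Runs.asg (e := .ld 0 (.reg 2)) (n := D.rd 0 (e (.root T)))
      (.ld (.reg (by norm_num) (by simp)) rfl) ?_)
    refine Runs.seq ((hrun [] _ ?_ ?_).mono le_rfl ?_)
    · exact ⟨⟨by simp, by simp⟩, by simp, by simp [Node.count_root (T.xCount_le q.1) hT], by simp,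
        by simp [h0], by simp [h1]⟩
    · have := M.bound; simp; omega
    · exact fun σ h => h
  refine (Runs.seq ((M.searchProg_spec hT q.1 q.2 m hm σ hx hy).mono le_rfl hfin)).mono ?_
    (fun _ h => h)
  simp only [locateTime]; omega

end StoredTree

/-- One step down from the node in register `0`, towards the point of rank given by register `1`;
register `2` holds the number of levels left. -/
def stepBody : RamProg :=
  .seq (.asg 4 (.ld 0 (.reg 0)))
  (.seq (.ite 4
    (.seq (.asg 5 (rankE (.reg 2) (.ld 5 (.reg 0) + .reg 1)))
    (.seq (.asg 6 (rankE (.reg 2) (.ld 5 (.reg 0) + .reg 1 + .lit 1) - .reg 5))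
    (.seq (.asg 7 (.reg 5 - rankE (.reg 2) (.ld 5 (.reg 0))))
    (.seq (.asg 8 (.reg 1 - .reg 7))
    (.ite 6 (.seq (.asg 1 (.reg 7)) (.asg 0 (.ld 2 (.reg 0))))
      (.seq (.asg 1 (.reg 8)) (.asg 0 (.ld 1 (.reg 0)))))))))
    .skip)
  (.seq (.asg 2 (.reg 2 - .lit 1)) (.asg 3 (.reg 2 % parE 4 3))))

/-- The last assignment turns the rank within a node into a position in the whole level, after which
no node is needed. -/
def stepPhase : RamProg :=
  .seq (.asg 2 (.ld 6 (.reg 0))) (.seq (.asg 3 (.reg 2 % parE 4 3)) (.seq (.loop 3 stepBody)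
    (.asg 1 (.ld 5 (.reg 0) + .reg 1))))

/-- One jump of the position in register `1`. -/
def jumpBody (o : ℕ) : RamProg :=
  .seq (.asg 1 (jumpE o (.reg 2 / parE o 0) (.reg 1)))
    (.seq (.asg 2 (.reg 2 - parE o 0)) (.asg 3 (.reg 2 % parE o 6)))

def jumpPhase (o : ℕ) : RamProg := .seq (.asg 3 (.reg 2 % parE o 6)) (.loop 3 (jumpBody o))

/-- Each jump length owns five consecutive arrays, the first of them at index 12. -/
def jumpPhases : ℕ → RamProg
  | 0 => .skip
  | i + 1 => .seq (jumpPhases i) (jumpPhase (12 + 5 * i))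

def reportProg (k : ℕ) : RamProg :=
  .seq stepPhase (.seq (jumpPhases k) (.seq (.asg 0 (.ld 8 (.reg 1)))
    (.seq (.cget 0 0 (.reg 0)) (.cget 1 1 (.reg 0)))))

/-! ### Correctness of reporting -/

namespace StoredTree

open RamProg WExpr

variable {w : ℕ} {D : DataMemory w} {T : RangeTree} {e : T.Node ≃ Fin T.numNodes}
  {Δ : ℕ → ℕ} {k : ℕ}

/-- The offset changes only array indices, so one time bound serves all jump lengths. -/
theorem jumpBody_stepCost (o : ℕ) : (jumpBody o).stepCost = (jumpBody 0).stepCost := rfl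

/-- The state `h` levels above the bottom on the way to the leaf `r`, at the node `v`. -/
structure AtStep (e : T.Node ≃ Fin T.numNodes) (r h : ℕ) (v : T.Node) (σ : NatState) : Prop where
  node : σ.reg 0 = e v
  rank : σ.reg 1 = v.count (T.xRank r)
  level : σ.reg 2 = h
  level_le : h ≤ T.height
  depth_le : v.depth ≤ T.height - h
  depth_eq : v.depth = T.height - h ∨ ∃ p, v.subtree = leaf p
  start_le : v.start ≤ r
  lt_end : r < v.start + v.size

theorem blockPos_eq_of_depth {v : T.Node} {r : ℕ} (h1 : v.start ≤ r) (h2 : r < v.start + v.size) :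
    blockPos T.leaves.length T.blockStart T.xRank v.depth r = v.start + v.count (T.xRank r) := by
  have := v.start_add_size_le
  rw [blockPos, (v.blockStart_eq_iff (by omega)).2 ⟨h1, h2⟩]; rfl

theorem count_eq_zero_of_leaf {v : T.Node} {p : ℝ × ℝ} {r : ℕ} (hv : v.subtree = leaf p)
    (h1 : v.start ≤ r) (h2 : r < v.start + v.size) : r = v.start ∧ v.count (T.xRank r) = 0 := by
  have hs : v.size = 1 := by rw [Node.size, hv]; rfl
  have hr : r = v.start := by omega
  refine ⟨hr, ?_⟩
  rw [Node.count, Finset.card_eq_zero, Finset.eq_empty_iff_forall_notMem]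
  intro i hi
  obtain ⟨a, b, c⟩ := v.mem_blockBelow_node.1 hi
  have : i = r := by omega
  subst this; omega

/-- A leaf reached early stays a block by itself at all lower levels, so its position there is its
index. The walk may therefore idle at the leaf while the level counter decreases. -/
theorem AtStep.blockPos_eq {r h : ℕ} {v : T.Node} {σ : NatState} (hs : AtStep e r h v σ) :
    blockPos T.leaves.length T.blockStart T.xRank (T.height - h) r =
      v.start + v.count (T.xRank r) := by
  rcases hs.depth_eq with hd | ⟨p, hv⟩
  · rw [← hd]; exact blockPos_eq_of_depth hs.start_le hs.lt_end
  · obtain ⟨hr, hc⟩ := count_eq_zero_of_leaf hv hs.start_le hs.lt_end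
    have hsz : v.size = 1 := by rw [Node.size, hv]; rfl
    have hlt := v.start_lt
    have hI := T.intervalHierarchy
    obtain ⟨m1, m2⟩ := hI.blockPos_mem (n := T.leaves.length) (xr := T.xRank)
      (d := T.height - h) (r := r) (by omega)
    obtain ⟨d, hd⟩ := Nat.exists_eq_add_of_le hs.depth_le
    have h3 : T.blockStart v.depth (blockPos T.leaves.length T.blockStart T.xRank
        (T.height - h) r) = T.blockStart v.depth r := by
      rw [hd] at m2 ⊢
      rw [← hI.refine_add v.depth d, m2, hI.refine_add]
    rw [(v.blockStart_eq_iff (by omega)).2 ⟨hs.start_le, hs.lt_end⟩, v.blockStart_eq_iff m1] at h3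
    omega

theorem stepBody_spec (M : StoredTree D T e Δ k) (hT : T.XInj) {r h : ℕ} {v : T.Node}
    {σ : NatState} (hs : AtStep e r (h + 1) v σ) :
    Fast D stepBody σ (fun σ' => (∃ v', AtStep e r h v' σ') ∧ σ'.reg 3 = h % Δ 1) := by
  have hpos := hs.blockPos_eq
  obtain ⟨h0, h1, h2, hle, hd1, hd2, hst, hen⟩ := hs
  have hb := M.bound
  have one : ∀ ρ : ℕ → ℕ, (WExpr.lit 1).Ev D ρ 1 := fun ρ => .lit (M.lt_pow (by omega))
  have hfin : ∀ (σ' : NatState) (v' : T.Node), σ'.reg 0 = e v' → σ'.reg 1 = v'.count (T.xRank r) →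
      σ'.reg 2 = h + 1 → v'.depth ≤ T.height - h →
      (v'.depth = T.height - h ∨ ∃ p, v'.subtree = leaf p) → v'.start ≤ r →
      r < v'.start + v'.size →
      Fast D (.seq (.asg 2 (.reg 2 - .lit 1)) (.asg 3 (.reg 2 % parE 4 3))) σ'
        (fun σ' => (∃ v', AtStep e r h v' σ') ∧ σ'.reg 3 = h % Δ 1) := by
    intro σ' v' a0 a1 a2 a3 a4 a5 a6
    refine Fast.seq (Fast.asg (n := h) (.sub (.reg (by norm_num) a2) (one _) (by omega)) ?_)
    refine Fast.asg (n := h % Δ 1) (.mod (.reg (by norm_num) (by simp))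
      (.ld (.lit (M.lt_pow (by omega))) M.rd_first)) ?_
    exact ⟨⟨v', by simp [a0], by simp [a1], by simp, by omega, a3, a4, a5, a6⟩, by simp⟩
  have hs1 : v.start < T.leaves.length := v.start_lt
  have hsz := v.start_add_size_le
  refine Fast.seq (Fast.asg (n := D.rd 0 (e v)) (.ld (.reg (by norm_num) h0) rfl) ?_)
  refine Fast.seq (Fast.ite (by norm_num) (fun hc => ?_) (fun hc => ?_))
  · obtain ⟨l, r', hv⟩ : ∃ l r', v.subtree = .node l r' := by
      rcases hU : v.subtree with p | ⟨l, r'⟩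
      · simp [M.rd_leaf v p hU] at hc
      · exact ⟨l, r', rfl⟩
    have hdep : v.depth = T.height - (h + 1) := by
      rcases hd2 with hd2 | ⟨p, hp⟩
      · exact hd2
      · rw [hv] at hp; simp at hp
    obtain ⟨vl, vr, hvl, hvr, sl, sr, c1, c2, c3, c4, c5⟩ := v.children_node hv
    have hsum := (Node.count_children v vl vr (T.xRank r) c1 c3 c4 c5).1
    have hbit := Node.bitRank_add_count hT v vl vr (T.xRank r) c1 c3 c4 c5
    have hlt : v.start + v.count (T.xRank r) < T.leaves.length := by
      rw [← hpos]
      exact (T.intervalHierarchy.blockPos_mem (by omega)).1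
    -- The bit at the current position tells which child contains the target `r`. The program does
    -- not know `r`; it obtains this bit as the difference of two consecutive bit ranks.
    have hsplit : splitBit T.leaves.length T.blockStart T.xRank v.depth
        (v.start + v.count (T.xRank r)) ↔ vr.start ≤ r := by
      rw [← hpos, ← hdep, T.intervalHierarchy.splitBit_blockPos hT.xRank_injOn (by omega),
        (v.blockStart_eq_iff (by omega)).2 ⟨hst, hen⟩, ← c1, ← c3, ne_eq,
        vl.blockStart_eq_iff (by omega)]
      omega
    have rstart : ∀ ρ : ℕ → ℕ, ρ 0 = e v → (WExpr.ld 5 (.reg 0)).Ev D ρ v.start :=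
      fun ρ h => .ld (.reg (by norm_num) h) (M.rd_start v)
    have rpos : ∀ ρ : ℕ → ℕ, ρ 0 = e v → ρ 1 = v.count (T.xRank r) →
        (WExpr.ld 5 (.reg 0) + .reg 1).Ev D ρ (v.start + v.count (T.xRank r)) :=
      fun ρ h h' => .add (rstart ρ h) (.reg (by norm_num) h') (M.lt_pow (by omega))
    have rrank : ∀ (ρ : ℕ → ℕ) (p : WExpr) (y : ℕ), ρ 2 = h + 1 → p.Ev D ρ y →
        y ≤ T.leaves.length → (rankE (.reg 2) p).Ev D ρ
          (bitRank T.leaves.length T.blockStart T.xRank v.depth y) := by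
      intro ρ p y a2 hp hy
      rw [hdep]
      exact M.rank_ev ρ _ _ (h + 1) y (.reg (by norm_num) a2) hp hle hy
    have hr1 := bitRank_le (n := T.leaves.length) (st := T.blockStart) (xr := T.xRank) v.depth
      v.start
    refine Fast.seq (Fast.asg (rrank _ _ _ (by simp [h2]) (rpos _ (by simp [h0]) (by simp [h1]))
      hlt.le) ?_)
    rw [hbit]
    refine Fast.seq (Fast.asg (n := if vr.start ≤ r then 1 else 0) ?_ ?_)
    · have e1 := WExpr.Ev.sub (rrank (((σ.setReg 4 (D.rd 0 (e v))).setReg 5 (bitRank T.leaves.length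
          T.blockStart T.xRank v.depth v.start + vr.count (T.xRank r))).reg) _ _ (by simp [h2])
          (.add (rpos _ (by simp [h0]) (by simp [h1])) (one _) (M.lt_pow (by omega))) hlt)
          (.reg (r := 5) (n := bitRank T.leaves.length
          T.blockStart T.xRank v.depth v.start + vr.count (T.xRank r)) (by norm_num) (by simp)) ?_
      · convert e1 using 1
        split_ifs with hc'
        · rw [bitRank_succ_of (hsplit.2 hc'), hbit]; omega
        · rw [bitRank_succ_of_not (fun h => hc' (hsplit.1 h)), hbit]; omega
      · by_cases hc' : vr.start ≤ r
        · rw [bitRank_succ_of (hsplit.2 hc'), hbit]; omega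
        · rw [bitRank_succ_of_not (fun h => hc' (hsplit.1 h)), hbit]
    refine Fast.seq (Fast.asg (n := vr.count (T.xRank r)) ?_ ?_)
    · have e1 := WExpr.Ev.sub (.reg (r := 5) (n := bitRank T.leaves.length
          T.blockStart T.xRank v.depth v.start + vr.count (T.xRank r)) (by norm_num) (by simp))
        (rrank ((((σ.setReg 4 (D.rd 0 (e v))).setReg 5 (bitRank T.leaves.length
          T.blockStart T.xRank v.depth v.start + vr.count (T.xRank r))).setReg 6
          (if vr.start ≤ r then 1 else 0)).reg) _ _ (by simp [h2])
          (rstart _ (by simp [h0])) hs1.le) (by omega)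
      rwa [Nat.add_sub_cancel_left] at e1
    have e4 : v.count (T.xRank r) - vr.count (T.xRank r) = vl.count (T.xRank r) := by omega
    refine Fast.seq (Fast.asg (n := vl.count (T.xRank r)) (e4 ▸ .sub (.reg (by norm_num)
      (by simp [h1])) (.reg (by norm_num) (by simp)) (by omega)) ?_)
    refine Fast.ite (by norm_num) (fun hc => ?_) (fun hc => ?_)
    · have hc' : vr.start ≤ r := by by_contra hcon; simp [hcon] at hc
      refine Fast.seq (Fast.asg (n := vr.count (T.xRank r)) (.reg (by norm_num) (by simp)) ?_)
      refine Fast.asg (n := e vr) (.ld (.reg (by norm_num) (by simp [h0])) (M.rd_right v vr hvr)) ?_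
      exact hfin _ vr (by simp) (by simp) (by simp [h2]) (by omega) (.inl (by omega)) hc'
        (by omega)
    · have hc' : ¬ vr.start ≤ r := by intro hcon; simp [hcon] at hc
      refine Fast.seq (Fast.asg (n := vl.count (T.xRank r)) (.reg (by norm_num) (by simp)) ?_)
      refine Fast.asg (n := e vl) (.ld (.reg (by norm_num) (by simp [h0])) (M.rd_left v vl hvl)) ?_
      exact hfin _ vl (by simp) (by simp) (by simp [h2]) (by omega) (.inl (by omega)) (by omega)
        (by omega)
  · have hlf : ∃ p, v.subtree = leaf p := by
      rcases hU : v.subtree with p | ⟨l, r'⟩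
      · exact ⟨p, rfl⟩
      · simp [M.rd_node v l r' hU] at hc
    exact Fast.skip (hfin _ v (by simp [h0]) (by simp [h1]) (by simp [h2]) (by omega) (.inr hlf)
      hst hen)

/-- The state at the position of the leaf `r`, at a level whose height is divisible by `δ`. -/
def AtLevel (T : RangeTree) (r δ : ℕ) (σ : NatState) : Prop :=
  ∃ h, σ.reg 2 = h ∧ h ≤ T.height ∧ δ ∣ h ∧
    σ.reg 1 = blockPos T.leaves.length T.blockStart T.xRank (T.height - h) r

theorem stepPhase_spec (M : StoredTree D T e Δ k) (hT : T.XInj) (hΔ : 0 < Δ 1) {r : ℕ} {v : T.Node}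
    {σ : NatState} (h0 : σ.reg 0 = e v) (h1 : σ.reg 1 = v.count (T.xRank r)) (hst : v.start ≤ r)
    (hen : r < v.start + v.size) :
    Runs D stepPhase σ (Δ 1 * (stepBody.stepCost + 1) + 20) (AtLevel T r (Δ 1)) := by
  have hdep := v.depth_add_height
  have key := Runs.loop (D := D) (r := 3) (c := stepBody) (T := stepBody.stepCost)
    (fun m σ => ∃ h v, AtStep e r h v σ ∧ σ.reg 3 = h % Δ 1 ∧ h % Δ 1 = m) (by norm_num) ?_
  · refine (Runs.seq (Runs.asg (n := T.height - v.depth) (.ld (.reg (by norm_num) h0)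
      (M.rd_height v)) (Runs.seq (Runs.asg (n := (T.height - v.depth) % Δ 1) (.mod (.reg (by norm_num)
      (by simp)) (.ld (.lit (M.lt_pow (by omega))) M.rd_first)) (Runs.seq (Runs.mono
      (key ((T.height - v.depth) % Δ 1) _ ⟨T.height - v.depth, v, ⟨by simp [h0], by simp [h1], by simp, by omega,
        by omega, .inl (by omega), hst, hen⟩, by simp, rfl⟩) le_rfl ?_)))))).mono
      (T := _ + (_ + (_ + ((WExpr.ld 5 (.reg 0) + .reg 1).cost + 1)))) ?_ (fun _ h => h)
    · rintro σ' ⟨⟨m, h, u, hs, a1, a2⟩, a3⟩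
      have hpos := hs.blockPos_eq
      have hlt := u.start_add_size_le
      have hsl := hs.start_le
      have hse := hs.lt_end
      have := (T.intervalHierarchy.blockPos_mem (n := T.leaves.length) (xr := T.xRank)
        (d := T.height - h) (r := r) (by omega)).1
      refine Runs.asg (n := u.start + u.count (T.xRank r)) (.add (.ld (.reg (by norm_num) hs.node)
        (M.rd_start u)) (.reg (by norm_num) hs.rank) (M.lt_pow (by omega))) ?_
      exact ⟨h, by simp [hs.level], hs.level_le, Nat.dvd_of_mod_eq_zero (by omega), by simp [hpos]⟩
    · have : (T.height - v.depth) % Δ 1 * (stepBody.stepCost + 1) ≤ Δ 1 * (stepBody.stepCost + 1) :=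
        Nat.mul_le_mul_right _ (Nat.mod_lt _ hΔ).le
      have c1 : (WExpr.ld 5 (.reg 0) + .reg 1).cost = 4 := rfl
      have c2 : (WExpr.ld 6 (.reg 0)).cost = 2 := rfl
      have c3 : (WExpr.reg 2 % .ld 4 (.lit 3)).cost = 4 := rfl
      omega
  · rintro m σ ⟨h, u, hs, a1, a2⟩ hne
    obtain ⟨h, rfl⟩ : ∃ h', h = h' + 1 := by
      rcases h with _ | h
      · simp at a1; omega
      · exact ⟨h, rfl⟩
    refine Runs.mono (M.stepBody_spec hT hs) le_rfl ?_
    rintro σ' ⟨⟨v', hv'⟩, b1⟩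
    refine ⟨h % Δ 1, ?_, h, v', hv', b1, rfl⟩
    have := Nat.add_mod h 1 (Δ 1)
    rw [a1, a2] at hne
    have e1 := Nat.div_add_mod (h + 1) (Δ 1)
    -- The residue `m` of `h + 1` is nonzero, so going one level down lowers it by exactly one; the
    -- residue is the loop rank.
    have e2 : h = m - 1 + Δ 1 * ((h + 1) / Δ 1) := by omega
    have e3 := Nat.mod_lt (h + 1) hΔ
    rw [e2, Nat.add_mul_mod_self_left, Nat.mod_eq_of_lt (by omega)]
    omega

/-- The height is `x` times the jump length, and each jump lowers `x` by one. The phase ends when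
`B` divides `x`, that is, after `x % B` jumps. -/
theorem jumpPhase_spec (M : StoredTree D T e Δ k) {B i : ℕ} (hi : i < k) (hB : 0 < B)
    (hΔ : 0 < Δ (i + 1)) (hBΔ : Δ (i + 2) = B * Δ (i + 1)) {r : ℕ} (hr : r < T.leaves.length)
    {σ : NatState} (hσ : AtLevel T r (Δ (i + 1)) σ) :
    Runs D (jumpPhase (12 + 5 * i)) σ (B * ((jumpBody 0).stepCost + 1) + 10)
      (AtLevel T r (Δ (i + 2))) := by
  have hp0 : ∀ ρ : ℕ → ℕ, (parE (12 + 5 * i) 0).Ev D ρ (Δ (i + 1)) :=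
    fun ρ => .ld (.lit (M.lt_pow (by omega))) (M.rd_step i hi)
  have hp6 : ∀ ρ : ℕ → ℕ, (parE (12 + 5 * i) 6).Ev D ρ (Δ (i + 2)) :=
    fun ρ => .ld (.lit (M.lt_pow (by omega))) (M.rd_next i hi)
  have hmod : ∀ x, x * Δ (i + 1) % Δ (i + 2) = x % B * Δ (i + 1) := by
    intro x; rw [hBΔ, Nat.mul_mod_mul_right]
  have key := Runs.loop (D := D) (r := 3) (c := jumpBody (12 + 5 * i)) (T := (jumpBody 0).stepCost)
    (fun m σ => ∃ x, σ.reg 2 = x * Δ (i + 1) ∧ x * Δ (i + 1) ≤ T.height ∧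
      σ.reg 1 = blockPos T.leaves.length T.blockStart T.xRank (T.height - x * Δ (i + 1)) r ∧
      σ.reg 3 = x * Δ (i + 1) % Δ (i + 2) ∧ x % B = m) (by norm_num) ?_
  · obtain ⟨h, h2, hle, ⟨x, rfl⟩, h1⟩ := hσ
    rw [Nat.mul_comm] at h2 hle h1
    refine (Runs.seq (Runs.asg (n := x * Δ (i + 1) % Δ (i + 2)) (.mod (.reg (by norm_num) h2) (hp6 _))
      ((key (x % B) _ ⟨x, by simp [h2], hle, by simp [h1], by simp, rfl⟩).mono le_rfl ?_))).mono ?_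
      (fun _ h => h)
    · rintro σ' ⟨⟨m, x, a1, a2, a3, a4, a5⟩, a6⟩
      exact ⟨x * Δ (i + 1), a1, a2, Nat.dvd_of_mod_eq_zero (by omega), a3⟩
    · have : x % B * ((jumpBody 0).stepCost + 1) ≤ B * ((jumpBody 0).stepCost + 1) :=
        Nat.mul_le_mul_right _ (Nat.mod_lt _ hB).le
      have c3 : (WExpr.reg 2 % parE (12 + 5 * i) 6).cost = 4 := rfl
      omega
  · rintro m σ ⟨x, a1, a2, a3, a4, a5⟩ hne
    rw [a4, hmod] at hne
    have hxB : x % B ≠ 0 := fun h0 => hne (by rw [h0, Nat.zero_mul])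
    obtain ⟨x, rfl⟩ : ∃ x', x = x' + 1 := by
      rcases x with _ | x
      · simp at hxB
      · exact ⟨x, rfl⟩
    have hdiv : (x + 1) * Δ (i + 1) / Δ (i + 1) = x + 1 := Nat.mul_div_cancel _ hΔ
    have hj := M.jump_ev i hi σ.reg (.reg 2 / parE (12 + 5 * i) 0) (.reg 1) x r
      (by have := WExpr.Ev.div (.reg (by norm_num) a1) (hp0 σ.reg); rwa [hdiv] at this) a2 hr
      (.reg (by norm_num) a3)
    have hsub : (x + 1) * Δ (i + 1) - Δ (i + 1) = x * Δ (i + 1) := by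
      rw [Nat.succ_mul, Nat.add_sub_cancel]
    have hle : x * Δ (i + 1) ≤ T.height := by rw [Nat.succ_mul] at a2; omega
    rw [← jumpBody_stepCost (12 + 5 * i)]
    refine Fast.seq (Fast.asg hj ?_)
    refine Fast.seq (Fast.asg (n := x * Δ (i + 1)) (hsub ▸ .sub (.reg (by norm_num) (by simp [a1]))
      (hp0 _) (by rw [Nat.succ_mul]; omega)) ?_)
    refine Fast.asg (n := x * Δ (i + 1) % Δ (i + 2)) (.mod (.reg (by norm_num) (by simp)) (hp6 _)) ?_
    refine ⟨x % B, ?_, x, by simp, hle, by simp, by simp, rfl⟩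
    have e1 := Nat.div_add_mod (x + 1) B
    have e3 := Nat.mod_lt (x + 1) hB
    have e2 : x = m - 1 + B * ((x + 1) / B) := by omega
    rw [e2, Nat.add_mul_mod_self_left, Nat.mod_eq_of_lt (by omega)]
    omega

theorem jumpPhases_spec (M : StoredTree D T e Δ k) {B : ℕ} (hB : 0 < B) (hΔ : ∀ i, Δ i = B ^ i)
    {r : ℕ} (hr : r < T.leaves.length) (j : ℕ) (hj : j ≤ k) {σ : NatState}
    (hσ : AtLevel T r (Δ 1) σ) :
    Runs D (jumpPhases j) σ (j * (B * ((jumpBody 0).stepCost + 1) + 10) + 1)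
      (AtLevel T r (Δ (j + 1))) := by
  induction j with
  | zero => exact (Runs.skip hσ).mono (by simp) (fun _ h => h)
  | succ j ih =>
    refine (Runs.seq ((ih (by omega)).mono le_rfl fun σ' h' => M.jumpPhase_spec (B := B) (i := j)
      (by omega) hB (by rw [hΔ]; exact pow_pos hB _) (by rw [hΔ, hΔ]; ring) hr h')).mono ?_
      (fun _ h => h)
    rw [Nat.succ_mul]; omega

/-- The time bound for reporting. -/
def reportTime (k B : ℕ) : ℕ :=
  B * (stepBody.stepCost + 1) + k * (B * ((jumpBody 0).stepCost + 1) + 10) + 40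

theorem reportProg_spec (M : StoredTree D T e Δ k) (hT : T.XInj) {B : ℕ} (hB : 0 < B)
    (hΔ : ∀ i, Δ i = B ^ i) (hk : T.height < B ^ (k + 1)) {v : T.Node} {i : ℕ}
    (hi : i < v.pointList.length) {σ : NatState} (h0 : σ.reg 0 = e v) (h1 : σ.reg 1 = i) :
    Runs D (reportProg k) σ (reportTime k B)
      (fun σ' => σ'.creg 0 = v.pointList[i].1 ∧ σ'.creg 1 = v.pointList[i].2) := by
  obtain ⟨r, r1, r2, r3, r4⟩ := v.pointList_getElem hT i hi
  have hv := v.start_add_size_le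
  have hΔ1 : Δ 1 = B := by rw [hΔ, pow_one]
  have hr : r < T.leaves.length := by omega
  have hfin : ∀ σ', AtLevel T r (Δ (k + 1)) σ' → Runs D (.seq (.asg 0 (.ld 8 (.reg 1)))
      (.seq (.cget 0 0 (.reg 0)) (.cget 1 1 (.reg 0)))) σ' (3 + (2 + 2))
      (fun σ' => σ'.creg 0 = v.pointList[i].1 ∧ σ'.creg 1 = v.pointList[i].2) := by
    rintro σ' ⟨h, a1, a2, a3, a4⟩
    -- A multiple of B^(k+1) that is at most the height, hence smaller than B^(k+1), is 0: the
    -- lowest level has been reached.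
    have hz : h = 0 := Nat.eq_zero_of_dvd_of_lt a3 (by rw [hΔ]; omega)
    subst hz
    obtain ⟨m1, m2⟩ := T.intervalHierarchy.blockPos_mem (n := T.leaves.length) (xr := T.xRank)
      (d := T.height - 0) hr
    rw [T.blockStart_of_height_le _ (by simp) _ m1, T.blockStart_of_height_le _ (by simp) _ hr] at m2
    rw [m2] at a4
    obtain ⟨u, hul, hrd⟩ := M.rd_yleaf r hr
    obtain ⟨q1, q2⟩ := M.coord_leaf u _ hul
    refine Runs.seq (Runs.asg (e := .ld 8 (.reg 1)) (n := e u) (.ld (.reg (by norm_num) a4) hrd) ?_)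
    refine Runs.seq (Runs.cget (e := .reg 0) (n := e u) (.reg (by norm_num) (by simp)) ?_)
    refine Runs.cget (e := .reg 0) (n := e u) (.reg (by norm_num) (by simp)) ?_
    rw [q1, q2, r3]
    simp
  refine (Runs.seq ((M.stepPhase_spec hT (hΔ1 ▸ hB) h0 (by rw [h1, r4]) r1 r2).mono le_rfl
    fun σ' h' => Runs.seq ((M.jumpPhases_spec hB hΔ hr k le_rfl h').mono le_rfl hfin))).mono ?_
    (fun _ h => h)
  rw [hΔ1, reportTime]; omega

end StoredTree

/-! ### The stored tables -/


namespace WExpr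

variable {w : ℕ} {D : DataMemory w} {ρ : ℕ → ℕ}

theorem Ev.cast {e : WExpr} {x y : ℕ} (h : e.Ev D ρ x) (hxy : x = y) : e.Ev D ρ y := hxy ▸ h

theorem parE_ev {o j x : ℕ} (hj : j < 2 ^ w) (h : D.rd o j = x) : (parE o j).Ev D ρ x :=
  .ld (.lit hj) h

theorem index_lt {j m W R N : ℕ} (hj : j < R) (hm : m < W) (hN : R * W ≤ N) : j * W + m < N := by
  have : (j + 1) * W ≤ R * W := Nat.mul_le_mul_right _ hj
  rw [Nat.succ_mul] at this
  omega

/-- All intermediate values are indices into tables that fit into the address space, or are at most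
`n`; hence nothing overflows. -/
theorem rankE_ev {n H W b : ℕ} {st : ℕ → ℕ → ℕ} {xr : ℕ → ℕ} (h5 : 5 ≤ 2 ^ w) (hW : W = n / b + 1)
    (hb : 0 < b) (p1 : D.rd 4 1 = W) (p2 : D.rd 4 2 = b) (hHW : (H + 1) * W ≤ 2 ^ w)
    (hbw : 2 ^ b * (b + 1) ≤ 2 ^ w)
    (r9 : ∀ h ≤ H, ∀ m < W, D.rd 9 (h * W + m) = bitRank n st xr (H - h) (m * b))
    (r10 : ∀ h ≤ H, ∀ m < W, D.rd 10 (h * W + m) = packedWord 2 b (splitBitNat n st xr (H - h)) m)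
    (r11 : ∀ z < 2 ^ b, ∀ o < b + 1, D.rd 11 (z * (b + 1) + o) = digitCount z o)
    (hn : n < 2 ^ w) {h p : WExpr} {x y : ℕ} (hx : h.Ev D ρ x) (hy : p.Ev D ρ y) (hxH : x ≤ H)
    (hyn : y ≤ n) : (rankE h p).Ev D ρ (bitRank n st xr (H - x) y) := by
  have e1 : (parE 4 1).Ev D ρ W := parE_ev (by omega) p1
  have e2 : (parE 4 2).Ev D ρ b := parE_ev (by omega) p2
  have hm : y / b < W := by rw [hW]; exact Nat.lt_succ_of_le (Nat.div_le_div_right hyn)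
  have hi := index_lt (j := x) (Nat.lt_succ_of_le hxH) hm hHW
  have ei : (h * parE 4 1 + p / parE 4 2).Ev D ρ (x * W + y / b) :=
    .add (.mul hx e1 ((Nat.le_add_right _ _).trans_lt hi)) (.div hy e2) hi
  have hz : packedWord 2 b (splitBitNat n st xr (H - x)) (y / b) < 2 ^ b :=
    packDigits_lt (fun j => splitBitNat_lt n st xr _ _) b
  have ho : y % b < b + 1 := (Nat.mod_lt y hb).trans (Nat.lt_succ_self b)
  have hi2 := index_lt hz ho hbw
  have hbb : b + 1 ≤ 2 ^ b * (b + 1) := Nat.le_mul_of_pos_left _ (by positivity)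
  have hb2 : b + 1 < 2 ^ w := by
    have h2 : 2 * (b + 1) ≤ 2 ^ b * (b + 1) := Nat.mul_le_mul_right _ (by
      calc 2 = 2 ^ 1 := rfl
        _ ≤ 2 ^ b := Nat.pow_le_pow_right (by norm_num) hb)
    omega
  have key := bitRank_eq_block n st xr (H - x) hb y
  have hle := bitRank_le (n := n) (st := st) (xr := xr) (H - x) y
  exact Ev.cast (.add (.ld ei (r9 x hxH _ hm)) (.ld (.add (.mul (.ld ei (r10 x hxH _ hm))
    (.add e2 (.lit (by omega)) hb2) (by omega)) (.mod hy e2) hi2) (r11 _ hz _ ho)) (by omega)) key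

theorem unpackE_ev {o a R W K s : ℕ} {g : ℕ → ℕ → ℕ} (h7 : 7 ≤ 2 ^ w) (hK : 0 < K)
    (p1 : D.rd o 1 = s) (p2 : D.rd o 2 = K) (p3 : D.rd o 3 = W) (hRW : R * W ≤ 2 ^ w)
    (hg : ∀ j p, g j p < s)
    (ra : ∀ j < R, ∀ m < W, D.rd a (j * W + m) = packedWord s K (g j) m)
    (r4 : ∀ m < K, D.rd (o + 4) m = s ^ m) {j p : WExpr} {x y : ℕ} (hx : j.Ev D ρ x)
    (hy : p.Ev D ρ y) (hxR : x < R) (hyW : y / K < W) : (unpackE o a j p).Ev D ρ (g x y) := by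
  have e1 : (parE o 1).Ev D ρ s := parE_ev (by omega) p1
  have e2 : (parE o 2).Ev D ρ K := parE_ev (by omega) p2
  have e3 : (parE o 3).Ev D ρ W := parE_ev (by omega) p3
  have hi := index_lt hxR hyW hRW
  exact Ev.cast (.mod (.div (.ld (.add (.mul hx e3 ((Nat.le_add_right _ _).trans_lt hi)) (.div hy e2) hi) (ra x hxR _ hyW))
    (.ld (.mod hy e2) (r4 _ (Nat.mod_lt y hK)))) e1) (packedWord_get hK (hg x) y)

/-- Indices and remainders are packed in the same base `s`, so one table of powers unpacks both.
This is where `c ≤ s` is needed. -/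
theorem jumpE_ev {n o R WK WS K s c : ℕ} {tab : ℕ → ℕ → ℕ → ℕ} {ix lo : ℕ → ℕ → ℕ}
    {f : ℕ → ℕ → ℕ} (h7 : 7 ≤ 2 ^ w) (hK : 0 < K) (hcs : c ≤ s) (hn : n ≤ 2 ^ w)
    (hWK : WK = n / K + 1) (hWS : WS = n / s + 1)
    (p1 : D.rd o 1 = s) (p2 : D.rd o 2 = K) (p3 : D.rd o 3 = WK) (p4 : D.rd o 4 = WS)
    (p5 : D.rd o 5 = c) (hRK : R * WK ≤ 2 ^ w) (hRS : R * WS * c ≤ 2 ^ w)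
    (hix : ∀ j p, ix j p < c) (hlo : ∀ j p, lo j p < s)
    (r1 : ∀ j < R, ∀ m < WK, D.rd (o + 1) (j * WK + m) = packedWord s K (ix j) m)
    (r2 : ∀ j < R, ∀ m < WK, D.rd (o + 2) (j * WK + m) = packedWord s K (lo j) m)
    (r3 : ∀ j < R, ∀ m < WS, ∀ i < c, D.rd (o + 3) ((j * WS + m) * c + i) = tab j m i)
    (r4 : ∀ m < K, D.rd (o + 4) m = s ^ m) {j p : WExpr} {x y : ℕ} (hx : j.Ev D ρ x)
    (hy : p.Ev D ρ y) (hxR : x < R) (hyn : y < n)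
    (hf : tab x (y / s) (ix x y) * s + lo x y = f x y) (hfn : f x y < n) :
    (jumpE o j p).Ev D ρ (f x y) := by
  have e1 : (parE o 1).Ev D ρ s := parE_ev (by omega) p1
  have e4 : (parE o 4).Ev D ρ WS := parE_ev (by omega) p4
  have e5 : (parE o 5).Ev D ρ c := parE_ev (by omega) p5
  have hc : 0 < c := (Nat.zero_le _).trans_lt (hix 0 0)
  have hyK : y / K < WK := by rw [hWK]; exact Nat.lt_succ_of_le (Nat.div_le_div_right hyn.le)
  have hyS : y / s < WS := by rw [hWS]; exact Nat.lt_succ_of_le (Nat.div_le_div_right hyn.le)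
  have hi : x * WS + y / s < R * WS := index_lt hxR hyS le_rfl
  have hi2 := index_lt hi (hix x y) hRS
  have h1 : x * WS ≤ x * WS + y / s := Nat.le_add_right _ _
  have hle : R * WS ≤ R * WS * c := Nat.le_mul_of_pos_right _ hc
  have u1 := unpackE_ev (g := ix) h7 hK p1 p2 p3 hRK (fun j p => (hix j p).trans_le hcs) r1 r4 hx hy
    hxR hyK
  have u2 := unpackE_ev (g := lo) h7 hK p1 p2 p3 hRK hlo r2 r4 hx hy hxR hyK
  exact Ev.cast (.add (.mul (.ld (.add (.mul (.add (.mul hx e4 (h1.trans_lt (by omega))) (.div hy e1) (by omega)) e5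
    (by omega)) u1 hi2) (r3 x hxR _ hyS _ (hix x y))) e1 (by omega)) u2 (by omega)) hf

end WExpr

/-- A list of arrays given by their lengths and entries. -/
def tabulate (w N : ℕ) (len : ℕ → ℕ) (F : ℕ → ℕ → ℕ) : List (List (BitVec w)) :=
  (List.range N).map fun m => (List.range (len m)).map fun j => BitVec.ofNat w (F m j)

theorem tabulate_length_le (w N : ℕ) (len : ℕ → ℕ) (F : ℕ → ℕ → ℕ) (b : ℕ)
    (h : ∀ m < N, len m ≤ b) : (tabulate w N len F).flatten.length ≤ N * b := by
  rw [tabulate, List.length_flatten, List.map_map]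
  have : (List.length ∘ fun m => (List.range (len m)).map fun j => BitVec.ofNat w (F m j)) = len := by
    funext m; simp
  rw [this]
  refine (List.sum_le_card_nsmul _ b ?_).trans (by simp)
  intro x hx
  obtain ⟨m, hm, rfl⟩ := List.mem_map.1 hx
  exact h m (List.mem_range.1 hm)

namespace RangeTree

variable {w : ℕ} {T : RangeTree} {e : T.Node ≃ Fin T.numNodes}

theorem rd_augmented {N : ℕ} {len : ℕ → ℕ} {F : ℕ → ℕ → ℕ} {a m j : ℕ} (ha : a = m + 4)
    (hm : m < N) (hj : j < len m) (hF : F m j < 2 ^ w) :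
    (T.augmented w e (tabulate w N len F)).rd a j = F m j := by
  subst ha
  have : (T.augmented w e (tabulate w N len F)).words.getD (m + 4) [] =
      (tabulate w N len F).getD m [] := rfl
  rw [DataMemory.rd, this, tabulate, List.getD_eq_getElem (List.map _ (List.range N)) _ (by simpa using hm)]
  simp only [List.getElem_map, List.getElem_range]
  rw [List.getD_eq_getElem _ _ (by simpa using hj)]
  simp [Nat.mod_eq_of_lt hF]

theorem getD_ofFn_node {α : Type*} (g : Fin T.numNodes → α) (d : α) (v : T.Node) :
    (List.ofFn g).getD (e v) d = g (e v) := by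
  rw [List.getD_eq_getElem _ _ (by simp)]
  simp

theorem rd_augmented_zero {X : List (List (BitVec w))} (hw : 0 < w) (v : T.Node) :
    (T.augmented w e X).rd 0 (e v) = if v.leftChild.isSome then 1 else 0 := by
  have : (T.augmented w e X).words.getD 0 [] =
    List.ofFn fun k => if (e.symm k).leftChild.isSome then 1 else 0 := rfl
  rw [DataMemory.rd, this, getD_ofFn_node, Equiv.symm_apply_apply]
  have h1 : 1 < 2 ^ w := Nat.one_lt_two_pow (by omega)
  split_ifs <;> simp [Nat.mod_eq_of_lt h1]

theorem nodeWord_some (hn : T.numNodes ≤ 2 ^ w) (u : T.Node) :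
    (nodeWord w e (some u)).toNat = e u := by
  simp only [nodeWord, BitVec.toNat_ofNat]
  exact Nat.mod_eq_of_lt ((e u).isLt.trans_le hn)

theorem rd_augmented_one {X : List (List (BitVec w))} (hn : T.numNodes ≤ 2 ^ w) {v u : T.Node}
    (h : v.leftChild = some u) : (T.augmented w e X).rd 1 (e v) = e u := by
  have : (T.augmented w e X).words.getD 1 [] =
    List.ofFn fun k => nodeWord w e (e.symm k).leftChild := rfl
  rw [DataMemory.rd, this, getD_ofFn_node, Equiv.symm_apply_apply, h, nodeWord_some hn]

theorem rd_augmented_two {X : List (List (BitVec w))} (hn : T.numNodes ≤ 2 ^ w) {v u : T.Node}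
    (h : v.rightChild = some u) : (T.augmented w e X).rd 2 (e v) = e u := by
  have : (T.augmented w e X).words.getD 2 [] =
    List.ofFn fun k => nodeWord w e (e.symm k).rightChild := rfl
  rw [DataMemory.rd, this, getD_ofFn_node, Equiv.symm_apply_apply, h, nodeWord_some hn]

theorem rd_augmented_three {X : List (List (BitVec w))} (hn : T.numNodes ≤ 2 ^ w) :
    (T.augmented w e X).rd 3 0 = e (.root T) :=
  nodeWord_some hn _

theorem coord_augmented_zero {X : List (List (BitVec w))} (v : T.Node) :
    ((T.augmented w e X).coords.getD 0 []).getD (e v) 0 = v.coordFields.1 := by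
  have : (T.augmented w e X).coords.getD 0 [] = List.ofFn fun k => (e.symm k).coordFields.1 := rfl
  rw [this, getD_ofFn_node, Equiv.symm_apply_apply]

theorem coord_augmented_one {X : List (List (BitVec w))} (v : T.Node) :
    ((T.augmented w e X).coords.getD 1 []).getD (e v) 0 = v.coordFields.2 := by
  have : (T.augmented w e X).coords.getD 1 [] = List.ofFn fun k => (e.symm k).coordFields.2 := rfl
  rw [this, getD_ofFn_node, Equiv.symm_apply_apply]

/-- The lengths of the arrays that do not depend on a jump length. -/
def baseLen (T : RangeTree) (b : ℕ) : ℕ → ℕ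
  | 0 => 4
  | 1 => T.numNodes
  | 2 => T.numNodes
  | 3 => T.leaves.length
  | 4 => T.leaves.length
  | 5 => (T.height + 1) * (T.leaves.length / b + 1)
  | 6 => (T.height + 1) * (T.leaves.length / b + 1)
  | 7 => 2 ^ b * (b + 1)
  | _ => 0

open Classical in
/-- The entries of the arrays that do not depend on a jump length. -/
noncomputable def baseVal (T : RangeTree) (e : T.Node ≃ Fin T.numNodes) (b B : ℕ) : ℕ → ℕ → ℕ
  | 0, j => [T.leaves.length, T.leaves.length / b + 1, b, B].getD j 0
  | 1, j => if h : j < T.numNodes then (e.symm ⟨j, h⟩).start else 0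
  | 2, j => if h : j < T.numNodes then T.height - (e.symm ⟨j, h⟩).depth else 0
  | 3, j => if h : ∃ u : T.Node, ∃ r < T.leaves.length, T.xRank r = j ∧
      u.subtree = leaf (T.leafAt r) then e h.choose else 0
  | 4, j => if h : ∃ u : T.Node, u.subtree = leaf (T.leafAt j) then e h.choose else 0
  | 5, m => bitRank T.leaves.length T.blockStart T.xRank
      (T.height - m / (T.leaves.length / b + 1)) (m % (T.leaves.length / b + 1) * b)
  | 6, m => packedWord 2 b (splitBitNat T.leaves.length T.blockStart T.xRank
      (T.height - m / (T.leaves.length / b + 1))) (m % (T.leaves.length / b + 1))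
  | 7, m => digitCount (m / (b + 1)) (m % (b + 1))
  | _, _ => 0

/-- The lengths of the arrays for the jump length `δ`. -/
def jumpLen (n H δ s K c : ℕ) : ℕ → ℕ
  | 0 => 7
  | 1 => (H / δ + 1) * (n / K + 1)
  | 2 => (H / δ + 1) * (n / K + 1)
  | 3 => (H / δ + 1) * (n / s + 1) * c
  | 4 => K
  | _ => 0

/-- The entries of the arrays for the jump length `δ`. -/
def jumpVal (n δ δ' s K c : ℕ) (tab : ℕ → ℕ → ℕ → ℕ) (ix lo : ℕ → ℕ → ℕ) : ℕ → ℕ → ℕ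
  | 0, m => [δ, s, K, n / K + 1, n / s + 1, c, δ'].getD m 0
  | 1, m => packedWord s K (ix (m / (n / K + 1))) (m % (n / K + 1))
  | 2, m => packedWord s K (lo (m / (n / K + 1))) (m % (n / K + 1))
  | 3, m => tab (m / c / (n / s + 1)) (m / c % (n / s + 1)) (m % c)
  | 4, m => s ^ m
  | _, _ => 0

end RangeTree

/-- Array `m` of a base family followed by families of five arrays each. -/
def familyAt {α : Type*} (base : ℕ → α) (fam : ℕ → ℕ → α) (m : ℕ) : α :=
  if m < 8 then base m else fam ((m - 8) / 5) ((m - 8) % 5)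

theorem familyAt_base {α : Type*} (base : ℕ → α) (fam : ℕ → ℕ → α) {m : ℕ} (hm : m < 8) :
    familyAt base fam m = base m := if_pos hm

theorem familyAt_fam {α : Type*} (base : ℕ → α) (fam : ℕ → ℕ → α) (i : ℕ) {t : ℕ} (ht : t < 5) :
    familyAt base fam (8 + 5 * i + t) = fam i t := by
  have h1 : (8 + 5 * i + t - 8) / 5 = i := by omega
  have h2 : (8 + 5 * i + t - 8) % 5 = t := by omega
  rw [familyAt, if_neg (by omega), h1, h2]

/-! ### Sizes of the tables -/

/-- There are O(log n) levels, each with n / b + 1 blocks of `b` bits. As `b` is at least half of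
log n, the logarithms cancel. -/
theorem levels_mul_blocks_le {n H γ : ℕ} (hn : 0 < n) (hH : H ≤ γ * (Nat.log 2 n + 1)) :
    (H + 1) * (n / (Nat.log 2 n / 2 + 1) + 1) ≤ (3 * γ + 3) * n := by
  set L := Nat.log 2 n + 1 with hL
  set b := Nat.log 2 n / 2 + 1 with hb
  have h1 : L ≤ 2 * b := by omega
  have h2 : b * (n / b) ≤ n := Nat.mul_div_le n b
  have h3 : L ≤ n := Nat.succ_le_of_lt (Nat.log_lt_self 2 hn.ne')
  have h4 : L * (n / b) ≤ 2 * n := by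
    calc L * (n / b) ≤ 2 * b * (n / b) := Nat.mul_le_mul_right _ h1
      _ = 2 * (b * (n / b)) := by ring
      _ ≤ 2 * n := by omega
  have h5 : H + 1 ≤ (γ + 1) * L := by rw [Nat.succ_mul]; omega
  calc (H + 1) * (n / b + 1) ≤ (γ + 1) * L * (n / b + 1) := Nat.mul_le_mul_right _ h5
    _ = (γ + 1) * (L * (n / b) + L) := by ring
    _ ≤ (γ + 1) * (2 * n + n) := Nat.mul_le_mul_left _ (by omega)
    _ = (3 * γ + 3) * n := by ring

/-- Halving the logarithm keeps the digit-count table near √n rows: with m the half, 2^m · 2^m ≤ n,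
and the row length m + 2 is at most 2 · 2^m. -/
theorem two_pow_half_log_le {n : ℕ} (hn : 0 < n) :
    2 ^ (Nat.log 2 n / 2 + 1) * (Nat.log 2 n / 2 + 1 + 1) ≤ 4 * n := by
  set m := Nat.log 2 n / 2 with hm
  have h1 : m < 2 ^ m := Nat.lt_two_pow_self
  have h2 : 2 ^ m * 2 ^ m ≤ n := by
    rw [← pow_add]
    exact (Nat.pow_le_pow_right (by norm_num) (by omega)).trans (Nat.pow_log_le_self 2 hn.ne')
  calc 2 ^ (m + 1) * (m + 1 + 1) ≤ 2 ^ (m + 1) * (2 * 2 ^ m) := Nat.mul_le_mul_left _ (by omega)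
    _ = 4 * (2 ^ m * 2 ^ m) := by ring
    _ ≤ 4 * n := by omega

/-- The number of positions in a window of the table for jumps of length `δ`. -/
def windowSize (n κ δ : ℕ) : ℕ := min (2 ^ (κ * δ)) n

/-- The number of packed entries in a word of the table for jumps of length `δ`. -/
def perWord (n κ δ : ℕ) : ℕ := max 1 (Nat.log 2 n / (κ * δ))

/-- The number of quotients stored for a window. -/
def windowStride (n κ δ : ℕ) : ℕ := if 2 ^ (κ * δ) ≤ n then 2 ^ (δ + 3) else 1

section

variable {n κ δ k γ H : ℕ}

theorem windowSize_pos (hn : 0 < n) : 0 < windowSize n κ δ :=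
  lt_min (by positivity) hn

theorem windowSize_le : windowSize n κ δ ≤ n := min_le_right _ _

theorem perWord_pos : 0 < perWord n κ δ := lt_max_of_lt_left one_pos

theorem windowStride_pos : 0 < windowStride n κ δ := by
  unfold windowStride; split_ifs <;> positivity

/-- A packed word has `perWord` digits in base `windowSize`, so its value fits into a machine word.
If the nominal window exceeds `n`, there is one digit and the base is `n`. -/
theorem windowSize_pow_le (hn : 0 < n) (hκ : 0 < κ * δ) :
    windowSize n κ δ ^ perWord n κ δ ≤ n := by
  by_cases h : 2 ^ (κ * δ) ≤ n
  · have h1 : κ * δ ≤ Nat.log 2 n := Nat.le_log_of_pow_le (by norm_num) h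
    have h2 : perWord n κ δ = Nat.log 2 n / (κ * δ) :=
      max_eq_right ((Nat.one_le_div_iff hκ).2 h1)
    rw [windowSize, min_eq_left h, h2, ← pow_mul]
    exact (Nat.pow_le_pow_right (by norm_num) (Nat.mul_div_le _ _)).trans
      (Nat.pow_log_le_self 2 hn.ne')
  · have h1 : Nat.log 2 n < κ * δ := Nat.log_lt_of_lt_pow hn.ne' (not_le.1 h)
    have h2 : perWord n κ δ = 1 := by rw [perWord, Nat.div_eq_of_lt h1]; rfl
    rw [h2, pow_one]; exact windowSize_le

theorem windowStride_eq (h : 2 ^ (κ * δ) ≤ n) : windowStride n κ δ = 2 ^ (δ + 3) := if_pos h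

/-- The reason for the exponent k + 5: one δ pays for 2^δ, three more for the factor 8, and k + 1
for the logarithm. -/
theorem stride_mul_log_le (hδ : 0 < δ) (hL : Nat.log 2 n + 1 ≤ 2 ^ ((k + 1) * δ)) :
    2 ^ (δ + 3) * (Nat.log 2 n + 1) ≤ 2 ^ ((k + 5) * δ) := by
  have e : (k + 5) * δ = (δ + 3 * δ) + (k + 1) * δ := by ring
  rw [e, pow_add 2 (δ + 3 * δ)]
  exact Nat.mul_le_mul (Nat.pow_le_pow_right (n := 2) (by norm_num) (by omega)) hL

theorem windowStride_le (hn : 0 < n) (hδ : 0 < δ) (hL : Nat.log 2 n + 1 ≤ 2 ^ ((k + 1) * δ)) :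
    windowStride n (k + 5) δ ≤ windowSize n (k + 5) δ := by
  by_cases h : 2 ^ ((k + 5) * δ) ≤ n
  · rw [windowStride_eq h, windowSize, min_eq_left h]
    exact (Nat.le_mul_of_pos_right _ (by omega)).trans (stride_mul_log_le hδ hL)
  · rw [windowStride, if_neg h]; exact windowSize_pos hn

theorem window_dichotomy :
    windowSize n κ δ = n ∨ 4 * 2 ^ δ + 1 ≤ windowStride n κ δ := by
  by_cases h : 2 ^ (κ * δ) ≤ n
  · right
    rw [windowStride_eq h, pow_add]
    have : 0 < 2 ^ δ := by positivity
    omega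
  · left; exact min_eq_right (not_le.1 h).le

theorem levels_mul_words_le (hn : 0 < n) (hδ : 0 < δ) (hκ : 0 < κ)
    (hH : H ≤ γ * (Nat.log 2 n + 1)) :
    (H / δ + 1) * (n / perWord n κ δ + 1) ≤ (2 * κ * γ + γ + 2) * n := by
  set L := Nat.log 2 n + 1 with hLd
  set K := perWord n κ δ with hK
  have hK0 : 0 < K := perWord_pos
  have hκδ : 0 < κ * δ := Nat.mul_pos hκ hδ
  have h3 : L ≤ n := Nat.succ_le_of_lt (Nat.log_lt_self 2 hn.ne')
  have h1 : L ≤ 2 * κ * δ * K := by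
    have a : Nat.log 2 n < κ * δ * (Nat.log 2 n / (κ * δ) + 1) := Nat.lt_mul_div_succ _ hκδ
    have b : Nat.log 2 n / (κ * δ) ≤ K := le_max_right _ _
    have c : κ * δ * (Nat.log 2 n / (κ * δ) + 1) ≤ κ * δ * (2 * K) :=
      Nat.mul_le_mul_left _ (by omega)
    calc L ≤ κ * δ * (2 * K) := by omega
      _ = _ := by ring
  have h2 : H / δ * (n / K) ≤ 2 * κ * γ * n := by
    -- After multiplication by `L`, the H / δ tables and the n / K words in each are paid for by `L
    -- ≤ 2κδK`, so δ and K cancel.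
    refine Nat.le_of_mul_le_mul_left (c := L) ?_ (by omega)
    calc L * (H / δ * (n / K)) ≤ 2 * κ * δ * K * (H / δ * (n / K)) := Nat.mul_le_mul_right _ h1
      _ = 2 * κ * ((δ * (H / δ)) * (K * (n / K))) := by ring
      _ ≤ 2 * κ * (H * n) := Nat.mul_le_mul_left _ (Nat.mul_le_mul (Nat.mul_div_le _ _)
          (Nat.mul_div_le _ _))
      _ ≤ 2 * κ * (γ * L * n) := Nat.mul_le_mul_left _ (Nat.mul_le_mul_right _ hH)
      _ = L * (2 * κ * γ * n) := by ring
  have h4 : H / δ ≤ γ * n := (Nat.div_le_self _ _).trans (hH.trans (Nat.mul_le_mul_left _ h3))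
  have h5 : n / K ≤ n := Nat.div_le_self _ _
  calc (H / δ + 1) * (n / K + 1) = H / δ * (n / K) + H / δ + n / K + 1 := by ring
    _ ≤ 2 * κ * γ * n + γ * n + n + n := by omega
    _ = _ := by ring

theorem levels_mul_windows_le (hn : 0 < n) (hδ : 0 < δ) (hH : H ≤ γ * (Nat.log 2 n + 1))
    (hL : Nat.log 2 n + 1 ≤ 2 ^ ((k + 1) * δ)) :
    (H / δ + 1) * (n / windowSize n (k + 5) δ + 1) * windowStride n (k + 5) δ ≤
      (2 * γ + 2) * n := by
  set L := Nat.log 2 n + 1 with hLd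
  have h3 : L ≤ n := Nat.succ_le_of_lt (Nat.log_lt_self 2 hn.ne')
  have h5 : H / δ + 1 ≤ (γ + 1) * L := by
    have := Nat.div_le_self H δ
    rw [Nat.succ_mul]; omega
  have h6 : L * ((n / windowSize n (k + 5) δ + 1) * windowStride n (k + 5) δ) ≤ 2 * n := by
    -- Otherwise there is one window of length `n` with a single quotient, and the row has two
    -- entries.
    by_cases h : 2 ^ ((k + 5) * δ) ≤ n
    · have h1 : L * windowStride n (k + 5) δ ≤ windowSize n (k + 5) δ := by
        rw [windowStride_eq h, windowSize, min_eq_left h, Nat.mul_comm]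
        exact stride_mul_log_le hδ hL
      have h2 := windowSize_le (n := n) (κ := k + 5) (δ := δ)
      calc _ = (n / windowSize n (k + 5) δ + 1) * (L * windowStride n (k + 5) δ) := by ring
        _ ≤ (n / windowSize n (k + 5) δ + 1) * windowSize n (k + 5) δ := Nat.mul_le_mul_left _ h1
        _ = windowSize n (k + 5) δ * (n / windowSize n (k + 5) δ) + windowSize n (k + 5) δ := by ring
        _ ≤ n + n := Nat.add_le_add (Nat.mul_div_le _ _) h2
        _ = 2 * n := by ring
    · rw [windowSize, min_eq_right (not_le.1 h).le, windowStride, if_neg h, Nat.div_self hn]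
      omega
  calc _ = (H / δ + 1) * ((n / windowSize n (k + 5) δ + 1) * windowStride n (k + 5) δ) := by ring
    _ ≤ (γ + 1) * L * ((n / windowSize n (k + 5) δ + 1) * windowStride n (k + 5) δ) :=
      Nat.mul_le_mul_right _ h5
    _ = (γ + 1) * (L * ((n / windowSize n (k + 5) δ + 1) * windowStride n (k + 5) δ)) := by ring
    _ ≤ (γ + 1) * (2 * n) := Nat.mul_le_mul_left _ h6
    _ = _ := by ring

theorem perWord_le (hn : 0 < n) : perWord n κ δ ≤ n :=
  max_le hn ((Nat.div_le_self _ _).trans (Nat.log_lt_self 2 hn.ne').le)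

end

/-- The number of words in an array, per point. -/
def arrayBound (k γ : ℕ) : ℕ := 2 * (k + 5) * γ + 3 * γ + 12 + 2 ^ (k + 1) * γ

theorem List.getD_lt_of_forall {l : List ℕ} {b : ℕ} (hb : 0 < b) (h : ∀ x ∈ l, x < b) (m : ℕ) :
    l.getD m 0 < b := by
  by_cases hm : m < l.length
  · rw [List.getD_eq_getElem _ _ hm]; exact h _ (List.getElem_mem hm)
  · rw [List.getD_eq_default _ _ (not_lt.1 hm)]; exact hb

theorem Nat.mul_add_div_mod {W m : ℕ} (j : ℕ) (hm : m < W) :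
    (j * W + m) / W = j ∧ (j * W + m) % W = m := by
  rw [Nat.mul_comm]
  exact ⟨by rw [Nat.mul_add_div (by omega), Nat.div_eq_of_lt hm, Nat.add_zero],
    by rw [Nat.mul_add_mod, Nat.mod_eq_of_lt hm]⟩

open WExpr in
-- Each of the 8 + 5k arrays is bounded separately by `arrayBound k γ` words per point. `hL` keeps
-- the lists of quotients small, and `hB` lets the jump lengths, which are stored as parameters, fit
-- into words.
theorem RangeTree.exists_storedTree (T : RangeTree) (hT : T.XInj) (e : T.Node ≃ Fin T.numNodes)
    (k γ B w : ℕ) (hB0 : 0 < B) (hH : T.height ≤ γ * (Nat.log 2 T.leaves.length + 1))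
    (hL : Nat.log 2 T.leaves.length + 1 ≤ 2 ^ ((k + 1) * B))
    (hB : B ^ (k + 1) ≤ (2 ^ (k + 1) * γ + 1) * T.leaves.length)
    (hw : (arrayBound k γ + 12) * T.leaves.length ≤ 2 ^ w) :
    ∃ X : List (List (BitVec w)),
      X.flatten.length ≤ (8 + 5 * k) * (arrayBound k γ * T.leaves.length) ∧
      StoredTree (T.augmented w e X) T e (fun i => B ^ i) k := by
  set n := T.leaves.length with hnd
  have hn : 0 < n := T.leaves_length_pos
  set b := Nat.log 2 n / 2 + 1 with hbd
  have hb : 0 < b := Nat.succ_pos _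
  set κ := k + 5 with hκ
  have hδ : ∀ i, 0 < B ^ i := fun i => pow_pos hB0 i
  have hLi : ∀ i, Nat.log 2 n + 1 ≤ 2 ^ ((k + 1) * B ^ (i + 1)) := fun i =>
    hL.trans (Nat.pow_le_pow_right (by norm_num) (Nat.mul_le_mul_left _ (by
      calc B = B ^ 1 := (pow_one B).symm
        _ ≤ B ^ (i + 1) := Nat.pow_le_pow_right hB0 (by omega))))
  -- Row `j` leads from height `j * B ^ (i + 1)` to the next lower multiple. Where the subtraction
  -- truncates, the table exists but is never consulted.
  have hex : ∀ i j : ℕ, ∃ (tab : ℕ → ℕ → ℕ) (ix lo : ℕ → ℕ), (∀ j i, tab j i ≤ n) ∧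
      (∀ p, ix p < windowStride n κ (B ^ (i + 1))) ∧
      (∀ p, lo p < windowSize n κ (B ^ (i + 1))) ∧
      ∀ r < n, ∀ p, p = blockPos n T.blockStart T.xRank (T.height - j * B ^ (i + 1)) r →
        tab (p / windowSize n κ (B ^ (i + 1))) (ix p) * windowSize n κ (B ^ (i + 1)) + lo p =
          blockPos n T.blockStart T.xRank (T.height - j * B ^ (i + 1) + B ^ (i + 1)) r :=
    fun i j => T.intervalHierarchy.exists_jump_table hT.xRank_injOn _ _ _ _ (windowSize_pos hn)
      windowStride_pos window_dichotomy
  choose tab ix lo htab hix hlo hjump using hex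
  set len : ℕ → ℕ := familyAt (T.baseLen b) (fun i => jumpLen n T.height (B ^ (i + 1))
    (windowSize n κ (B ^ (i + 1))) (perWord n κ (B ^ (i + 1))) (windowStride n κ (B ^ (i + 1))))
    with hlen
  set F : ℕ → ℕ → ℕ := familyAt (T.baseVal e b B) (fun i => jumpVal n (B ^ (i + 1)) (B ^ (i + 2))
    (windowSize n κ (B ^ (i + 1))) (perWord n κ (B ^ (i + 1))) (windowStride n κ (B ^ (i + 1)))
    (tab i) (ix i) (lo i)) with hF
  have hnn := T.numNodes_add_one
  rw [← hnd] at hnn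
  have hLn : Nat.log 2 n + 1 ≤ n := Nat.succ_le_of_lt (Nat.log_lt_self 2 hn.ne')
  have hHn : T.height ≤ γ * n := hH.trans (Nat.mul_le_mul_left _ hLn)
  have q1 := levels_mul_blocks_le hn hH
  have q2 := two_pow_half_log_le hn
  rw [← hbd] at q1 q2
  have q3 : ∀ i, _ := fun i => levels_mul_words_le (κ := κ) (H := T.height) hn (hδ (i + 1))
    (by omega) hH
  have q4 : ∀ i, _ := fun i => levels_mul_windows_le (k := k) (H := T.height) hn (hδ (i + 1)) hH
    (hLi i)
  rw [← hκ] at q4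
  have hbound : ∀ c, c ≤ arrayBound k γ → c * n ≤ arrayBound k γ * n :=
    fun c hc => Nat.mul_le_mul_right _ hc
  have hab : arrayBound k γ = 2 * κ * γ + 3 * γ + 12 + 2 ^ (k + 1) * γ := rfl
  have hbig : arrayBound k γ * n + 12 * n ≤ 2 ^ w := by rw [← Nat.add_mul]; exact hw
  have l5 : (T.height + 1) * (n / b + 1) ≤ arrayBound k γ * n := q1.trans (hbound _ (by omega))
  have l7 : 2 ^ b * (b + 1) ≤ arrayBound k γ * n := q2.trans (hbound _ (by omega))
  have l1 : ∀ i, (T.height / B ^ (i + 1) + 1) * (n / perWord n κ (B ^ (i + 1)) + 1) ≤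
      arrayBound k γ * n := fun i => (q3 i).trans (hbound _ (by omega))
  have l3 : ∀ i, (T.height / B ^ (i + 1) + 1) * (n / windowSize n κ (B ^ (i + 1)) + 1) *
      windowStride n κ (B ^ (i + 1)) ≤ arrayBound k γ * n :=
    fun i => (q4 i).trans (hbound _ (by omega))
  have l12 : 12 * n ≤ arrayBound k γ * n := hbound 12 (by omega)
  have lk : ∀ i < k, B ^ (i + 2) ≤ arrayBound k γ * n := fun i hi =>
    (Nat.pow_le_pow_right hB0 (by omega)).trans (hB.trans (hbound _ (by omega)))
  refine ⟨tabulate w (8 + 5 * k) len F, tabulate_length_le _ _ _ _ _ ?_, ?_⟩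
  · intro m hm
    by_cases hm8 : m < 8
    · rw [hlen, familyAt_base _ _ hm8]
      interval_cases m <;> simp only [baseLen, ← hnd] <;> omega
    · obtain ⟨i, t, ht, rfl⟩ : ∃ i t, t < 5 ∧ m = 8 + 5 * i + t :=
        ⟨(m - 8) / 5, (m - 8) % 5, Nat.mod_lt _ (by norm_num), by omega⟩
      rw [hlen, familyAt_fam _ _ _ ht]
      have := perWord_le (κ := κ) (δ := B ^ (i + 1)) hn
      have := l1 i
      have := l3 i
      interval_cases t <;> simp only [jumpLen] <;> omega
  · have hwp : 0 < w := by
      rcases Nat.eq_zero_or_pos w with rfl | h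
      · simp at hbig; omega
      · exact h
    have hnw : T.numNodes ≤ 2 ^ w := by omega
    have rb : ∀ {a m j : ℕ}, a = m + 4 → m < 8 → j < T.baseLen b m → T.baseVal e b B m j < 2 ^ w →
        (T.augmented w e (tabulate w (8 + 5 * k) len F)).rd a j = T.baseVal e b B m j := by
      intro a m j ha hm hj hv
      have hF' : F m = T.baseVal e b B m := familyAt_base _ _ hm
      have hl' : len m = T.baseLen b m := familyAt_base _ _ hm
      rw [rd_augmented ha (by omega) (by rwa [hl']) (by rwa [hF']), hF']
    have rj : ∀ {a i t j : ℕ}, a = 12 + 5 * i + t → i < k → t < 5 →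
        j < jumpLen n T.height (B ^ (i + 1)) (windowSize n κ (B ^ (i + 1)))
          (perWord n κ (B ^ (i + 1))) (windowStride n κ (B ^ (i + 1))) t →
        jumpVal n (B ^ (i + 1)) (B ^ (i + 2)) (windowSize n κ (B ^ (i + 1)))
          (perWord n κ (B ^ (i + 1))) (windowStride n κ (B ^ (i + 1))) (tab i) (ix i) (lo i) t j
          < 2 ^ w →
        (T.augmented w e (tabulate w (8 + 5 * k) len F)).rd a j =
          jumpVal n (B ^ (i + 1)) (B ^ (i + 2)) (windowSize n κ (B ^ (i + 1)))
          (perWord n κ (B ^ (i + 1))) (windowStride n κ (B ^ (i + 1))) (tab i) (ix i) (lo i) t j := by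
      intro a i t j ha hi ht hj hv
      have hF' : F (8 + 5 * i + t) = _ := familyAt_fam _ _ i ht
      have hl' : len (8 + 5 * i + t) = _ := familyAt_fam _ _ i ht
      rw [rd_augmented (m := 8 + 5 * i + t) (by omega) (by omega) (by rwa [hl']) (by rwa [hF']), hF']
    have hBk : B ≤ arrayBound k γ * n := by
      calc B = B ^ 1 := (pow_one B).symm
        _ ≤ B ^ (k + 1) := Nat.pow_le_pow_right hB0 (by omega)
        _ ≤ _ := hB.trans (hbound _ (by omega))
    have v0 : ∀ j, T.baseVal e b B 0 j < 2 ^ w := by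
      intro j
      refine List.getD_lt_of_forall (by positivity) ?_ j
      have := Nat.div_le_self n b
      simp only [List.mem_cons, List.not_mem_nil, or_false, ← hnd]
      rintro x (rfl | rfl | rfl | rfl) <;> omega
    have u0 : ∀ i < k, ∀ j, jumpVal n (B ^ (i + 1)) (B ^ (i + 2)) (windowSize n κ (B ^ (i + 1)))
          (perWord n κ (B ^ (i + 1))) (windowStride n κ (B ^ (i + 1))) (tab i) (ix i) (lo i) 0 j
          < 2 ^ w := by
      intro i hi j
      refine List.getD_lt_of_forall (by positivity) ?_ j
      have a1 := lk i hi
      have a2 : B ^ (i + 1) ≤ B ^ (i + 2) := Nat.pow_le_pow_right hB0 (by omega)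
      have a3 := windowSize_le (n := n) (κ := κ) (δ := B ^ (i + 1))
      have a4 := perWord_le (κ := κ) (δ := B ^ (i + 1)) hn
      have a5 := Nat.div_le_self n (perWord n κ (B ^ (i + 1)))
      have a6 := Nat.div_le_self n (windowSize n κ (B ^ (i + 1)))
      have a7 := windowStride_le hn (hδ (i + 1)) (hLi i)
      rw [← hκ] at a7
      simp only [List.mem_cons, List.not_mem_nil, or_false]
      rintro x (rfl | rfl | rfl | rfl | rfl | rfl | rfl) <;> omega
    have hnodes : ∀ v : T.Node, (e v : ℕ) < 2 ^ w := fun v => (e v).isLt.trans_le hnw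
    constructor
    case bound =>
      have : T.height ≤ arrayBound k γ * n := hHn.trans (hbound _ (by omega))
      omega
    case rd_leaf =>
      intro v p hv
      rw [rd_augmented_zero hwp, (v.children_leaf hv).1]; simp
    case rd_node =>
      intro v l r hv
      obtain ⟨vl, vr, h1, -⟩ := v.children_node hv
      rw [rd_augmented_zero hwp, h1]; simp
    case rd_left => exact fun v u h => rd_augmented_one hnw h
    case rd_right => exact fun v u h => rd_augmented_two hnw h
    case rd_root => exact rd_augmented_three hnw
    case coord_leaf =>
      intro v p hv
      rw [coord_augmented_zero, coord_augmented_one, Node.coordFields, hv]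
      exact ⟨rfl, rfl⟩
    case coord_node =>
      intro v l r hv
      rw [coord_augmented_one, Node.coordFields, hv]
    case rd_length => exact rb (m := 0) rfl (by norm_num) (by simp [baseLen]) (v0 0)
    case rd_first =>
      rw [rb (m := 0) rfl (by norm_num) (by simp [baseLen]) (v0 3)]
      simp [baseVal]
    case rd_start =>
      intro v
      have hv : T.baseVal e b B 1 (e v) = v.start := by simp [baseVal]
      have := v.start_lt
      rw [rb (m := 1) rfl (by norm_num) (e v).isLt (by omega), hv]
    case rd_height =>
      intro v
      have hv : T.baseVal e b B 2 (e v) = T.height - v.depth := by simp [baseVal]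
      have : T.height ≤ arrayBound k γ * n := hHn.trans (hbound _ (by omega))
      rw [rb (m := 2) rfl (by norm_num) (e v).isLt (by omega), hv]
    case rd_xleaf =>
      intro r hr
      obtain ⟨u, -, hu⟩ := Node.exists_leaf r hr
      have hq : ∃ u : T.Node, ∃ r' < T.leaves.length, T.xRank r' = T.xRank r ∧
          u.subtree = leaf (T.leafAt r') := ⟨u, r, hr, rfl, hu⟩
      have hv : T.baseVal e b B 3 (T.xRank r) = e hq.choose := dif_pos hq
      obtain ⟨r', h1, h2, h3⟩ := hq.choose_spec
      have : r' = r := hT.xRank_injOn (by simpa using h1) (by simpa using hr) h2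
      subst this
      refine ⟨hq.choose, h3, ?_⟩
      rw [rb (m := 3) rfl (by norm_num) (T.xRank_lt hr) (by rw [hv]; exact hnodes _), hv]
    case rd_yleaf =>
      intro r hr
      obtain ⟨u, -, hu⟩ := Node.exists_leaf r hr
      have hq : ∃ u : T.Node, u.subtree = leaf (T.leafAt r) := ⟨u, hu⟩
      have hv : T.baseVal e b B 4 r = e hq.choose := dif_pos hq
      refine ⟨hq.choose, hq.choose_spec, ?_⟩
      rw [rb (m := 4) rfl (by norm_num) hr (by rw [hv]; exact hnodes _), hv]
    case rd_step =>
      intro i hi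
      exact rj (t := 0) rfl hi (by norm_num) (by simp [jumpLen]) (u0 i hi 0)
    case rd_next =>
      intro i hi
      exact rj (t := 0) rfl hi (by norm_num) (by simp [jumpLen]) (u0 i hi 6)
    case rank_ev =>
      intro ρ h p x y hx hy hxH hyn
      have hidx : ∀ h ≤ T.height, ∀ m < n / b + 1,
          h * (n / b + 1) + m < (T.height + 1) * (n / b + 1) :=
        fun h hh m hm => index_lt (Nat.lt_succ_of_le hh) hm le_rfl
      have hmb : ∀ m < n / b + 1, m * b ≤ n := fun m hm =>
        (Nat.mul_le_mul_right _ (Nat.le_of_lt_succ hm)).trans (Nat.div_mul_le_self _ _)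
      refine rankE_ev (n := n) (H := T.height) (W := n / b + 1) (b := b) (by omega) rfl hb
        (rb (m := 0) (j := 1) rfl (by norm_num) (by simp [baseLen]) (v0 1))
        (rb (m := 0) (j := 2) rfl (by norm_num) (by simp [baseLen]) (v0 2))
        (by omega) (by omega) ?_ ?_ ?_ (by omega) hx hy hxH hyn
      · intro h hh m hm
        obtain ⟨d1, d2⟩ := Nat.mul_add_div_mod h hm
        have hv : T.baseVal e b B 5 (h * (n / b + 1) + m) =
            bitRank n T.blockStart T.xRank (T.height - h) (m * b) := by
          simp only [baseVal, ← hnd, d1, d2]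
        have := bitRank_le (n := n) (st := T.blockStart) (xr := T.xRank) (T.height - h) (m * b)
        have := hmb m hm
        rw [rb (m := 5) rfl (by norm_num) (hidx h hh m hm) (by omega), hv]
      · intro h hh m hm
        obtain ⟨d1, d2⟩ := Nat.mul_add_div_mod h hm
        have hv : T.baseVal e b B 6 (h * (n / b + 1) + m) =
            packedWord 2 b (splitBitNat n T.blockStart T.xRank (T.height - h)) m := by
          simp only [baseVal, ← hnd, d1, d2]
        have h1 : packedWord 2 b (splitBitNat n T.blockStart T.xRank (T.height - h)) m < 2 ^ b :=
          packDigits_lt (fun j => splitBitNat_lt _ _ _ _ _) b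
        have h2 : 2 ^ b ≤ 2 ^ b * (b + 1) := Nat.le_mul_of_pos_right _ (Nat.succ_pos _)
        rw [rb (m := 6) rfl (by norm_num) (hidx h hh m hm) (by omega), hv]
      · intro z hz o ho
        obtain ⟨d1, d2⟩ := Nat.mul_add_div_mod z ho
        have hv : T.baseVal e b B 7 (z * (b + 1) + o) = digitCount z o := by
          simp only [baseVal, d1, d2]
        have h1 := digitCount_le z o
        have h2 : b + 1 ≤ 2 ^ b * (b + 1) := Nat.le_mul_of_pos_left _ (by positivity)
        rw [rb (m := 7) rfl (by norm_num) (index_lt hz ho le_rfl) (by omega), hv]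
    case jump_ev =>
      intro i hi ρ j p x r hj hx hr hp
      have hKp := windowSize_pow_le (n := n) (κ := κ) (δ := B ^ (i + 1)) hn
        (Nat.mul_pos (by omega) (hδ _))
      have hs0 := windowSize_pos (κ := κ) (δ := B ^ (i + 1)) hn
      have hcs := windowStride_le (k := k) hn (hδ (i + 1)) (hLi i)
      rw [← hκ] at hcs
      obtain ⟨m1, -⟩ := T.intervalHierarchy.blockPos_mem (n := n) (xr := T.xRank)
        (d := T.height - (x + 1) * B ^ (i + 1)) hr
      obtain ⟨m2, -⟩ := T.intervalHierarchy.blockPos_mem (n := n) (xr := T.xRank)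
        (d := T.height - x * B ^ (i + 1)) hr
      have hf := hjump i (x + 1) r hr _ rfl
      -- Here `hx` guarantees that the subtraction does not truncate, so the jump ends at the
      -- intended level.
      have hlev : T.height - (x + 1) * B ^ (i + 1) + B ^ (i + 1) = T.height - x * B ^ (i + 1) := by
        rw [Nat.succ_mul] at hx ⊢; omega
      rw [hlev] at hf
      have hrow : x + 1 < T.height / B ^ (i + 1) + 1 :=
        Nat.lt_succ_of_le ((Nat.le_div_iff_mul_le (hδ _)).2 hx)
      have hpk : ∀ (g : ℕ → ℕ), (∀ q, g q < windowSize n κ (B ^ (i + 1))) → ∀ m,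
          packedWord (windowSize n κ (B ^ (i + 1))) (perWord n κ (B ^ (i + 1))) g m < 2 ^ w :=
        fun g hg m => (packDigits_lt (fun j => hg _) _).trans_le (by omega)
      have a1 := l1 i
      have a3 := l3 i
      refine jumpE_ev (n := n) (R := T.height / B ^ (i + 1) + 1)
        (WK := n / perWord n κ (B ^ (i + 1)) + 1) (WS := n / windowSize n κ (B ^ (i + 1)) + 1)
        (K := perWord n κ (B ^ (i + 1))) (s := windowSize n κ (B ^ (i + 1)))
        (c := windowStride n κ (B ^ (i + 1))) (tab := tab i) (ix := ix i) (lo := lo i)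
        (f := fun _ _ => blockPos n T.blockStart T.xRank (T.height - x * B ^ (i + 1)) r)
        (by omega) perWord_pos hcs (by omega) rfl rfl
        (rj (t := 0) (j := 1) rfl hi (by norm_num) (by simp [jumpLen]) (u0 i hi 1))
        (rj (t := 0) (j := 2) rfl hi (by norm_num) (by simp [jumpLen]) (u0 i hi 2))
        (rj (t := 0) (j := 3) rfl hi (by norm_num) (by simp [jumpLen]) (u0 i hi 3))
        (rj (t := 0) (j := 4) rfl hi (by norm_num) (by simp [jumpLen]) (u0 i hi 4))
        (rj (t := 0) (j := 5) rfl hi (by norm_num) (by simp [jumpLen]) (u0 i hi 5))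
        (by omega) (by omega) (hix i) (hlo i) ?_ ?_ ?_ ?_ hj hp hrow m1 hf m2
      · intro j' hj' m hm
        obtain ⟨d1, d2⟩ := Nat.mul_add_div_mod j' hm
        rw [rj (t := 1) rfl hi (by norm_num) (index_lt hj' hm le_rfl) (hpk _
          (fun q => (hix i _ q).trans_le hcs) _)]
        simp only [jumpVal, d1, d2]
      · intro j' hj' m hm
        obtain ⟨d1, d2⟩ := Nat.mul_add_div_mod j' hm
        rw [rj (t := 2) rfl hi (by norm_num) (index_lt hj' hm le_rfl) (hpk _ (hlo i _) _)]
        simp only [jumpVal, d1, d2]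
      · intro j' hj' m hm c' hc'
        obtain ⟨d1, d2⟩ := Nat.mul_add_div_mod j' hm
        obtain ⟨d3, d4⟩ := Nat.mul_add_div_mod
          (j' * (n / windowSize n κ (B ^ (i + 1)) + 1) + m) hc'
        rw [rj (t := 3) rfl hi (by norm_num) (index_lt (index_lt hj' hm le_rfl) hc' le_rfl)
          ((htab i _ _ _).trans_lt (by omega))]
        simp only [jumpVal, d1, d2, d3, d4]
      · intro m hm
        have : windowSize n κ (B ^ (i + 1)) ^ m ≤ n :=
          (Nat.pow_le_pow_right hs0 hm.le).trans hKp
        exact rj (t := 4) rfl hi (by norm_num) hm (this.trans_lt (by omega))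

/-! ### Logarithms, the choice of the base, and the final estimates -/

theorem RangeTree.length_le_two_pow_height (T : RangeTree) : T.leaves.length ≤ 2 ^ T.height := by
  induction T with
  | leaf p => simp [leaves, height]
  | node l r hl hr =>
    have h1 : 2 ^ l.height ≤ 2 ^ max l.height r.height :=
      Nat.pow_le_pow_right (by norm_num) (le_max_left _ _)
    have h2 : 2 ^ r.height ≤ 2 ^ max l.height r.height :=
      Nat.pow_le_pow_right (by norm_num) (le_max_right _ _)
    simp only [leaves, height, List.length_append, pow_succ]
    omega

theorem one_le_lg (n : ℕ) : 1 ≤ lg n := le_max_left _ _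

theorem lg_le_log_add_one (n : ℕ) : lg n ≤ (Nat.log 2 n + 1 : ℕ) := by
  refine max_le (by push_cast; linarith [(Nat.cast_nonneg (Nat.log 2 n) : (0 : ℝ) ≤ _)]) ?_
  rcases Nat.eq_zero_or_pos n with rfl | hn
  · simp
  · rw [Real.logb_le_iff_le_rpow (by norm_num) (by exact_mod_cast hn), Real.rpow_natCast]
    exact_mod_cast (Nat.lt_pow_succ_log_self (by norm_num) n).le

theorem log_add_one_le_lg {n : ℕ} (hn : 0 < n) : ((Nat.log 2 n + 1 : ℕ) : ℝ) ≤ 2 * lg n := by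
  have h1 : (Nat.log 2 n : ℝ) ≤ lg n := by
    refine le_trans ?_ (le_max_right _ _)
    rw [Real.le_logb_iff_rpow_le (by norm_num) (by exact_mod_cast hn), Real.rpow_natCast]
    exact_mod_cast Nat.pow_log_le_self 2 hn.ne'
  have := one_le_lg n
  push_cast
  linarith

theorem BitVec.eq_ofNat_of_toNat_eq {w : ℕ} {x : BitVec w} {n : ℕ} (h : x.toNat = n) :
    x = BitVec.ofNat w n := by
  rw [← h, BitVec.ofNat_toNat, BitVec.setWidth_eq]

theorem RangeTree.IsOver.nodup {T : RangeTree} {P : Finset (ℝ × ℝ)} (h : T.IsOver P) :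
    T.leaves.Nodup :=
  h.1.imp (fun hab e => by rw [e] at hab; exact lt_irrefl _ hab)

theorem RangeTree.IsOver.length_eq {T : RangeTree} {P : Finset (ℝ × ℝ)} (h : T.IsOver P) :
    T.leaves.length = P.card := by
  rw [← List.toFinset_card_of_nodup h.nodup]
  congr 1
  ext p
  rw [List.mem_toFinset, h.2]

theorem RangeTree.IsOver.xInj {T : RangeTree} {P : Finset (ℝ × ℝ)} (h : T.IsOver P)
    (hP : GeneralPosition P) : T.XInj := by
  intro i hi j hj e
  have hi : i < T.leaves.length := by simpa using hi
  have hj : j < T.leaves.length := by simpa using hj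
  simp only [leafAt, List.getD_eq_getElem _ _ hi, List.getD_eq_getElem _ _ hj] at e
  have := hP.1 ((h.2 _).1 (List.getElem_mem hi)) ((h.2 _).1 (List.getElem_mem hj)) e
  exact h.nodup.getElem_inj_iff.1 this

/-- The least base `B` with `H < B ^ (k + 1)` grows like the `(k + 1)`-st root of `H`. -/
theorem exists_base (k H : ℕ) : ∃ B, 0 < B ∧ H < B ^ (k + 1) ∧ (B - 1) ^ (k + 1) ≤ H := by
  have hex : ∃ B, H < B ^ (k + 1) :=
    ⟨H + 1, (Nat.lt_succ_self H).trans_le (Nat.le_self_pow (Nat.succ_ne_zero k) _)⟩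
  have h0 : 0 < Nat.find hex := by
    rw [Nat.find_pos]; simp
  exact ⟨Nat.find hex, h0, Nat.find_spec hex, not_lt.1 (Nat.find_min hex (by omega))⟩

/-- For `B ≥ 2` one has `B ≤ 2 (B - 1)`, so minimality of the base costs only the factor 2^(k+1).
This keeps all jump lengths linear in `n`. -/
theorem base_pow_le {k H γ n B : ℕ} (hn : 0 < n) (hB0 : 0 < B) (hH : H ≤ γ * n)
    (hB : (B - 1) ^ (k + 1) ≤ H) : B ^ (k + 1) ≤ (2 ^ (k + 1) * γ + 1) * n := by
  rcases Nat.lt_or_ge B 2 with h | h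
  · have : B = 1 := by omega
    subst this
    rw [one_pow]; exact Nat.mul_pos (Nat.succ_pos _) hn
  · calc B ^ (k + 1) ≤ (2 * (B - 1)) ^ (k + 1) := Nat.pow_le_pow_left (by omega) _
      _ = 2 ^ (k + 1) * (B - 1) ^ (k + 1) := Nat.mul_pow _ _ _
      _ ≤ 2 ^ (k + 1) * (γ * n) := Nat.mul_le_mul_left _ (hB.trans hH)
      _ = 2 ^ (k + 1) * γ * n := (Nat.mul_assoc _ _ _).symm
      _ ≤ _ := Nat.mul_le_mul_right _ (Nat.le_succ _)

/-- Since ε (k + 1) ≥ 1, `l` is at most the (k+1)-st power of `l ^ ε`; comparing (k+1)-st powers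
bounds `B - 1`, and the remaining 1 is absorbed by `l ^ ε ≥ 1`. -/
theorem base_le_rpow {k H γ B : ℕ} {l ε : ℝ} (hl : 1 ≤ l) (hε : 0 < ε) (hk : 1 / ε ≤ k)
    (hH : (H : ℝ) ≤ γ * l) (hB : (B - 1) ^ (k + 1) ≤ H) : (B : ℝ) ≤ (γ + 2) * l ^ ε := by
  have hlε : 1 ≤ l ^ ε := Real.one_le_rpow hl hε.le
  have hγ : (0 : ℝ) ≤ γ := Nat.cast_nonneg _
  have h1 : l ≤ (l ^ ε) ^ (k + 1) := by
    rw [← Real.rpow_natCast, ← Real.rpow_mul (by linarith)]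
    refine Real.self_le_rpow_of_one_le hl ?_
    rw [div_le_iff₀ hε] at hk
    push_cast
    nlinarith
  have h2 : ((B - 1 : ℕ) : ℝ) ^ (k + 1) ≤ ((γ + 1) * l ^ ε) ^ (k + 1) := by
    calc ((B - 1 : ℕ) : ℝ) ^ (k + 1) ≤ H := by exact_mod_cast hB
      _ ≤ γ * l := hH
      _ ≤ (γ + 1) * l := by nlinarith
      _ ≤ (γ + 1) ^ (k + 1) * (l ^ ε) ^ (k + 1) :=
        mul_le_mul (le_self_pow₀ (by linarith) (Nat.succ_ne_zero k)) h1 (by linarith) (by positivity)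
      _ = _ := (mul_pow _ _ _).symm
  have h3 : ((B - 1 : ℕ) : ℝ) ≤ (γ + 1) * l ^ ε :=
    le_of_pow_le_pow_left₀ (Nat.succ_ne_zero k) (by positivity) h2
  have h4 : (B : ℝ) ≤ ((B - 1 : ℕ) : ℝ) + 1 := by
    exact_mod_cast (by omega : B ≤ B - 1 + 1)
  nlinarith

/-- The factor in the time bound for reporting. -/
def reportFactor (k : ℕ) : ℕ :=
  stepBody.stepCost + 1 + k * ((jumpBody 0).stepCost + 1 + 10) + 40

theorem reportTime_le {k B : ℕ} (hB : 0 < B) :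
    StoredTree.reportTime k B ≤ B * reportFactor k := by
  unfold StoredTree.reportTime reportFactor
  have h1 : k * (B * ((jumpBody 0).stepCost + 1) + 10) ≤ B * (k * ((jumpBody 0).stepCost + 1 + 10)) := by
    calc k * (B * ((jumpBody 0).stepCost + 1) + 10)
        ≤ k * (B * ((jumpBody 0).stepCost + 1) + B * 10) := Nat.mul_le_mul_left _ (by omega)
      _ = _ := by ring
  have h2 : B * (stepBody.stepCost + 1 + k * ((jumpBody 0).stepCost + 1 + 10) + 40) =
      B * (stepBody.stepCost + 1) + B * (k * ((jumpBody 0).stepCost + 1 + 10)) + B * 40 := by ring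
  rw [h2]
  omega

theorem StoredTree.Holds.holdsNodes {w : ℕ} {T : RangeTree} {e : T.Node ≃ Fin T.numNodes} {c : ℕ}
    {σ : NatState} {S : List T.Node} {s : RamState w} (h : Holds e c σ S) (hs : Rep s σ)
    (hS : S.length ≤ 2 ^ w) : s.HoldsNodes e S := by
  refine ⟨BitVec.eq_ofNat_of_toNat_eq ?_, fun j hj => BitVec.eq_ofNat_of_toNat_eq ?_⟩
  · rw [hs.1 0 (by norm_num), h.1]
  · rw [hs.2.2 0 j (by omega), (h.2 j hj).1]

theorem StoredTree.Holds.holdsSizes {w : ℕ} {T : RangeTree} {e : T.Node ≃ Fin T.numNodes} {x : ℝ}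
    {σ : NatState} {S : List T.Node} {s : RamState w} (h : Holds e (T.xCount x) σ S) (hs : Rep s σ)
    (hS : S.length ≤ 2 ^ w) : s.HoldsSizes S (fun v => v.prefixList x) := by
  refine fun j hj => BitVec.eq_ofNat_of_toNat_eq ?_
  rw [hs.2.2 1 j (by omega), (h.2 j hj).2, Node.prefixList_length]

theorem mainTheorem8 (β : ℝ) :
    ∃ A : ℝ, ∀ ε : ℝ, 0 < ε →
      ∃ (C : ℕ) (locate sizes report : RamProg),
        ∀ (P : Finset (ℝ × ℝ)) (T : RangeTree),
          GeneralPosition P → T.IsOver P → (T.height : ℝ) ≤ β * lg P.card →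
          ∀ w : ℕ, C * P.card ≤ 2 ^ w →
          ∀ e : T.Node ≃ Fin T.numNodes,
            ∃ X : List (List (BitVec w)),
              X.flatten.length ≤ C * P.card ∧
              ∀ q : ℝ × ℝ, ∃ (S : List T.Node) (L : T.Node → List (ℝ × ℝ)),
                IsPrefixPartition P q S L ∧
                (S.length : ℝ) ≤ A * lg P.card ∧
                -- locating the nodes, then computing the sizes
                (∀ s : RamState w, s.creg 0 = q.1 → s.creg 1 = q.2 →
                  ∃ (s₁ : RamState w) (t₁ : ℕ),
                    RamProg.Exec (T.augmented w e X) locate s s₁ t₁ ∧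
                    (t₁ : ℝ) ≤ A * lg P.card ∧
                    s₁.HoldsNodes e S ∧
                    ∃ (s₂ : RamState w) (t₂ : ℕ),
                      RamProg.Exec (T.augmented w e X) sizes s₁ s₂ t₂ ∧
                      (t₂ : ℝ) ≤ A * lg P.card ∧
                      s₂.HoldsNodes e S ∧ s₂.HoldsSizes S L) ∧
                -- reporting a point
                (∀ v ∈ S, ∀ (i : ℕ) (hi : i < (L v).length), ∀ s : RamState w,
                  s.reg 0 = BitVec.ofNat w (e v) → s.reg 1 = BitVec.ofNat w i →
                  ∃ (s' : RamState w) (t : ℕ),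
                    RamProg.Exec (T.augmented w e X) report s s' t ∧
                    (t : ℝ) ≤ C * lg P.card ^ ε ∧
                    s'.creg 0 = (L v)[i].1 ∧ s'.creg 1 = (L v)[i].2) := by
  obtain ⟨γ, hγ⟩ := exists_nat_ge β
  -- This is `locateTime` with the bit length replaced by `2 * lg` and the height by `γ * lg`, with
  -- room for the size of S. It is fixed before ε because the locating code does not involve `k`.
  refine ⟨(2 * (searchBody.stepCost + 1) + γ * (descendBody.stepCost + 1) + lastLeafProg.stepCost +
    40 + γ + 2 : ℕ), fun ε hε => ?_⟩
  obtain ⟨k, hk⟩ := exists_nat_ge (1 / ε)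
  -- The three summands pay for the size of the tables, the required word length, and the reporting
  -- time. The program for sizes is `skip`, as locating has already written them.
  refine ⟨(8 + 5 * k) * arrayBound k γ + (arrayBound k γ + 12) + (γ + 2) * reportFactor k,
    locateProg, .skip, reportProg k, fun P T hP hT hβ w hw e => ?_⟩
  have hX := hT.xInj hP
  have hn := T.leaves_length_pos
  rw [← hT.length_eq] at hβ hw ⊢
  have hl := one_le_lg T.leaves.length
  have hHlg : (T.height : ℝ) ≤ γ * lg T.leaves.length :=
    hβ.trans (mul_le_mul_of_nonneg_right hγ (by linarith))
  have hH : T.height ≤ γ * (Nat.log 2 T.leaves.length + 1) := by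
    have := hHlg.trans (mul_le_mul_of_nonneg_left (lg_le_log_add_one T.leaves.length)
      (Nat.cast_nonneg γ))
    exact_mod_cast this
  obtain ⟨B, hB0, hBH, hB1⟩ := exists_base k T.height
  have hlog : Nat.log 2 T.leaves.length ≤ T.height := by
    have := Nat.log_mono_right (b := 2) T.length_le_two_pow_height
    rwa [Nat.log_pow (by norm_num)] at this
  -- A binary tree with n leaves has height at least log n, so log n ≤ H < B^(k+1), and B ≤ 2^B.
  have hL : Nat.log 2 T.leaves.length + 1 ≤ 2 ^ ((k + 1) * B) := by
    calc Nat.log 2 T.leaves.length + 1 ≤ B ^ (k + 1) := by omega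
      _ ≤ (2 ^ B) ^ (k + 1) := Nat.pow_le_pow_left Nat.lt_two_pow_self.le _
      _ = _ := by rw [← pow_mul, Nat.mul_comm]
  have hLn : Nat.log 2 T.leaves.length + 1 ≤ T.leaves.length :=
    Nat.succ_le_of_lt (Nat.log_lt_self 2 hn.ne')
  have hw' : (arrayBound k γ + 12) * T.leaves.length ≤ 2 ^ w :=
    (Nat.mul_le_mul_right _ (by omega)).trans hw
  obtain ⟨X, hXlen, M⟩ := T.exists_storedTree hX e k γ B w hB0 hH hL
    (base_pow_le hn hB0 (hH.trans (Nat.mul_le_mul_left _ hLn)) hB1) hw'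
  refine ⟨X, ?_, fun q => ?_⟩
  · refine hXlen.trans ?_
    rw [← Nat.mul_assoc]
    exact Nat.mul_le_mul_right _ (by omega)
  obtain ⟨S, hcov, hlen, hrun⟩ := M.locateProg_spec hX hT.1 q (Nat.log 2 T.leaves.length + 1)
    (Nat.lt_pow_succ_log_self (by norm_num) _)
  have hbound := M.bound
  have hSw : S.length ≤ 2 ^ w := by omega
  have hSlg : (S.length : ℝ) ≤ (γ + 1) * lg T.leaves.length := by
    have : (S.length : ℝ) ≤ T.height + 1 := by exact_mod_cast hlen
    nlinarith
  have hlog2 := log_add_one_le_lg hn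
  have hpos : ∀ x : ℕ, (0 : ℝ) ≤ x := fun x => Nat.cast_nonneg x
  refine ⟨S, fun v => v.prefixList q.1, hcov.isPrefixPartition hT.2 hT.nodup, ?_, ?_, ?_⟩
  · refine hSlg.trans (mul_le_mul_of_nonneg_right ?_ (by linarith))
    exact_mod_cast (by nlinarith [Nat.zero_le (γ * (descendBody.stepCost + 1))] :
      γ + 1 ≤ 2 * (searchBody.stepCost + 1) + γ * (descendBody.stepCost + 1) +
        lastLeafProg.stepCost + 40 + γ + 2)
  · intro s hx hy
    obtain ⟨s₁, t₁, hexec, ht, σ, hrep, hholds⟩ := hrun (ofState s) hx hy s (rep_ofState s)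
    refine ⟨s₁, t₁, hexec, ?_, hholds.holdsNodes hrep hSw, s₁, 1, .skip s₁, ?_,
      hholds.holdsNodes hrep hSw, hholds.holdsSizes hrep hSw⟩
    · have h1 : (t₁ : ℝ) ≤ ((Nat.log 2 T.leaves.length + 1 : ℕ) : ℝ) * (searchBody.stepCost + 1) +
          T.height * (descendBody.stepCost + 1) + lastLeafProg.stepCost + 40 := by
        exact_mod_cast ht
      have h2 := mul_le_mul_of_nonneg_right hlog2
        (by have := hpos searchBody.stepCost; linarith : (0 : ℝ) ≤ searchBody.stepCost + 1)
      have h3 := mul_le_mul_of_nonneg_right hHlg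
        (by have := hpos descendBody.stepCost; linarith : (0 : ℝ) ≤ descendBody.stepCost + 1)
      have h4 := mul_le_mul_of_nonneg_left hl (hpos lastLeafProg.stepCost)
      have h5 := mul_nonneg (hpos γ) (by linarith : (0 : ℝ) ≤ lg T.leaves.length)
      push_cast at h1 h2 h3 ⊢
      nlinarith
    · have h1 : (1 : ℝ) ≤ ((2 * (searchBody.stepCost + 1) + γ * (descendBody.stepCost + 1) +
          lastLeafProg.stepCost + 40 + γ + 2 : ℕ) : ℝ) := by
        exact_mod_cast Nat.succ_le_of_lt (Nat.succ_pos _)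
      push_cast at h1 ⊢
      nlinarith
  · intro v _ i hi s h0 h1
    have hpre := v.prefixList_prefix q.1
    have hip : i < v.pointList.length := hi.trans_le hpre.length_le
    have hsz : v.pointList.length = v.size := v.pointList_perm.length_eq
    have hvs := v.start_add_size_le
    have hnn := T.numNodes_add_one
    have hev := (e v).isLt
    obtain ⟨s', t, hexec, ht, σ, hrep, a0, a1⟩ := M.reportProg_spec hX hB0 (fun _ => rfl) hBH hip
      (σ := ofState s) (by
        show (s.reg 0).toNat = e v
        rw [h0, BitVec.toNat_ofNat, Nat.mod_eq_of_lt (by omega)]) (by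
        show (s.reg 1).toNat = i
        rw [h1, BitVec.toNat_ofNat, Nat.mod_eq_of_lt (by omega)]) s (rep_ofState s)
    have hget : (v.prefixList q.1)[i] = v.pointList[i] := hpre.getElem hi
    refine ⟨s', t, hexec, ?_, ?_, ?_⟩
    · have h2 : (t : ℝ) ≤ B * reportFactor k := by exact_mod_cast ht.trans (reportTime_le hB0)
      have h3 := base_le_rpow hl hε hk hHlg hB1
      have h4 : (B : ℝ) * reportFactor k ≤ (γ + 2) * lg T.leaves.length ^ ε * reportFactor k :=
        mul_le_mul_of_nonneg_right h3 (hpos _)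
      have h5 : (0 : ℝ) ≤ lg T.leaves.length ^ ε := Real.rpow_nonneg (by linarith) _
      have h6 : (((γ + 2) * reportFactor k : ℕ) : ℝ) ≤ (((8 + 5 * k) * arrayBound k γ +
          (arrayBound k γ + 12) + (γ + 2) * reportFactor k : ℕ) : ℝ) := by
        exact_mod_cast Nat.le_add_left _ _
      have h7 := mul_le_mul_of_nonneg_right h6 h5
      refine h2.trans (h4.trans (le_trans (le_of_eq ?_) h7))
      push_cast; ring
    · rw [hrep.2.1, a0]; exact congrArg Prod.fst hget.symm
    · rw [hrep.2.1, a1]; exact congrArg Prod.snd hget.symm
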